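/- **Setting.** Let $\Gamma$ be the rose with $r$ petals, with oriented edges $E_i^{\pm1}$; we identify a direction at the vertex with the oriented edge that it starts, and write $\bar x$ for $x$ with the opposite orientation. A *proper full fold* with data $(u,a)$, where $u,a$ are oriented edges and $a\ne u,\bar u$, is the map of roses $u\mapsto a\,u$ that sends every other edge $x\neq u,\bar u$ to $x$. An *$(r;\tfrac32-r)$ ltt structure* $G$ is a simple graph of coloured edges on the $2r$ directions, together with one black edge $[d,\bar d]$ for every edge pair, with a unique red vertex $d^u$ (the other vertices are purple) and a unique red edge $[d^u,\overline{d^a}]$ (a coloured edge is red if it has a red endpoint, purple otherwise), such that the purple subgraph is connected. It is *birecurrent* if some line that alternates between black and coloured edges crosses every edge infinitely often in both directions. For a fold $f$ with data $(u,a)$, $(f,G_0,G_1)$ is a *generating triple* if $u$ is the red vertex and $[u,\bar a]$ the red edge of $G_1$, and the direction map $Df$ maps coloured edges of $G_0$ to coloured edges of $G_1$ and restricts to an isomorphism of the purple subgraphs. It is an *extension* (resp. a *switch*) if moreover, for some purple edge $[a,l]$ of $G_1$, the red vertex of $G_0$ is $u$ (resp. $a$), the red edge of $G_0$ is $[u,l]$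 (resp. $[a,l]$), and, for an extension, $Df$ is the identity on the purple vertices of $G_0$. An *ideally decomposed admissible composition* consists of folds $g_k$ with data $(u_k,a_k)$ and birecurrent $(r;\tfrac32-r)$ ltt structures $G_k$, $k\in\mathbf Z/n$, $n\geq1$, such that every $(g_k,G_{k-1},G_k)$ is an extension or a switch. Put $g=g_n\circ\dots\circ g_1$, $T_k=\{u_{k+1},a_{k+1}\}$, and $g_{N,1}=g_N\circ\dots\circ g_1$ for all $N\ge0$ (indices mod $n$). Assume that $g$ is an irreducible train track map (its transition matrix is irreducible, and no power of $g$ creates cancellation in the image of an edge). Then there are edge lengths $\ell>0$ and $\lambda$ with $\ell(g(e))=\lambda\,\ell(e)$ for all edges $e$; fix any such, and take $g$ to be linear on edges. A *pNp* is a nontrivial tight path $\rho$, possibly starting and ending inside edges, with $g^k(\rho)\simeq\rho$ rel endpoints for some $k\ge1$. An *ipNp* is a pNp that is not a concatenation of two pNps. Tight paths are identified when they agree up to reparametrization. **Procedure, with bound $b$.** It builds *prospective pairs* $(\rho_1,\rho_2)$ of edge words, the beginnings of the two sides of a prospective ipNp $\bar\rho_1\rho_2$ (whose end edges may be partial), starting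 with $(u_1,a_1)$, i.e. with the turn $T_0$. Adding $e$ to $\rho_i$ is *legal* if $e\neq\bar x$ and $\{\bar x,e\}\ne T_0$, where $x$ is the last edge of $\rho_i$. (I), (II) Apply $g_1,g_2,\dots$ (that is, $g_{N,1}$ for $N=0,1,\dots$) and remove the common initial path of $g_{N,1}(\rho_1)$ and $g_{N,1}(\rho_2)$. Continue as long as both remainders are nonempty and start with the turn $T_N$; (a) if this holds up to $N=pn$, $p\geq1$, and the remainders start with the first edges of $\rho_1$ and $\rho_2$ respectively, then (IV) applies; (b) if one image is a proper initial subpath of the other, go to (III); (c) if the remainders start with a nondegenerate turn other than $T_N$, the pair is ruled out. (III) If $g_{N,1}(\rho_1)=g_{N,1}(\rho_2)\,t\cdots$ with $t$ an edge (or with the roles exchanged), replace $\rho_2$ by $\rho_2e$ for each edge $e$ that can be added legally and satisfies: (a) $\{Dg_{N,1}(e),t\}=T_N$ if $t$ is the red vertex of $G_N$; (b) $Dg_{N,1}(e)=t$ otherwise. The pair is ruled out if every resulting pair is (for instance, if there is none). (IV) Suppose (IIa) holds for $p$, with $g^p(\rho_1)=\tau\gamma_1$ and $g^p(\rho_2)=\tau\gamma_2$.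 (a) If $\gamma_1=\rho_1$ and $\gamma_2=\rho_2$, output $\bar\rho_1\rho_2$. (c) If $\rho_1,\rho_2$ are initial subpaths of $\gamma_1,\gamma_2$, not both equal, replace the last edges of $\rho_1$ and $\rho_2$ by partial edges that end at fixed points of $g^p$ (points whose image is at the same distance along $\gamma_i$ as the point along $\rho_i$), if there are such, and output the resulting path. (b), (d) If, on each of the sides $i=1,2$, one of $\rho_i,\gamma_i$ is an initial subpath of the other, apply (V) to each side on which $\gamma_i$ is properly shorter. (V) If $\gamma_i t$ is an initial subpath of $\rho_i$, with $t$ an edge, replace $\rho_i$ by $\rho_ie$ for each edge $e$ with $Dg^p(e)=t$ that can be added legally. (VI) Treat all the prospective pairs that arise in this way. In a search with bound $b$, only the powers $p\le b$ and the times $N\le bn$ are examined. **Claim.** 1. Only finitely many prospective pairs arise, for all bounds $b$ together. 2. Whatever $b$ is, every path that is output is an ipNp of $g$, and it is the only ipNp of $g$ up to orientation. 3. There is a bound $b$ for which the procedure outputs every ipNp of $g$, up to orientation. Moreover, $b$ can be chosen so that, if a prospective pair that arises (with any bound) starts with the turn $T_N$, after removal of the common initial path, at all times $N\le bn$, and if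 for no $p\leq b$ with (IIa) the words $\rho_i,\gamma_i$ are comparable (one an initial subpath of the other) on both sides, then the pair does not belong to any ipNp. 4. A prospective pair that arises and is ruled out by (IIc) and (III) does not belong to any ipNp. 5. The following are equivalent: $g$ has no pNp; $g$ has no ipNp; the procedure has no output, for any bound; the initial pair $(u_1,a_1)$ is ruled out by finitely many applications of (IIc) and (III). In particular, the procedure can certify that $g$ has no pNps. Here a pair $(\rho_1,\rho_2)$ *belongs to* an ipNp $\rho$ if $\rho=\bar\sigma_1\sigma_2$, where the edge words of $\sigma_1,\sigma_2$ (last edges possibly partial) begin with $\rho_1,\rho_2$. -/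

import Mathlib

namespace PeriodicNielsen

/-! ### Roses, directions, edge words -/

/-- The oriented edges of the `r`-petaled rose. `(i, true)` is the edge `E_i` and `(i, false)` the
same edge with the opposite orientation. A direction at the vertex is identified with the oriented
edge that it starts. -/
abbrev Dir (r : ℕ) := Fin r × Bool

/-- An edge path of the rose, written as the list of its oriented edges (not necessarily tight;
it is tight when `FreeGroup.IsReduced` holds). The inverse path is `FreeGroup.invRev`. -/
abbrev EdgeWord (r : ℕ) := List (Dir r)

/-- The same edge with the opposite orientation. -/
def bar {r : ℕ} (x : Dir r) : Dir r := (x.1, !x.2)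

/-! ### Proper full folds -/

/-- A proper full fold of edge-indexed roses: `e^pu ↦ e^a e^u`, every other edge goes to the edge
with the same label. Here `u` is the common label of `e^pu` and `e^u`, and `a` the common label of
`e^pa` and `e^a`. -/
structure Fold (r : ℕ) where
  u : Dir r
  a : Dir r
  ne : a ≠ u
  ne_bar : a ≠ bar u

namespace Fold
variable {r : ℕ}

/-- The image of an oriented edge. -/
def image (f : Fold r) (x : Dir r) : EdgeWord r :=
  if x = f.u then [f.a, f.u] else if x = bar f.u then [bar f.u, bar f.a] else [x]

/-- The image of an edge path, without tightening. -/
def mapWord (f : Fold r) (w : EdgeWord r) : EdgeWord r := w.flatMap f.image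

/-- The induced map of directions. -/
def dir (f : Fold r) (x : Dir r) : Dir r := if x = f.u then f.a else x

theorem head_image (f : Fold r) (x : Dir r) : (f.image x).head? = some (f.dir x) := by
  unfold image dir
  split_ifs <;> simp_all

end Fold

/-! ### Lamination train track structures -/

/-- A lamination train track structure based at the `r`-petaled rose. The vertices are the
directions, each of them red or purple. There is one black edge `[d, bar d]` for every edge pair
(left implicit), and `colored` is the graph of colored edges, at most one for each pair of
vertices. A colored edge is red if it has a red endpoint, and purple otherwise. -/
structure LTT (r : ℕ) where
  colored : SimpleGraph (Dir r)
  red : Set (Dir r)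

namespace LTT
variable {r : ℕ}

/-- `G` is an `(r; 3/2 - r)` ltt structure: there are a unique red vertex (hence `2r - 1` purple
ones) and a unique red edge, and the purple subgraph is connected. -/
structure IsType (G : LTT r) : Prop where
  red_vertex : ∃! d, d ∈ G.red
  red_edge : ∃! e : Sym2 (Dir r), e ∈ G.colored.edgeSet ∧ ∃ d ∈ e, d ∈ G.red
  connected : (G.colored.induce G.redᶜ).Connected

/-- Birecurrence: some locally smoothly embedded line (one that alternates between black and
colored edges) traverses every edge infinitely often in both of its ends. The line is given by the
sequence of black edges that it traverses; between `line i` and `line (i + 1)` it crosses the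
colored edge from `bar (line i)` to `line (i + 1)`. -/
def Birecurrent (G : LTT r) : Prop :=
  ∃ line : ℤ → Dir r,
    (∀ i, G.colored.Adj (bar (line i)) (line (i + 1))) ∧
    (∀ d : Dir r, ∀ N : ℤ,
      (∃ i, N ≤ i ∧ (line i = d ∨ line i = bar d)) ∧
      (∃ i, i ≤ N ∧ (line i = d ∨ line i = bar d))) ∧
    (∀ d d' : Dir r, G.colored.Adj d d' → ∀ N : ℤ,
      (∃ i, N ≤ i ∧ s(bar (line i), line (i + 1)) = s(d, d')) ∧
      (∃ i, i ≤ N ∧ s(bar (line i), line (i + 1)) = s(d, d')))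

/-- `(f, G₀, G₁)` is a generating triple. -/
structure IsGeneratingTriple (f : Fold r) (G₀ G₁ : LTT r) : Prop where
  type_source : G₀.IsType
  type_dest : G₁.IsType
  /-- `e^u` starts in the unachieved direction `d^u` (the red vertex) of `G₁` -/
  unachieved : f.u ∈ G₁.red
  /-- `e^a` starts in the twice-achieved direction `d^a` of `G₁`: the red edge is
  `[d^u, bar d^a]` -/
  twice_achieved : G₁.colored.Adj f.u (bar f.a)
  /-- the induced map of ltt structures exists -/
  induced : ∀ d d', G₀.colored.Adj d d' → G₁.colored.Adj (f.dir d) (f.dir d')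
  /-- it restricts to an isomorphism of the purple subgraphs -/
  bijOn : Set.BijOn f.dir G₀.redᶜ G₁.redᶜ
  iso : ∀ d ∈ G₀.redᶜ, ∀ d' ∈ G₀.redᶜ,
    (G₀.colored.Adj d d' ↔ G₁.colored.Adj (f.dir d) (f.dir d'))

/-- `(f, G₀, G₁)` is the extension determined by some purple edge `[d^a, l]` of `G₁`. -/
def IsExtension (f : Fold r) (G₀ G₁ : LTT r) : Prop :=
  IsGeneratingTriple f G₀ G₁ ∧ ∃ l : Dir r,
    (G₁.colored.Adj f.a l ∧ f.a ∉ G₁.red ∧ l ∉ G₁.red) ∧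
    (∀ d ∈ G₀.redᶜ, f.dir d = d) ∧ f.u ∈ G₀.red ∧ G₀.colored.Adj f.u l

/-- `(f, G₀, G₁)` is the switch determined by some purple edge `[d^a, l]` of `G₁`. -/
def IsSwitch (f : Fold r) (G₀ G₁ : LTT r) : Prop :=
  IsGeneratingTriple f G₀ G₁ ∧ ∃ l : Dir r,
    (G₁.colored.Adj f.a l ∧ f.a ∉ G₁.red ∧ l ∉ G₁.red) ∧
    f.u ∉ G₀.red ∧ f.a ∈ G₀.red ∧ G₀.colored.Adj f.a l

end LTT

/-! ### Ideally decomposed admissible compositions -/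

/-- An ideally decomposed admissible composition `(g_1, …, g_n; G_0, …, G_n)`, with
`g_k : Γ_(k-1) → Γ_k`. The indices are read cyclically, in `ℤ/n`; in particular `Γ_n = Γ_0` and
`G_n = G_0`. -/
structure AdmissibleComposition (r n : ℕ) where
  fold : ZMod n → Fold r
  G : ZMod n → LTT r
  step : ∀ k, LTT.IsExtension (fold k) (G (k - 1)) (G k) ∨ LTT.IsSwitch (fold k) (G (k - 1)) (G k)
  birecurrent : ∀ k, (G k).Birecurrent

/-- A path in the metric rose: the part of the unit speed edge path `word` between the arc length
parameters `a` and `b`. It may start and end inside edges. -/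
structure MPath (r : ℕ) where
  word : EdgeWord r
  a : ℝ
  b : ℝ

namespace AdmissibleComposition
variable {r n : ℕ} (c : AdmissibleComposition r n)

/-- `g_N ∘ ⋯ ∘ g_1` (indices mod `n`) on edge paths, without tightening. -/
def genWord : ℕ → EdgeWord r → EdgeWord r
  | 0, w => w
  | N + 1, w => (c.fold ((N + 1 : ℕ) : ZMod n)).mapWord (genWord N w)

/-- The direction map of `g_N ∘ ⋯ ∘ g_1` (indices mod `n`). -/
def genDir : ℕ → Dir r → Dir r
  | 0, x => x
  | N + 1, x => (c.fold ((N + 1 : ℕ) : ZMod n)).dir (genDir N x)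

/-- `g ^ p` on edge paths, without tightening, where `g = g_n ∘ ⋯ ∘ g_1`. -/
def powWord (p : ℕ) (w : EdgeWord r) : EdgeWord r := c.genWord (p * n) w

/-- The direction map of `g ^ p`. -/
def powDir (p : ℕ) (x : Dir r) : Dir r := c.genDir (p * n) x

/-- The turn `T_k = {d^pu_k, d^pa_k}` of `Γ_k`, which is folded by `g_(k+1)`. -/
def turn (k : ZMod n) : Sym2 (Dir r) := s((c.fold (k + 1)).u, (c.fold (k + 1)).a)

/-- `g` is a train track map: every power is locally injective on the interior of each edge. -/
def IsTrainTrack : Prop := ∀ (k : ℕ) (x : Dir r), FreeGroup.IsReduced (c.powWord k [x])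

/-- The transition matrix of `g`: the `(i, j)` entry counts how often `g(E_j)` traverses `E_i`, in
either direction. -/
def transition : Matrix (Fin r) (Fin r) ℝ :=
  fun i j => (((c.powWord 1 [(j, true)]).countP (fun x => x.1 = i) : ℕ) : ℝ)

/-- A Perron–Frobenius metric: positive edge lengths for which `g` stretches every edge by the same
factor. With respect to it `g` is taken to be linear on edges. -/
structure Metric where
  len : Fin r → ℝ
  stretch : ℝ
  len_pos : ∀ i, 0 < len i
  eigen : ∀ j, ((c.powWord 1 [(j, true)]).map (fun x => len x.1)).sum = stretch * len j

namespace Metric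
variable {c} (m : c.Metric)

/-- The length of an edge path. -/
noncomputable def length (w : EdgeWord r) : ℝ := (w.map (fun x => m.len x.1)).sum

/-- The endpoint `q` of the initial part of arc length `s` of an edge path that starts at the
vertex, and the homotopy class of that part rel endpoints. A point of the rose is the vertex
(`none`) or a point at distance `t` (strictly between 0 and the length) along the edge `E_i`
(`some (i, t)`). The class is recorded as the element of the fundamental group at the vertex
obtained by returning from `q` to the vertex along the initial part of `E_i`. -/
noncomputable def locate : EdgeWord r → ℝ → FreeGroup (Fin r) × Option (Fin r × ℝ)
  | [], _ => (1, none)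
  | x :: w, s =>
    if s ≤ 0 then (1, none)
    else if s < m.len x.1 then
      (if x.2 then (1, some (x.1, s)) else (FreeGroup.mk [x], some (x.1, m.len x.1 - s)))
    else (FreeGroup.mk [x] * (locate w (s - m.len x.1)).1, (locate w (s - m.len x.1)).2)

/-- Homotopy rel endpoints: the endpoints agree, and so do the classes of the paths, closed up to
loops at the vertex along initial parts of edges. -/
def Homotopic (ρ σ : MPath r) : Prop :=
  (m.locate ρ.word ρ.a).2 = (m.locate σ.word σ.a).2 ∧
  (m.locate ρ.word ρ.b).2 = (m.locate σ.word σ.b).2 ∧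
  (m.locate ρ.word ρ.a).1⁻¹ * (m.locate ρ.word ρ.b).1 =
    (m.locate σ.word σ.a).1⁻¹ * (m.locate σ.word σ.b).1

/-- A nontrivial tight path. A homotopy class rel endpoints contains at most one such path up to
reparametrization, so `Homotopic` is equality for tight paths. -/
def IsTight (ρ : MPath r) : Prop :=
  FreeGroup.IsReduced ρ.word ∧ 0 ≤ ρ.a ∧ ρ.a < ρ.b ∧ ρ.b ≤ m.length ρ.word

/-- The image of a path under `g ^ k`, without tightening. -/
noncomputable def image (k : ℕ) (ρ : MPath r) : MPath r :=
  ⟨c.powWord k ρ.word, m.stretch ^ k * ρ.a, m.stretch ^ k * ρ.b⟩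

/-- The path traversed backwards. -/
noncomputable def reverse (ρ : MPath r) : MPath r :=
  ⟨FreeGroup.invRev ρ.word, m.length ρ.word - ρ.b, m.length ρ.word - ρ.a⟩

/-- A periodic Nielsen path (pNp): a nontrivial tight path that is homotopic rel endpoints to its
image under some `g ^ k`, `k ≥ 1`. -/
def IsPNP (ρ : MPath r) : Prop := m.IsTight ρ ∧ ∃ k, 0 < k ∧ m.Homotopic (m.image k ρ) ρ

/-- An indivisible periodic Nielsen path (ipNp): a pNp that is not a concatenation of two pNps. -/
def IsIPNP (ρ : MPath r) : Prop :=
  m.IsPNP ρ ∧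
    ¬ ∃ t, ρ.a < t ∧ t < ρ.b ∧ m.IsPNP ⟨ρ.word, ρ.a, t⟩ ∧ m.IsPNP ⟨ρ.word, t, ρ.b⟩

/-- The path `bar α β`, where `α` is the initial part of length `L₁` of the edge path `w₁` and `β`
is the initial part of length `L₂` of `w₂`. -/
noncomputable def vee (w₁ w₂ : EdgeWord r) (L₁ L₂ : ℝ) : MPath r :=
  ⟨FreeGroup.invRev w₁ ++ w₂, m.length w₁ - L₁, m.length w₁ + L₂⟩

/-- The initial part of length `L` of `w` ends in the last edge of `w`, after its initial point;
that is, it is `w` with the last edge possibly replaced by a partial edge. -/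
def EndsInLast (w : EdgeWord r) (L : ℝ) : Prop := m.length w.dropLast < L ∧ L ≤ m.length w

/-- `ρ` is of the form `bar ρ₁' ρ₂'`, where the edge words of `ρ₁'` and `ρ₂'` (whose last edges may
be partial) begin with `w₁` and `w₂`. -/
def Contains (ρ : MPath r) (w₁ w₂ : EdgeWord r) : Prop :=
  ∃ v₁ v₂ L₁ L₂, w₁ <+: v₁ ∧ w₂ <+: v₂ ∧ FreeGroup.IsReduced (FreeGroup.invRev v₁ ++ v₂) ∧
    m.EndsInLast v₁ L₁ ∧ m.EndsInLast v₂ L₂ ∧ m.Homotopic ρ (m.vee v₁ v₂ L₁ L₂)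

end Metric

/-! ### The procedure

A *prospective pair* `(w₁, w₂)` consists of the initial edge words found so far of the two legal
halves of a prospective ipNp `bar ρ₁ ρ₂`. -/

/-- After `g_N ∘ ⋯ ∘ g_1`, and after removal of the common initial path, what remains of both sides
begins with the turn `T_N`, so that one continues to compose generators. (When `N = p * n`, this
is the situation of (IIa).) -/
def AtTurn (N : ℕ) (w₁ w₂ : EdgeWord r) : Prop :=
  ∃ τ x v₁ y v₂, c.genWord N w₁ = τ ++ x :: v₁ ∧ c.genWord N w₂ = τ ++ y :: v₂ ∧
    s(x, y) = c.turn N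

/-- One has continued to compose generators up to (and not including) `g_N`. -/
def Running (N : ℕ) (w₁ w₂ : EdgeWord r) : Prop := ∀ k < N, c.AtTurn k w₁ w₂

/-- (I), (IIb): after `g_N ∘ ⋯ ∘ g_1`, and not before, the image of `w₂` is a proper initial subpath
of the image of `w₁`, and `t` is the next edge. -/
def Absorbed (N : ℕ) (w₁ w₂ : EdgeWord r) (t : Dir r) : Prop :=
  c.Running N w₁ w₂ ∧ ∃ v, c.genWord N w₁ = c.genWord N w₂ ++ t :: v

/-- (IIc): after `g_N ∘ ⋯ ∘ g_1`, and not before, what remains of both sides begins with a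
nondegenerate turn different from `T_N`. -/
def Diverges (N : ℕ) (w₁ w₂ : EdgeWord r) : Prop :=
  c.Running N w₁ w₂ ∧
  ∃ τ x v₁ y v₂, c.genWord N w₁ = τ ++ x :: v₁ ∧ c.genWord N w₂ = τ ++ y :: v₂ ∧
    x ≠ y ∧ s(x, y) ≠ c.turn N

/-- The edge word `w` followed by the edge `e` is still tight and does not take the illegal turn
`T_0` where `e` is attached. -/
def LegalNext (w : EdgeWord r) (e : Dir r) : Prop :=
  ∀ x ∈ w.getLast?, e ≠ bar x ∧ s(bar x, e) ≠ c.turn 0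

/-- (III): the possible next edges `e` of the side `w` that has been absorbed at time `N`, when `t`
is the next edge of the other side. (IIIa) is the case in which `t` starts in the unachieved
direction of `G_N`, and (IIIb) the other case. -/
def NextEdge (N : ℕ) (t : Dir r) (w : EdgeWord r) (e : Dir r) : Prop :=
  (t ∈ (c.G N).red → s(c.genDir N e, t) = c.turn N) ∧
  (t ∉ (c.G N).red → c.genDir N e = t) ∧
  c.LegalNext w e

/-- (IIa) with the hypothesis of (IV): one has continued to compose generators up to `g ^ p`,
`p ≥ 1`, and `g ^ p (w₁) = τ γ₁`, `g ^ p (w₂) = τ γ₂`, where `γ_i` begins with the first edge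
of `w_i`. -/
def Returns (p : ℕ) (w₁ w₂ τ γ₁ γ₂ : EdgeWord r) : Prop :=
  1 ≤ p ∧ c.Running (p * n) w₁ w₂ ∧
  c.powWord p w₁ = τ ++ γ₁ ∧ c.powWord p w₂ = τ ++ γ₂ ∧
  γ₁ ≠ [] ∧ γ₂ ≠ [] ∧ γ₁.head? = w₁.head? ∧ γ₂.head? = w₂.head?

/-- One of two edge words is an initial subpath of the other. -/
def Comparable (v w : EdgeWord r) : Prop := v <+: w ∨ w <+: v

/-- The prospective pairs that arise in the procedure, when the powers `g ^ p` with `p ≤ b` are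
examined. -/
inductive Arises (b : ℕ) : EdgeWord r → EdgeWord r → Prop
  /-- the first edges form the illegal turn `T_0` -/
  | start : Arises b [(c.fold 1).u] [(c.fold 1).a]
  /-- (III), second side absorbed -/
  | addRight (w₁ w₂ : EdgeWord r) (N : ℕ) (t e : Dir r) : Arises b w₁ w₂ → N ≤ b * n →
      c.Absorbed N w₁ w₂ t → c.NextEdge N t w₂ e → Arises b w₁ (w₂ ++ [e])
  /-- (III), first side absorbed -/
  | addLeft (w₁ w₂ : EdgeWord r) (N : ℕ) (t e : Dir r) : Arises b w₁ w₂ → N ≤ b * n →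
      c.Absorbed N w₂ w₁ t → c.NextEdge N t w₁ e → Arises b (w₁ ++ [e]) w₂
  /-- (IVb), (IVd) and (V), second side too short -/
  | shortRight (w₁ w₂ : EdgeWord r) (p : ℕ) (τ γ₁ γ₂ : EdgeWord r) (t e : Dir r) :
      Arises b w₁ w₂ → p ≤ b → c.Returns p w₁ w₂ τ γ₁ γ₂ →
      Comparable γ₁ w₁ → γ₂ ++ [t] <+: w₂ →
      c.powDir p e = t → c.LegalNext w₂ e → Arises b w₁ (w₂ ++ [e])
  /-- (IVb), (IVd) and (V), first side too short -/
  | shortLeft (w₁ w₂ : EdgeWord r) (p : ℕ) (τ γ₁ γ₂ : EdgeWord r) (t e : Dir r) :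
      Arises b w₁ w₂ → p ≤ b → c.Returns p w₁ w₂ τ γ₁ γ₂ →
      γ₁ ++ [t] <+: w₁ → Comparable γ₂ w₂ →
      c.powDir p e = t → c.LegalNext w₁ e → Arises b (w₁ ++ [e]) w₂

/-- (IVa) and (IVc): the paths that the procedure identifies as ipNps, when the powers `g ^ p` with
`p ≤ b` are examined. In (IVc) the last edges of `w₁` and `w₂` are replaced by partial edges that
end at fixed points of `g ^ p`: the point at distance `L_i` along `w_i` is fixed, in the sense that
its image lies at distance `L_i` along `γ_i` (which begins with `w_i`), so at distance
`length τ + L_i` along `g ^ p (w_i)`. -/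
inductive Finds (m : c.Metric) (b : ℕ) : MPath r → Prop
  | exact (w₁ w₂ : EdgeWord r) (p : ℕ) (τ : EdgeWord r) :
      c.Arises b w₁ w₂ → p ≤ b → c.Returns p w₁ w₂ τ w₁ w₂ →
      Finds m b (m.vee w₁ w₂ (m.length w₁) (m.length w₂))
  | trimmed (w₁ w₂ : EdgeWord r) (p : ℕ) (τ γ₁ γ₂ : EdgeWord r) (L₁ L₂ : ℝ) :
      c.Arises b w₁ w₂ → p ≤ b → c.Returns p w₁ w₂ τ γ₁ γ₂ →
      w₁ <+: γ₁ → w₂ <+: γ₂ → ¬ (γ₁ = w₁ ∧ γ₂ = w₂) →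
      m.EndsInLast w₁ L₁ → m.EndsInLast w₂ L₂ →
      m.stretch ^ p * L₁ = m.length τ + L₁ → m.stretch ^ p * L₂ = m.length τ + L₂ →
      Finds m b (m.vee w₁ w₂ L₁ L₂)

/-- (VI): a prospective pair is ruled out, in finitely many steps, if (IIc) occurs for it, or if
(III) occurs and every choice of the next edge is ruled out (for instance, as there is none). -/
inductive RuledOut : EdgeWord r → EdgeWord r → Prop
  | diverges (w₁ w₂ : EdgeWord r) (N : ℕ) : c.Diverges N w₁ w₂ → RuledOut w₁ w₂
  | right (w₁ w₂ : EdgeWord r) (N : ℕ) (t : Dir r) : c.Absorbed N w₁ w₂ t →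
      (∀ e, c.NextEdge N t w₂ e → RuledOut w₁ (w₂ ++ [e])) → RuledOut w₁ w₂
  | left (w₁ w₂ : EdgeWord r) (N : ℕ) (t : Dir r) : c.Absorbed N w₂ w₁ t →
      (∀ e, c.NextEdge N t w₁ e → RuledOut (w₁ ++ [e]) w₂) → RuledOut w₁ w₂

end AdmissibleComposition

end PeriodicNielsen

/-! ### Edge words and folds -/

namespace PeriodicNielsen

variable {r n : ℕ}

/-! Two facts about the turns T_N drive the proof. T_N contains the red vertex u_N, which is not in
the image of Dg_N, so no pair of image directions is T_N. The red edge at u_N, which is the turn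
created inside the image a_N u_N, is not T_N either, because g_{N+1} collapses T_N and maps coloured
edges to coloured edges. Hence tight words without T_N go to tight words without T_{N+1}
(`Legal.mapWord`). As T_N is the only turn that g_{N+1} collapses, two sides that start with T_0 run
through the turns T_N forever, or one of them is absorbed, or they separate for good (`AtTau.succ`).
The path `tau N` removed on the way does not depend on the pair.

Let λ > 1 be the stretch factor and L = |tau n| / (λ - 1) (`halfLength`). Then |tau (pn)| = (λ^p -
1) L, so L is the only length with λ^p L = |tau (pn)| + L. Comparing lengths, an absorbed side is
shorter than L, and so is a side to which (V) adds an edge, while both sides of a pair that runs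
forever have length at least L. So edges are only added to sides shorter than L, which leaves
finitely many prospective pairs. By pigeonhole, a pair that runs forever produces a periodic pair
(`GoodPair`): legal words p_1, p_2 cut off in the edge at distance L, such that tau p_i is an
initial subpath of g^K(p_i). A periodic side is determined by its first edge (`side_unique`), so
there is at most one such pair. The procedure reaches it if it exists, and otherwise the finite
search tree is ruled out.

It remains to identify ipNps with the periodic pair. After trimming the word w of a pNp and passing
to an even power, g^K(w) tightens to σ w σ'. The number of turns T_N in the tightened images never
increases, and here it cannot drop, since σ w σ' contains w. So the segments between consecutive
turns T_0 persist, and an inner segment W satisfies g^K(W) = τ W τ⁻¹ with τ = tau (Kn). Thus around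
every turn T_0 of a pNp lies a copy of the periodic pair, with length L on either side, and its
endpoints are fixed, so the pNp splits there unless it equals the copy. A pNp has such a turn, as a
legal word is stretched too much. So pNps, ipNps, outputs and periodic pairs exist or fail to exist
together. -/

@[simp] theorem bar_bar (x : Dir r) : bar (bar x) = x := by simp [bar]

@[simp] theorem bar_fst (x : Dir r) : (bar x).1 = x.1 := rfl

theorem bar_inj {x y : Dir r} : bar x = bar y ↔ x = y :=
  ⟨fun h => by simpa using congrArg bar h, fun h => by rw [h]⟩

theorem bar_ne (x : Dir r) : bar x ≠ x := by
  intro h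
  have := congrArg Prod.snd h
  simp [bar] at this

theorem eq_or_eq_bar {x y : Dir r} (h : x.1 = y.1) : x = y ∨ x = bar y := by
  rcases x with ⟨i, s⟩
  rcases y with ⟨j, t⟩
  simp only at h
  subst h
  cases s <;> cases t <;> simp [bar]

theorem invRev_singleton (x : Dir r) : FreeGroup.invRev [x] = [bar x] := rfl

theorem invRev_cons' (x : Dir r) (w : EdgeWord r) :
    FreeGroup.invRev (x :: w) = FreeGroup.invRev w ++ [bar x] := by
  rw [FreeGroup.invRev_cons, invRev_singleton]

theorem getLast?_invRev (w : EdgeWord r) :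
    (FreeGroup.invRev w).getLast? = w.head?.map bar := by
  cases w <;> simp [invRev_cons']

theorem head?_invRev (w : EdgeWord r) :
    (FreeGroup.invRev w).head? = w.getLast?.map bar := by
  conv_rhs => rw [← FreeGroup.invRev_invRev (L₁ := w), getLast?_invRev]
  simp [Option.map_map, Function.comp_def]

theorem invRev_eq_nil {w : EdgeWord r} : FreeGroup.invRev w = [] ↔ w = [] := by
  simp [FreeGroup.invRev]

theorem mk_invRev_mul (w : EdgeWord r) :
    FreeGroup.mk (FreeGroup.invRev w) = (FreeGroup.mk w)⁻¹ := FreeGroup.inv_mk.symm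

theorem mk_append (v w : EdgeWord r) :
    FreeGroup.mk (v ++ w) = FreeGroup.mk v * FreeGroup.mk w := FreeGroup.mul_mk.symm

theorem isReduced_iff_isChain {w : EdgeWord r} :
    FreeGroup.IsReduced w ↔ w.IsChain (fun x y => y ≠ bar x) := by
  unfold FreeGroup.IsReduced
  apply List.IsChain.iff
  rintro ⟨i, s⟩ ⟨j, t⟩
  cases s <;> cases t <;> simp [bar, eq_comm]

theorem eq_of_mk_eq {v w : EdgeWord r} (hv : FreeGroup.IsReduced v) (hw : FreeGroup.IsReduced w)
    (h : FreeGroup.mk v = FreeGroup.mk w) : v = w := by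
  rw [← hv.reduce_eq, ← hw.reduce_eq]
  exact FreeGroup.reduce.sound h

namespace Fold

variable (f : Fold r)

@[simp] theorem mapWord_nil : f.mapWord [] = [] := rfl

@[simp] theorem mapWord_cons (x : Dir r) (w : EdgeWord r) :
    f.mapWord (x :: w) = f.image x ++ f.mapWord w := rfl

@[simp] theorem mapWord_append (v w : EdgeWord r) :
    f.mapWord (v ++ w) = f.mapWord v ++ f.mapWord w := by simp [mapWord]

theorem image_u : f.image f.u = [f.a, f.u] := by simp [image]

theorem image_bar_u : f.image (bar f.u) = [bar f.u, bar f.a] := by simp [image, bar_ne]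

theorem image_of_ne {x : Dir r} (h : x ≠ f.u) (h' : x ≠ bar f.u) : f.image x = [x] := by
  simp [image, h, h']

theorem image_a : f.image f.a = [f.a] := f.image_of_ne f.ne f.ne_bar

theorem image_bar (x : Dir r) : f.image (bar x) = FreeGroup.invRev (f.image x) := by
  by_cases h : x = f.u
  · subst h; rw [image_u, image_bar_u]; rfl
  by_cases h' : x = bar f.u
  · subst h'; rw [bar_bar, image_u, image_bar_u]; simp [invRev_cons']
  · rw [image_of_ne f h h', image_of_ne f, invRev_singleton]
    · exact fun h2 => h' (by rw [← h2, bar_bar])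
    · rwa [Ne, bar_inj]

theorem mapWord_invRev (w : EdgeWord r) :
    f.mapWord (FreeGroup.invRev w) = FreeGroup.invRev (f.mapWord w) := by
  induction w with
  | nil => rfl
  | cons x w ih =>
    rw [invRev_cons', mapWord_append, ih, mapWord_cons, mapWord_cons, FreeGroup.invRev_append,
      image_bar, mapWord_nil, List.append_nil]

theorem head?_mapWord (w : EdgeWord r) : (f.mapWord w).head? = w.head?.map f.dir := by
  cases w with
  | nil => rfl
  | cons x w => simp [List.head?_append, head_image]

theorem getLast?_mapWord (w : EdgeWord r) :
    (f.mapWord w).getLast? = w.getLast?.map (fun x => bar (f.dir (bar x))) := by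
  have h := f.head?_mapWord (FreeGroup.invRev w)
  rw [mapWord_invRev, head?_invRev, head?_invRev] at h
  have h2 := congrArg (Option.map bar) h
  simpa [Option.map_map, Function.comp_def] using h2

theorem dir_ne_u (x : Dir r) : f.dir x ≠ f.u := by
  unfold dir; split_ifs with h
  · exact f.ne
  · exact h

@[simp] theorem dir_u : f.dir f.u = f.a := by simp [dir]

@[simp] theorem dir_a : f.dir f.a = f.a := by simp [dir]

theorem dir_eq_dir {x y : Dir r} (h : f.dir x = f.dir y) : x = y ∨ s(x, y) = s(f.u, f.a) := by
  unfold dir at h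
  split_ifs at h with h1 h2 h2
  · exact Or.inl (h1.trans h2.symm)
  · right; rw [h1, ← h]
  · right; rw [h2, h]; exact Sym2.eq_swap
  · exact Or.inl h

end Fold

/-! ### Legal words and the turns T_N -/

namespace AdmissibleComposition

variable (c : AdmissibleComposition r n)

theorem generating (k : ZMod n) :
    LTT.IsGeneratingTriple (c.fold k) (c.G (k - 1)) (c.G k) := by
  rcases c.step k with h | h
  · exact h.1
  · exact h.1

theorem mem_red_iff (k : ZMod n) (d : Dir r) : d ∈ (c.G k).red ↔ d = (c.fold k).u := by
  have h := c.generating k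
  refine ⟨fun hd => h.type_dest.red_vertex.unique hd h.unachieved, ?_⟩
  rintro rfl
  exact h.unachieved

/-- Otherwise both directions of T_k would be purple in G_k, although the next fold identifies them
and its direction map is injective on purple vertices. -/
theorem u_mem_turn (k : ZMod n) : (c.fold k).u ∈ c.turn k := by
  have h := c.generating (k + 1)
  rw [add_sub_cancel_right] at h
  by_contra hc
  unfold turn at hc
  rw [Sym2.mem_iff, not_or] at hc
  have hu : (c.fold (k + 1)).u ∈ (c.G k).redᶜ := by
    rw [Set.mem_compl_iff, mem_red_iff]; exact fun h => hc.1 h.symm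
  have ha : (c.fold (k + 1)).a ∈ (c.G k).redᶜ := by
    rw [Set.mem_compl_iff, mem_red_iff]; exact fun h => hc.2 h.symm
  exact (c.fold (k + 1)).ne (h.bijOn.injOn ha hu (by simp))

/-- The next fold collapses T_k to a point, whereas its direction map sends coloured edges to
coloured edges, which are not loops. -/
theorem red_edge_ne_turn (k : ZMod n) : s(bar (c.fold k).a, (c.fold k).u) ≠ c.turn k := by
  intro hc
  have h := c.generating (k + 1)
  rw [add_sub_cancel_right] at h
  have hadj := (c.generating k).twice_achieved
  rw [← SimpleGraph.mem_edgeSet, Sym2.eq_swap, hc] at hadj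
  have := h.induced _ _ ((SimpleGraph.mem_edgeSet _).1 hadj)
  simp at this

/-- The `N`-th fold, with the index read modulo `n`. -/
abbrev fd (N : ℕ) : Fold r := c.fold ((N : ℕ) : ZMod n)

theorem turn_nat (N : ℕ) : c.turn N = s((c.fd (N + 1)).u, (c.fd (N + 1)).a) := by
  simp [turn, fd]

theorem turn_zero : c.turn 0 = s((c.fold 1).u, (c.fold 1).a) := by simp [turn]

/-- T_N contains u_N, the one direction that is missing from the image of Dg_N. -/
theorem dir_pair_ne_turn (N : ℕ) (x y : Dir r) :
    s((c.fd N).dir x, (c.fd N).dir y) ≠ c.turn N := by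
  intro h
  have := c.u_mem_turn N
  rw [← h, Sym2.mem_iff] at this
  rcases this with h | h
  · exact (c.fd N).dir_ne_u _ h.symm
  · exact (c.fd N).dir_ne_u _ h.symm

/-- An edge word that is tight and does not take the turn `T_N`. -/
def Legal (N : ℕ) (w : EdgeWord r) : Prop :=
  w.IsChain (fun x y => y ≠ bar x ∧ s(bar x, y) ≠ c.turn N)

variable {c}

theorem Legal.isReduced {N : ℕ} {w : EdgeWord r} (h : c.Legal N w) : FreeGroup.IsReduced w :=
  isReduced_iff_isChain.2 (h.imp fun _ _ h => h.1)

theorem Legal.infix {N : ℕ} {v w : EdgeWord r} (h : c.Legal N w) (h' : v <:+: w) :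
    c.Legal N v := List.IsChain.infix h h'

theorem Legal.left {N : ℕ} {v w : EdgeWord r} (h : c.Legal N (v ++ w)) : c.Legal N v :=
  List.IsChain.left_of_append h

theorem Legal.right {N : ℕ} {v w : EdgeWord r} (h : c.Legal N (v ++ w)) : c.Legal N w :=
  List.IsChain.right_of_append h

theorem Legal.invRev {N : ℕ} {w : EdgeWord r} (h : c.Legal N w) :
    c.Legal N (FreeGroup.invRev w) := by
  unfold Legal at *
  rw [FreeGroup.invRev, List.isChain_reverse, List.isChain_map]
  refine h.imp ?_
  rintro x y ⟨h1, h2⟩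
  refine ⟨fun h => h1 ?_, ?_⟩
  · change bar x = bar (bar y) at h
    rw [bar_bar] at h; exact h.symm
  · change s(bar (bar y), bar x) ≠ _
    rwa [bar_bar, Sym2.eq_swap]

/-- A turn of the image is either the red turn inside the image of u, or the image of a turn of `w`
under the direction map. The first is not T_{N+1}, nor is the second, and the second stays
nondegenerate because only T_N is collapsed. -/
theorem Legal.mapWord {N : ℕ} {w : EdgeWord r} (h : c.Legal N w) :
    c.Legal (N + 1) ((c.fd (N + 1)).mapWord w) := by
  set f := c.fd (N + 1) with hf
  have hau : c.Legal (N + 1) [f.a, f.u] := by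
    refine List.isChain_pair.2 ⟨fun h => f.ne_bar ?_, c.red_edge_ne_turn _⟩
    rw [h, bar_bar]
  induction w with
  | nil => exact List.isChain_nil
  | cons x w ih =>
    have hx : c.Legal (N + 1) (f.image x) := by
      by_cases h1 : x = f.u
      · rw [h1, f.image_u]; exact hau
      by_cases h2 : x = bar f.u
      · rw [h2, f.image_bar, f.image_u]; exact hau.invRev
      rw [f.image_of_ne h1 h2]; exact List.isChain_singleton _
    rw [Fold.mapWord_cons]
    refine List.IsChain.append hx (ih (List.IsChain.right_of_append (l₁ := [x]) h)) ?_
    intro y hy z hz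
    have hy' : y = bar (f.dir (bar x)) := by
      have := f.getLast?_mapWord [x]
      simp only [Fold.mapWord_cons, Fold.mapWord_nil, List.append_nil] at this
      rw [Option.mem_def, this] at hy
      simpa using hy.symm
    rw [Option.mem_def, f.head?_mapWord] at hz
    cases w with
    | nil => simp at hz
    | cons t w =>
      simp only [List.head?_cons, Option.map_some, Option.some.injEq] at hz
      obtain ⟨h1, h2⟩ := (List.isChain_cons_cons.1 h).1
      subst hz hy'
      rw [bar_bar]
      refine ⟨fun h => ?_, c.dir_pair_ne_turn _ _ _⟩
      rcases f.dir_eq_dir h with h | h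
      · exact h1 h
      · exact h2 (by rw [Sym2.eq_swap, h, turn_nat])

variable (c)

@[simp] theorem genWord_zero (w : EdgeWord r) : c.genWord 0 w = w := rfl

theorem genWord_succ (N : ℕ) (w : EdgeWord r) :
    c.genWord (N + 1) w = (c.fd (N + 1)).mapWord (c.genWord N w) := rfl

@[simp] theorem genWord_nil (N : ℕ) : c.genWord N [] = [] := by
  induction N with
  | zero => rfl
  | succ N ih => rw [genWord_succ, ih, Fold.mapWord_nil]

@[simp] theorem genWord_append (N : ℕ) (v w : EdgeWord r) :
    c.genWord N (v ++ w) = c.genWord N v ++ c.genWord N w := by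
  induction N with
  | zero => rfl
  | succ N ih => simp only [genWord_succ, ih, Fold.mapWord_append]

theorem genWord_cons (N : ℕ) (x : Dir r) (w : EdgeWord r) :
    c.genWord N (x :: w) = c.genWord N [x] ++ c.genWord N w := by
  rw [← genWord_append]; rfl

theorem genWord_invRev (N : ℕ) (w : EdgeWord r) :
    c.genWord N (FreeGroup.invRev w) = FreeGroup.invRev (c.genWord N w) := by
  induction N with
  | zero => rfl
  | succ N ih => simp only [genWord_succ, ih, Fold.mapWord_invRev]

theorem head?_genWord (N : ℕ) (w : EdgeWord r) :
    (c.genWord N w).head? = w.head?.map (c.genDir N) := by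
  induction N with
  | zero => simp [genDir]
  | succ N ih =>
    rw [genWord_succ, Fold.head?_mapWord, ih, Option.map_map]; rfl

theorem genWord_prefix {N : ℕ} {v w : EdgeWord r} (h : v <+: w) :
    c.genWord N v <+: c.genWord N w := by
  obtain ⟨s, rfl⟩ := h
  rw [genWord_append]
  exact List.prefix_append _ _

theorem fd_add (p N : ℕ) : c.fd (p * n + N) = c.fd N := by simp [fd]

theorem turn_mul (p : ℕ) : c.turn ((p * n : ℕ) : ZMod n) = c.turn 0 := by simp

theorem genWord_add (p N : ℕ) (w : EdgeWord r) :
    c.genWord (p * n + N) w = c.genWord N (c.genWord (p * n) w) := by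
  induction N with
  | zero => rfl
  | succ N ih => rw [← add_assoc, genWord_succ, ih, genWord_succ, add_assoc, fd_add]

theorem powWord_add (p q : ℕ) (w : EdgeWord r) :
    c.powWord (p + q) w = c.powWord q (c.powWord p w) := by
  unfold powWord; rw [add_mul, genWord_add]

variable {c}

theorem Legal.genWord {w : EdgeWord r} (h : c.Legal 0 w) (N : ℕ) : c.Legal N (c.genWord N w) := by
  induction N with
  | zero => exact h
  | succ N ih => exact ih.mapWord

theorem legal_mul {p : ℕ} {w : EdgeWord r} : c.Legal (p * n) w ↔ c.Legal 0 w := by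
  unfold Legal; simp

theorem Legal.powWord {w : EdgeWord r} (h : c.Legal 0 w) (p : ℕ) : c.Legal 0 (c.powWord p w) :=
  legal_mul.1 (h.genWord (p * n))

/-! ### The course of a pair of sides under composition -/

variable (c)

/-- The common initial path that is removed after `g_N ∘ ⋯ ∘ g_1` from any pair that starts with
the turns `T_0, …, T_N`. -/
def tau : ℕ → EdgeWord r
  | 0 => []
  | N + 1 => (c.fd (N + 1)).mapWord (tau N) ++ [(c.fd (N + 1)).a]

theorem tau_succ (N : ℕ) :
    c.tau (N + 1) = (c.fd (N + 1)).mapWord (c.tau N) ++ [(c.fd (N + 1)).a] := rfl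

theorem tau_add (p N : ℕ) : c.tau (p * n + N) = c.genWord N (c.tau (p * n)) ++ c.tau N := by
  induction N with
  | zero => simp [tau]
  | succ N ih =>
    rw [← add_assoc, tau_succ, ih, tau_succ, genWord_succ, add_assoc, fd_add]
    simp

end AdmissibleComposition

theorem common_prefix_unique {α : Type*} {σ τ v₁ v₂ w₁ w₂ : List α} {x x' y y' : α}
    (h₁ : σ ++ x :: v₁ = τ ++ x' :: w₁) (h₂ : σ ++ y :: v₂ = τ ++ y' :: w₂)
    (hxy : x ≠ y) (hxy' : x' ≠ y') : σ = τ := by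
  induction σ generalizing τ with
  | nil =>
    cases τ with
    | nil => rfl
    | cons t τ =>
      simp only [List.nil_append, List.cons_append, List.cons.injEq] at h₁ h₂
      exact absurd (h₁.1.trans h₂.1.symm) hxy
  | cons s σ ih =>
    cases τ with
    | nil =>
      simp only [List.nil_append, List.cons_append, List.cons.injEq] at h₁ h₂
      exact absurd (h₁.1.symm.trans h₂.1) hxy'
    | cons t τ =>
      simp only [List.cons_append, List.cons.injEq] at h₁ h₂
      rw [h₁.1, ih h₁.2 h₂.2]

theorem not_prefix_of_branch {α : Type*} {τ v₁ v₂ : List α} {x y : α} (hxy : x ≠ y) :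
    ¬ τ ++ x :: v₁ <+: τ ++ y :: v₂ := by
  rw [List.prefix_append_right_inj, List.cons_prefix_cons]
  exact fun h => hxy h.1

theorem exists_branch {α : Type*} {v w : List α} (h : ¬ v <+: w) (h' : ¬ w <+: v) :
    ∃ τ x v' y w', v = τ ++ x :: v' ∧ w = τ ++ y :: w' ∧ x ≠ y := by
  induction v generalizing w with
  | nil => exact absurd (List.nil_prefix) h
  | cons x v ih =>
    cases w with
    | nil => exact absurd (List.nil_prefix) h'
    | cons y w =>
      by_cases hxy : x = y
      · subst hxy
        rw [List.cons_prefix_cons] at h h'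
        obtain ⟨τ, a, v', b, w', rfl, rfl, hab⟩ :=
          ih (fun h2 => h ⟨rfl, h2⟩) (fun h2 => h' ⟨rfl, h2⟩)
        exact ⟨x :: τ, a, v', b, w', rfl, rfl, hab⟩
      · exact ⟨[], x, v, y, w, rfl, rfl, hxy⟩

namespace AdmissibleComposition

variable (c : AdmissibleComposition r n)

/-- After `g_N ∘ ⋯ ∘ g_1` and removal of `tau N`, both sides begin with the turn `T_N`. -/
def AtTau (N : ℕ) (w₁ w₂ : EdgeWord r) : Prop :=
  ∃ x v₁ y v₂, c.genWord N w₁ = c.tau N ++ x :: v₁ ∧ c.genWord N w₂ = c.tau N ++ y :: v₂ ∧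
    s(x, y) = c.turn N

/-- After `g_N ∘ ⋯ ∘ g_1`, the two sides branch at a nondegenerate turn different from `T_N`. -/
def Separated (N : ℕ) (w₁ w₂ : EdgeWord r) : Prop :=
  ∃ τ x v₁ y v₂, c.genWord N w₁ = τ ++ x :: v₁ ∧ c.genWord N w₂ = τ ++ y :: v₂ ∧
    x ≠ y ∧ s(x, y) ≠ c.turn N

variable {c}

theorem ne_of_eq_turn {k : ZMod n} {x y : Dir r} (h : s(x, y) = c.turn k) : x ≠ y := by
  rintro rfl
  unfold turn at h
  rw [Sym2.eq_iff] at h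
  apply (c.fold (k + 1)).ne
  rcases h with h | h <;> rw [← h.1, ← h.2]

theorem AtTau.atTurn {N : ℕ} {w₁ w₂ : EdgeWord r} (h : c.AtTau N w₁ w₂) : c.AtTurn N w₁ w₂ := by
  obtain ⟨x, v₁, y, v₂, h1, h2, h3⟩ := h
  exact ⟨_, x, v₁, y, v₂, h1, h2, h3⟩

theorem AtTau.symm {N : ℕ} {w₁ w₂ : EdgeWord r} (h : c.AtTau N w₁ w₂) : c.AtTau N w₂ w₁ := by
  obtain ⟨x, v₁, y, v₂, h1, h2, h3⟩ := h
  exact ⟨y, v₂, x, v₁, h2, h1, by rwa [Sym2.eq_swap]⟩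

theorem AtTurn.symm {N : ℕ} {w₁ w₂ : EdgeWord r} (h : c.AtTurn N w₁ w₂) : c.AtTurn N w₂ w₁ := by
  obtain ⟨τ, x, v₁, y, v₂, h1, h2, h3⟩ := h
  exact ⟨τ, y, v₂, x, v₁, h2, h1, by rwa [Sym2.eq_swap]⟩

theorem Separated.symm {N : ℕ} {w₁ w₂ : EdgeWord r} (h : c.Separated N w₁ w₂) :
    c.Separated N w₂ w₁ := by
  obtain ⟨τ, x, v₁, y, v₂, h1, h2, h3, h4⟩ := h
  exact ⟨τ, y, v₂, x, v₁, h2, h1, h3.symm, by rwa [Sym2.eq_swap]⟩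

theorem AtTurn.not_prefix {N : ℕ} {w₁ w₂ : EdgeWord r} (h : c.AtTurn N w₁ w₂) :
    ¬ c.genWord N w₁ <+: c.genWord N w₂ := by
  obtain ⟨τ, x, v₁, y, v₂, h1, h2, h3⟩ := h
  rw [h1, h2]
  exact not_prefix_of_branch (ne_of_eq_turn h3)

theorem Separated.not_prefix {N : ℕ} {w₁ w₂ : EdgeWord r} (h : c.Separated N w₁ w₂) :
    ¬ c.genWord N w₁ <+: c.genWord N w₂ := by
  obtain ⟨τ, x, v₁, y, v₂, h1, h2, h3, -⟩ := h
  rw [h1, h2]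
  exact not_prefix_of_branch h3

theorem Separated.not_atTurn {N : ℕ} {w₁ w₂ : EdgeWord r} (h : c.Separated N w₁ w₂) :
    ¬ c.AtTurn N w₁ w₂ := by
  rintro ⟨τ', x', v₁', y', v₂', h1', h2', h3'⟩
  obtain ⟨τ, x, v₁, y, v₂, h1, h2, h3, h4⟩ := h
  have hne := ne_of_eq_turn h3'
  rw [h1] at h1'
  rw [h2] at h2'
  obtain rfl := common_prefix_unique h1' h2' h3 hne
  simp only [List.append_cancel_left_eq, List.cons.injEq] at h1' h2'
  exact h4 (by rw [h1'.1, h2'.1, h3'])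

/-- A nondegenerate turn other than T_N is not collapsed by the next fold, and a pair of image
directions is never T_{N+1}. So (IIc) is irrevocable. -/
theorem Separated.succ {N : ℕ} {w₁ w₂ : EdgeWord r} (h : c.Separated N w₁ w₂) :
    c.Separated (N + 1) w₁ w₂ := by
  obtain ⟨τ, x, v₁, y, v₂, h1, h2, h3, h4⟩ := h
  have key : ∀ (x : Dir r) (v : EdgeWord r), ∃ v', (c.fd (N + 1)).mapWord (x :: v) =
      (c.fd (N + 1)).dir x :: v' := by
    intro x v
    have := (c.fd (N + 1)).head?_mapWord (x :: v)
    rw [List.head?_cons, Option.map_some, List.head?_eq_some_iff] at this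
    exact this
  obtain ⟨v₁', h1'⟩ := key x v₁
  obtain ⟨v₂', h2'⟩ := key y v₂
  refine ⟨(c.fd (N + 1)).mapWord τ, _, v₁', _, v₂', ?_, ?_, ?_, c.dir_pair_ne_turn _ x y⟩
  · rw [genWord_succ, h1, Fold.mapWord_append, h1']
  · rw [genWord_succ, h2, Fold.mapWord_append, h2']
  · intro h
    rcases (c.fd (N + 1)).dir_eq_dir h with h | h
    · exact h3 h
    · exact h4 (by rw [h, turn_nat])

theorem Separated.mono {N M : ℕ} (hNM : N ≤ M) {w₁ w₂ : EdgeWord r} (h : c.Separated N w₁ w₂) :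
    c.Separated M w₁ w₂ := by
  induction M, hNM using Nat.le_induction with
  | base => exact h
  | succ M _ ih => exact ih.succ

theorem genWord_prefix_mono {N M : ℕ} (hNM : N ≤ M) {w₁ w₂ : EdgeWord r}
    (h : c.genWord N w₁ <+: c.genWord N w₂) : c.genWord M w₁ <+: c.genWord M w₂ := by
  induction M, hNM using Nat.le_induction with
  | base => exact h
  | succ M _ ih =>
    obtain ⟨s, hs⟩ := ih
    rw [genWord_succ, genWord_succ, ← hs, Fold.mapWord_append]
    exact List.prefix_append _ _

theorem genWord_prefix_tau_mono {N M : ℕ} (hNM : N ≤ M) {w : EdgeWord r}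
    (h : c.genWord N w <+: c.tau N) : c.genWord M w <+: c.tau M := by
  induction M, hNM using Nat.le_induction with
  | base => exact h
  | succ M _ ih =>
    obtain ⟨s, hs⟩ := ih
    rw [genWord_succ, tau_succ, ← hs, Fold.mapWord_append, List.append_assoc]
    exact List.prefix_append _ _

variable (c) in
/-- After `g_N ∘ ⋯ ∘ g_1`, the second side is absorbed. -/
def Swallowed (N : ℕ) (w₁ w₂ : EdgeWord r) : Prop :=
  c.genWord N w₂ = c.tau N ∧ ∃ v, c.genWord N w₁ = c.tau N ++ (c.fd N).u :: v

/-- The side that starts with u becomes a u..., the other one a followed by an image. After removal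
of a, the first starts with u and the second, if anything is left of it, with a direction other than
u. So the sides are never equal, and the three outcomes are exhaustive. -/
theorem AtTau.succ {N : ℕ} {w₁ w₂ : EdgeWord r} (h : c.AtTau N w₁ w₂) :
    c.AtTau (N + 1) w₁ w₂ ∨ c.Swallowed (N + 1) w₁ w₂ ∨ c.Swallowed (N + 1) w₂ w₁ ∨
      c.Separated (N + 1) w₁ w₂ := by
  set f := c.fd (N + 1) with hf
  have key : ∀ w₁ w₂ v₁ v₂, c.genWord N w₁ = c.tau N ++ f.u :: v₁ →
      c.genWord N w₂ = c.tau N ++ f.a :: v₂ →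
      c.AtTau (N + 1) w₁ w₂ ∨ c.Swallowed (N + 1) w₁ w₂ ∨ c.Separated (N + 1) w₁ w₂ := by
    intro w₁ w₂ v₁ v₂ h1 h2
    have e1 : c.genWord (N + 1) w₁ = c.tau (N + 1) ++ f.u :: f.mapWord v₁ := by
      rw [genWord_succ, h1, tau_succ, Fold.mapWord_append, Fold.mapWord_cons, ← hf, f.image_u]
      simp
    have e2 : c.genWord (N + 1) w₂ = c.tau (N + 1) ++ f.mapWord v₂ := by
      rw [genWord_succ, h2, tau_succ, Fold.mapWord_append, Fold.mapWord_cons, ← hf, f.image_a]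
      simp
    cases v₂ with
    | nil => exact Or.inr (Or.inl ⟨by simpa using e2, _, e1⟩)
    | cons z v₂ =>
      have hz := f.head?_mapWord (z :: v₂)
      rw [List.head?_cons, Option.map_some, List.head?_eq_some_iff] at hz
      obtain ⟨v', hv'⟩ := hz
      rw [hv'] at e2
      by_cases ht : s(f.u, f.dir z) = c.turn ((N + 1 : ℕ) : ZMod n)
      · exact Or.inl ⟨_, _, _, _, e1, e2, ht⟩
      · exact Or.inr (Or.inr ⟨_, _, _, _, _, e1, e2, (f.dir_ne_u z).symm, ht⟩)
  obtain ⟨x, v₁, y, v₂, h1, h2, h3⟩ := h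
  rw [turn_nat, Sym2.eq_iff] at h3
  rcases h3 with ⟨rfl, rfl⟩ | ⟨rfl, rfl⟩
  · rcases key w₁ w₂ v₁ v₂ h1 h2 with h | h | h <;> simp [h]
  · rcases key w₂ w₁ v₂ v₁ h2 h1 with h | h | h
    · exact Or.inl h.symm
    · exact Or.inr (Or.inr (Or.inl h))
    · exact Or.inr (Or.inr (Or.inr h.symm))

theorem Swallowed.prefix {N : ℕ} {w₁ w₂ : EdgeWord r} (h : c.Swallowed N w₁ w₂) :
    c.genWord N w₂ <+: c.genWord N w₁ := by
  obtain ⟨h1, v, h2⟩ := h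
  rw [h1, h2]
  exact List.prefix_append _ _

/-- A pair that starts with `T_0` either runs through all the turns `T_k`, `k ≤ N`, or stops. -/
theorem AtTau.run {w₁ w₂ : EdgeWord r} (h : c.AtTau 0 w₁ w₂) (N : ℕ) :
    (∀ k ≤ N, c.AtTau k w₁ w₂) ∨ ∃ M ≤ N, (∀ k < M, c.AtTau k w₁ w₂) ∧
      (c.Swallowed M w₁ w₂ ∨ c.Swallowed M w₂ w₁ ∨ c.Separated M w₁ w₂) := by
  induction N with
  | zero => left; intro k hk; rwa [Nat.le_zero.1 hk]
  | succ N ih =>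
    rcases ih with h1 | ⟨M, hM, h1⟩
    · rcases (h1 N le_rfl).succ with h2 | h2
      · left
        intro k hk
        rcases Nat.le_succ_iff.1 hk with hk | rfl
        · exact h1 k hk
        · exact h2
      · exact Or.inr ⟨N + 1, le_rfl, fun k hk => h1 k (Nat.lt_succ_iff.1 hk), h2⟩
    · exact Or.inr ⟨M, hM.trans (Nat.le_succ N), h1⟩

/-- Absorption and separation both persist, so a pair that is at T_N now cannot have stopped
earlier; hence it was at every previous turn, with the standard common initial path. -/
theorem AtTurn.atTau {N : ℕ} {w₁ w₂ : EdgeWord r} (h : c.AtTurn N w₁ w₂)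
    (h₀ : c.AtTau 0 w₁ w₂) : ∀ k ≤ N, c.AtTau k w₁ w₂ := by
  rcases h₀.run N with h1 | ⟨M, hM, -, h1 | h1 | h1⟩
  · exact h1
  · exact absurd (genWord_prefix_mono hM h1.prefix) h.symm.not_prefix
  · exact absurd (genWord_prefix_mono hM h1.prefix) h.not_prefix
  · exact absurd h (h1.mono hM).not_atTurn

theorem AtTau.eq_tau {N : ℕ} {w₁ w₂ τ v₁ v₂ : EdgeWord r} {x y : Dir r} (h : c.AtTau N w₁ w₂)
    (h₁ : c.genWord N w₁ = τ ++ x :: v₁) (h₂ : c.genWord N w₂ = τ ++ y :: v₂) (hxy : x ≠ y) :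
    τ = c.tau N := by
  obtain ⟨x', v₁', y', v₂', h1, h2, h3⟩ := h
  rw [h1] at h₁
  rw [h2] at h₂
  exact (common_prefix_unique h₁ h₂ (ne_of_eq_turn h3) hxy).symm

theorem Running.atTau {N : ℕ} {w₁ w₂ : EdgeWord r} (h : c.Running N w₁ w₂)
    (h₀ : c.AtTau 0 w₁ w₂) : ∀ k < N, c.AtTau k w₁ w₂ :=
  fun k hk => (h k hk).atTau h₀ k le_rfl

/-- The absorbed side started with a before the last fold and the other one with u, so the next edge
is u_N, the red vertex of G_N. Thus only (IIIa) ever occurs. -/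
theorem Absorbed.swallowed {N : ℕ} {w₁ w₂ : EdgeWord r} {t : Dir r} (h : c.Absorbed N w₁ w₂ t)
    (h₀ : c.AtTau 0 w₁ w₂) : c.Swallowed N w₁ w₂ ∧ t = (c.fd N).u := by
  obtain ⟨hrun, v, hv⟩ := h
  have hp : c.genWord N w₂ <+: c.genWord N w₁ := by rw [hv]; exact List.prefix_append _ _
  have hs : c.Swallowed N w₁ w₂ := by
    cases N with
    | zero => exact absurd hp h₀.atTurn.symm.not_prefix
    | succ N =>
      rcases (hrun.atTau h₀ N (Nat.lt_succ_self N)).succ with h1 | h1 | h1 | h1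
      · exact absurd hp h1.atTurn.symm.not_prefix
      · exact h1
      · have := h1.prefix.length_le
        rw [hv] at this
        simp at this
      · exact absurd hp h1.symm.not_prefix
  refine ⟨hs, ?_⟩
  obtain ⟨h1, v', h2⟩ := hs
  rw [h2, h1] at hv
  simp only [List.append_cancel_left_eq, List.cons.injEq] at hv
  exact hv.1.symm

theorem AtTau.mono {N : ℕ} {w₁ w₂ p₁ p₂ : EdgeWord r} (h : c.AtTau N w₁ w₂) (h₁ : w₁ <+: p₁)
    (h₂ : w₂ <+: p₂) : c.AtTau N p₁ p₂ := by
  obtain ⟨x, v₁, y, v₂, e1, e2, h3⟩ := h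
  obtain ⟨s₁, rfl⟩ := h₁
  obtain ⟨s₂, rfl⟩ := h₂
  refine ⟨x, v₁ ++ c.genWord N s₁, y, v₂ ++ c.genWord N s₂, ?_, ?_, h3⟩ <;> simp [e1, e2]

theorem Separated.mono_prefix {N : ℕ} {w₁ w₂ p₁ p₂ : EdgeWord r} (h : c.Separated N w₁ w₂)
    (h₁ : w₁ <+: p₁) (h₂ : w₂ <+: p₂) : c.Separated N p₁ p₂ := by
  obtain ⟨τ, x, v₁, y, v₂, e1, e2, h3⟩ := h
  obtain ⟨s₁, rfl⟩ := h₁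
  obtain ⟨s₂, rfl⟩ := h₂
  refine ⟨τ, x, v₁ ++ c.genWord N s₁, y, v₂ ++ c.genWord N s₂, ?_, ?_, h3⟩ <;> simp [e1, e2]

theorem atTau_zero {x y : Dir r} {w₁ w₂ : EdgeWord r} (h₁ : w₁.head? = some x)
    (h₂ : w₂.head? = some y) (h : s(x, y) = c.turn 0) : c.AtTau 0 w₁ w₂ := by
  obtain ⟨v₁, rfl⟩ := List.head?_eq_some_iff.1 h₁
  obtain ⟨v₂, rfl⟩ := List.head?_eq_some_iff.1 h₂
  exact ⟨x, v₁, y, v₂, rfl, rfl, by simpa using h⟩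

end AdmissibleComposition

/-! ### Lengths, and the periodic pair -/

namespace AdmissibleComposition

variable {c : AdmissibleComposition r n}

namespace Metric

variable (m : c.Metric)

@[simp] theorem length_nil : m.length [] = 0 := rfl

@[simp] theorem length_cons (x : Dir r) (w : EdgeWord r) :
    m.length (x :: w) = m.len x.1 + m.length w := rfl

@[simp] theorem length_append (v w : EdgeWord r) : m.length (v ++ w) = m.length v + m.length w := by
  simp [length]

@[simp] theorem length_invRev (w : EdgeWord r) : m.length (FreeGroup.invRev w) = m.length w := by
  induction w with
  | nil => rfl
  | cons x w ih => rw [invRev_cons', length_append, ih]; simp [add_comm]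

theorem length_nonneg (w : EdgeWord r) : 0 ≤ m.length w := by
  induction w with
  | nil => exact le_rfl
  | cons x w ih => exact add_nonneg (m.len_pos _).le ih

theorem length_pos {w : EdgeWord r} (h : w ≠ []) : 0 < m.length w := by
  cases w with
  | nil => exact absurd rfl h
  | cons x w => exact add_pos_of_pos_of_nonneg (m.len_pos _) (m.length_nonneg _)

theorem length_le_of_prefix {v w : EdgeWord r} (h : v <+: w) : m.length v ≤ m.length w := by
  obtain ⟨s, rfl⟩ := h
  rw [length_append]
  linarith [m.length_nonneg s]

theorem length_lt_of_prefix {v w : EdgeWord r} (h : v <+: w) (hne : v ≠ w) :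
    m.length v < m.length w := by
  obtain ⟨s, rfl⟩ := h
  rw [length_append]
  have : s ≠ [] := by rintro rfl; simp at hne
  linarith [m.length_pos this]

theorem prefix_of_length_le {u v w : EdgeWord r} (hu : u <+: w) (hv : v <+: w)
    (h : m.length u ≤ m.length v) : u <+: v := by
  rcases List.prefix_or_prefix_of_prefix hu hv with h1 | h1
  · exact h1
  · by_cases hne : v = u
    · rw [hne]
    · exact absurd h (not_le.2 (m.length_lt_of_prefix h1 hne))

theorem length_powWord_one (w : EdgeWord r) :
    m.length (c.powWord 1 w) = m.stretch * m.length w := by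
  have hx : ∀ x : Dir r, m.length (c.powWord 1 [x]) = m.stretch * m.len x.1 := by
    rintro ⟨i, s⟩
    cases s with
    | true => exact m.eigen i
    | false =>
      have : c.powWord 1 [(i, false)] = FreeGroup.invRev (c.powWord 1 [(i, true)]) := by
        unfold powWord
        rw [← genWord_invRev]; rfl
      rw [this, length_invRev]
      exact m.eigen i
  induction w with
  | nil => simp [powWord]
  | cons x w ih =>
    have : c.powWord 1 (x :: w) = c.powWord 1 [x] ++ c.powWord 1 w := c.genWord_cons _ x w
    rw [this, length_append, ih, hx, length_cons]
    ring

theorem length_powWord (k : ℕ) (w : EdgeWord r) :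
    m.length (c.powWord k w) = m.stretch ^ k * m.length w := by
  induction k with
  | zero => simp [powWord]
  | succ k ih => rw [powWord_add, length_powWord_one, ih, pow_succ]; ring

theorem length_le_mapWord (f : Fold r) (w : EdgeWord r) : m.length w ≤ m.length (f.mapWord w) := by
  induction w with
  | nil => exact le_rfl
  | cons x w ih =>
    rw [Fold.mapWord_cons, length_append, length_cons]
    have : m.len x.1 ≤ m.length (f.image x) := by
      have ha := (m.len_pos f.a.1).le
      by_cases h1 : x = f.u
      · rw [h1, f.image_u]; simp [ha]
      by_cases h2 : x = bar f.u
      · rw [h2, f.image_bar_u]; simp [ha]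
      rw [f.image_of_ne h1 h2]; simp
    linarith

theorem length_genWord_mono {N M : ℕ} (h : N ≤ M) (w : EdgeWord r) :
    m.length (c.genWord N w) ≤ m.length (c.genWord M w) := by
  induction M, h using Nat.le_induction with
  | base => exact le_rfl
  | succ M _ ih => exact ih.trans (m.length_le_mapWord _ _)

/-- The length of either side of an indivisible periodic Nielsen path. -/
noncomputable def halfLength : ℝ := m.length (c.tau n) / (m.stretch - 1)

section

variable [NeZero n]

theorem one_lt_stretch : 1 < m.stretch := by
  have h1 : 1 ≤ 1 * n := by rw [one_mul]; exact NeZero.one_le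
  have h2 := m.length_genWord_mono h1 [(c.fd 1).u]
  have h3 := m.length_powWord_one [(c.fd 1).u]
  unfold powWord at h3
  rw [h3, genWord_succ, genWord_zero, Fold.mapWord_cons, Fold.image_u] at h2
  simp only [Fold.mapWord_nil, List.append_nil, length_cons, length_nil, add_zero] at h2
  have ha := m.len_pos (c.fd 1).a.1
  have hu := m.len_pos (c.fd 1).u.1
  by_contra hc
  push Not at hc
  nlinarith

theorem one_le_pow_stretch (k : ℕ) : 1 ≤ m.stretch ^ k := one_le_pow₀ m.one_lt_stretch.le

theorem one_lt_pow_stretch {k : ℕ} (hk : 1 ≤ k) : 1 < m.stretch ^ k :=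
  one_lt_pow₀ m.one_lt_stretch (by omega)

theorem halfLength_pos : 0 < m.halfLength := by
  refine div_pos (m.length_pos ?_) (by linarith [m.one_lt_stretch])
  have key : ∀ N : ℕ, N ≠ 0 → c.tau N ≠ [] := by
    intro N hN
    obtain ⟨k, rfl⟩ := Nat.exists_eq_succ_of_ne_zero hN
    rw [Nat.succ_eq_add_one, tau_succ]
    simp
  exact key n (NeZero.ne n)

/-- A geometric sum: `tau ((p + 1) * n)` is the image of `tau (p * n)` under g followed by `tau n`.
-/
theorem length_tau (p : ℕ) : m.length (c.tau (p * n)) = (m.stretch ^ p - 1) * m.halfLength := by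
  have h1 : m.length (c.tau n) = (m.stretch - 1) * m.halfLength := by
    unfold halfLength
    have : m.stretch - 1 ≠ 0 := by linarith [m.one_lt_stretch]
    field_simp
  induction p with
  | zero => simp [tau]
  | succ p ih =>
    have h2 := m.length_powWord_one (c.tau (p * n))
    unfold powWord at h2
    rw [one_mul] at h2
    rw [Nat.succ_mul, tau_add, length_append, h2, ih, h1, pow_succ]
    ring

theorem exists_pow_stretch_gt (x : ℝ) : ∃ p, x < m.stretch ^ p :=
  pow_unbounded_of_one_lt x m.one_lt_stretch

/-- A side that is absorbed is shorter than `halfLength`. -/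
theorem lt_halfLength_of_prefix_tau {N : ℕ} {w : EdgeWord r} (h : c.genWord N w <+: c.tau N) :
    m.length w < m.halfLength := by
  have hN : N ≤ N * n := Nat.le_mul_of_pos_right N (NeZero.pos n)
  have h1 := m.length_le_of_prefix (genWord_prefix_tau_mono hN h)
  have h2 := m.length_powWord N w
  unfold powWord at h2
  rw [h2, length_tau] at h1
  have h3 := m.one_le_pow_stretch N
  have h4 := m.halfLength_pos
  by_contra hc
  push Not at hc
  nlinarith

/-- At time pn the image contains the removed path, so λ^p |w₁| ≥ (λ^p - 1) L; for large p this
forces |w₁| ≥ L. -/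
theorem halfLength_le_of_atTau {w₁ w₂ : EdgeWord r} (h : ∀ N, c.AtTau N w₁ w₂) :
    m.halfLength ≤ m.length w₁ := by
  by_contra hc
  push Not at hc
  obtain ⟨p, hp⟩ := m.exists_pow_stretch_gt (m.halfLength / (m.halfLength - m.length w₁))
  rw [div_lt_iff₀ (by linarith)] at hp
  obtain ⟨x, v₁, y, v₂, e1, -, -⟩ := h (p * n)
  have h2 := m.length_powWord p w₁
  unfold powWord at h2
  rw [e1, length_append, length_tau] at h2
  have := m.length_nonneg (x :: v₁)
  nlinarith

end

theorem eq_of_endsInLast {v w : EdgeWord r} {L : ℝ} (h : v <+: w) (hv : m.EndsInLast v L)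
    (hw : m.EndsInLast w L) : v = w := by
  by_contra hne
  have h1 : v <+: w.dropLast := by
    obtain ⟨s, rfl⟩ := h
    have : s ≠ [] := by rintro rfl; simp at hne
    rw [List.dropLast_append_of_ne_nil this]
    exact List.prefix_append _ _
  linarith [m.length_le_of_prefix h1, hv.2, hw.1]

theorem prefix_of_lt_of_le {v w p : EdgeWord r} {L : ℝ} (hw : m.length w.dropLast < L)
    (hv : L ≤ m.length v) (hwp : w <+: p) (hvp : v <+: p) : w <+: v := by
  rcases List.prefix_or_prefix_of_prefix hwp hvp with h1 | h1
  · exact h1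
  · by_cases hne : v = w
    · rw [hne]
    · have h2 : v <+: w.dropLast := by
        obtain ⟨s, rfl⟩ := h1
        have : s ≠ [] := by rintro rfl; simp at hne
        rw [List.dropLast_append_of_ne_nil this]
        exact List.prefix_append _ _
      linarith [m.length_le_of_prefix h2]

theorem exists_prefix_endsInLast {w : EdgeWord r} {L : ℝ} (hL : 0 < L) (h : L ≤ m.length w) :
    ∃ v, v <+: w ∧ m.EndsInLast v L := by
  induction w using List.reverseRecOn with
  | nil => rw [length_nil] at h; linarith
  | append_singleton w x ih =>
    by_cases h1 : L ≤ m.length w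
    · obtain ⟨v, hv, h2⟩ := ih h1
      exact ⟨v, hv.trans (List.prefix_append _ _), h2⟩
    · exact ⟨w ++ [x], List.prefix_rfl, by simpa using h1, h⟩

theorem EndsInLast.ne_nil {w : EdgeWord r} {L : ℝ} (hL : 0 < L) (h : m.EndsInLast w L) :
    w ≠ [] := by
  rintro rfl
  have := h.2
  rw [length_nil] at this
  linarith

theorem finite_length_dropLast_lt [Nonempty (Fin r)] (L : ℝ) :
    {w : EdgeWord r | m.length w.dropLast < L}.Finite := by
  obtain ⟨i, hi⟩ := Finite.exists_min m.len
  have key : ∀ w : EdgeWord r, w.length * m.len i ≤ m.length w := by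
    intro w
    induction w with
    | nil => simp
    | cons x w ih =>
      rw [length_cons, List.length_cons]
      push_cast
      linarith [hi x.1]
  obtain ⟨B, hB⟩ := exists_nat_gt (L / m.len i)
  rw [div_lt_iff₀ (m.len_pos i)] at hB
  refine (List.finite_length_le (Dir r) (B + 1)).subset ?_
  intro w hw
  have h1 : (w.dropLast.length : ℝ) * m.len i < B * m.len i :=
    ((key w.dropLast).trans_lt hw).trans hB
  have h2 := lt_of_mul_lt_mul_right h1 (m.len_pos i).le
  have h3 : w.dropLast.length < B := by exact_mod_cast h2
  rw [List.length_dropLast] at h3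
  simp only [Set.mem_ofPred_eq]
  omega

/-- A pair of legal sides whose initial parts of length `halfLength` are the two sides of a
periodic Nielsen path. -/
structure GoodPair (p₁ p₂ : EdgeWord r) : Prop where
  head₁ : p₁.head? = some (c.fold 1).u
  head₂ : p₂.head? = some (c.fold 1).a
  legal₁ : c.Legal 0 p₁
  legal₂ : c.Legal 0 p₂
  ends₁ : m.EndsInLast p₁ m.halfLength
  ends₂ : m.EndsInLast p₂ m.halfLength
  periodic : ∃ K, 1 ≤ K ∧ c.tau (K * n) ++ p₁ <+: c.powWord K p₁ ∧
    c.tau (K * n) ++ p₂ <+: c.powWord K p₂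

end Metric

theorem periodic_iterate {K : ℕ} {p : EdgeWord r} (h : c.tau (K * n) ++ p <+: c.powWord K p)
    (j : ℕ) : c.tau (K * j * n) ++ p <+: c.powWord (K * j) p := by
  induction j with
  | zero => simp [powWord, tau]
  | succ j ih =>
    have h1 := c.genWord_prefix (N := K * n) ih
    rw [mul_add, mul_one, powWord_add, add_mul, tau_add, List.append_assoc]
    refine List.IsPrefix.trans ?_ h1
    rw [genWord_append, List.prefix_append_right_inj]
    exact h

/-- The induction needs the stronger statement that the images also differ from T_N, the only turn
that the next fold collapses. -/
theorem genDir_ne {x y : Dir r} (h : x ≠ y) (h' : s(x, y) ≠ c.turn 0) (N : ℕ) :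
    c.genDir N x ≠ c.genDir N y := by
  have : c.genDir N x ≠ c.genDir N y ∧ s(c.genDir N x, c.genDir N y) ≠ c.turn N := by
    induction N with
    | zero => exact ⟨h, by simpa [genDir] using h'⟩
    | succ N ih =>
      refine ⟨fun h2 => ?_, c.dir_pair_ne_turn _ _ _⟩
      rcases (c.fd (N + 1)).dir_eq_dir h2 with h3 | h3
      · exact ih.1 h3
      · exact ih.2 (by rw [h3, turn_nat])
  exact this.1

namespace Metric

variable {m : c.Metric}

section

variable [NeZero n]

/-- If the sides branched after a common part α, then α would be nonempty and shorter than L, so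
g^K(α) would be shorter than τ α. The missing part δ would then be a common beginning of the images
of what follows α on the two sides. If the branching turn is not T_0, these images have different
first edges. If it is T_0, then δ = τ, so g^K(α) has the length of α, although α is stretched. -/
theorem side_unique {K : ℕ} (hK : 1 ≤ K) {v w : EdgeWord r} (hhead : v.head? = w.head?)
    (hv : m.EndsInLast v m.halfLength) (hw : m.EndsInLast w m.halfLength)
    (hKv : c.tau (K * n) ++ v <+: c.powWord K v) (hKw : c.tau (K * n) ++ w <+: c.powWord K w) :
    v = w := by
  by_contra hne
  obtain ⟨α, x, β, y, γ, rfl, rfl, hxy⟩ := exists_branch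
    (fun h => hne (m.eq_of_endsInLast h hv hw)) (fun h => hne (m.eq_of_endsInLast h hw hv).symm)
  have hα : α ≠ [] := by
    rintro rfl
    simp only [List.nil_append, List.head?_cons, Option.some.injEq] at hhead
    exact hxy hhead
  have h0 := m.length_pos hα
  have hαL : m.length α < m.halfLength := by
    have := hv.1
    rw [List.dropLast_append_of_ne_nil (by simp), length_append] at this
    linarith [m.length_nonneg (x :: β).dropLast]
  have hsplit : ∀ t, c.powWord K (α ++ t) = c.powWord K α ++ c.powWord K t :=
    fun t => c.genWord_append _ _ _
  -- This is λ^K |α| < (λ^K - 1) L + |α|, that is |α| < L.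
  have h1 : m.length (c.powWord K α) < m.length (c.tau (K * n) ++ α) := by
    rw [length_powWord, length_append, length_tau]
    have := m.one_lt_pow_stretch hK
    nlinarith
  have hp : c.powWord K α <+: c.tau (K * n) ++ α :=
    m.prefix_of_length_le (w := c.powWord K (α ++ x :: β))
      (by rw [hsplit]; exact List.prefix_append _ _)
      (by refine List.IsPrefix.trans ?_ hKv; rw [← List.append_assoc]; exact List.prefix_append _ _)
      h1.le
  obtain ⟨δ, hδ⟩ := hp
  have hδ0 : δ ≠ [] := by
    rintro rfl
    rw [List.append_nil] at hδ
    rw [hδ] at h1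
    exact lt_irrefl _ h1
  rw [← List.append_assoc, ← hδ, hsplit, List.append_assoc, List.prefix_append_right_inj] at hKv hKw
  obtain ⟨s, hs⟩ := hKv
  obtain ⟨t, ht⟩ := hKw
  by_cases hT : s(x, y) = c.turn 0
  · have hat : c.AtTurn (K * n) (x :: β) (y :: γ) :=
      ⟨δ, x, β ++ s, y, γ ++ t, by rw [← powWord, ← hs]; simp, by rw [← powWord, ← ht]; simp,
        by rw [turn_mul, hT]⟩
    -- Here δ is followed by the distinct edges x and y, so it is the whole common initial path,
    -- which is `tau (K * n)`.
    have hd := (hat.atTau (atTau_zero rfl rfl hT) _ le_rfl).eq_tau (τ := δ) (x := x)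
      (v₁ := β ++ s) (y := y) (v₂ := γ ++ t) (by rw [← powWord, ← hs]; simp)
      (by rw [← powWord, ← ht]; simp) hxy
    have e := congrArg m.length hδ
    rw [hd, length_append, length_append, length_powWord] at e
    have := m.one_lt_pow_stretch hK
    nlinarith
  · have e1 := c.head?_genWord (K * n) (x :: β)
    have e2 := c.head?_genWord (K * n) (y :: γ)
    rw [← powWord, ← hs] at e1
    rw [← powWord, ← ht] at e2
    cases δ with
    | nil => exact hδ0 rfl
    | cons d δ =>
      simp only [List.cons_append, List.head?_cons, Option.map_some, Option.some.injEq] at e1 e2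
      exact genDir_ne hxy hT _ (e1.symm.trans e2)

/-- Both pairs are periodic for the product of their periods, and corresponding sides have the same
first edge. -/
theorem GoodPair.unique {p₁ p₂ q₁ q₂ : EdgeWord r} (hp : m.GoodPair p₁ p₂)
    (hq : m.GoodPair q₁ q₂) : p₁ = q₁ ∧ p₂ = q₂ := by
  obtain ⟨K, hK, h1, h2⟩ := hp.periodic
  obtain ⟨J, hJ, h3, h4⟩ := hq.periodic
  have hKJ : 1 ≤ K * J := Nat.one_le_iff_ne_zero.2 (by positivity)
  have h1' := periodic_iterate h1 J
  have h2' := periodic_iterate h2 J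
  have h3' := periodic_iterate h3 K
  have h4' := periodic_iterate h4 K
  rw [mul_comm J K] at h3' h4'
  exact ⟨side_unique hKJ (hp.head₁.trans hq.head₁.symm) hp.ends₁ hq.ends₁ h1' h3',
    side_unique hKJ (hp.head₂.trans hq.head₂.symm) hp.ends₂ hq.ends₂ h2' h4'⟩

/-- By periodicity the pair is back at T_0 at arbitrarily late times, hence it was at every turn in
between. -/
theorem GoodPair.atTau {p₁ p₂ : EdgeWord r} (hp : m.GoodPair p₁ p₂) (N : ℕ) :
    c.AtTau N p₁ p₂ := by
  obtain ⟨K, hK, h1, h2⟩ := hp.periodic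
  obtain ⟨t₁, ht₁⟩ := periodic_iterate h1 N
  obtain ⟨t₂, ht₂⟩ := periodic_iterate h2 N
  obtain ⟨v₁, hv₁⟩ := List.head?_eq_some_iff.1 hp.head₁
  obtain ⟨v₂, hv₂⟩ := List.head?_eq_some_iff.1 hp.head₂
  have h0 := atTau_zero hp.head₁ hp.head₂ c.turn_zero.symm
  have hat : c.AtTurn (K * N * n) p₁ p₂ := by
    refine ⟨c.tau (K * N * n), (c.fold 1).u, v₁ ++ t₁, (c.fold 1).a, v₂ ++ t₂, ?_, ?_, ?_⟩
    · rw [← powWord, ← ht₁, hv₁]; simp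
    · rw [← powWord, ← ht₂, hv₂]; simp
    · rw [turn_mul, turn_zero]
  refine hat.atTau h0 N ?_
  calc N = 1 * N * 1 := by ring
    _ ≤ K * N * n := Nat.mul_le_mul (Nat.mul_le_mul_right N hK) NeZero.one_le

/-- A pair that continues forever yields a periodic one. -/
theorem exists_goodPair_of_atTau {w₁ w₂ : EdgeWord r} (hw₁ : c.Legal 0 w₁) (hw₂ : c.Legal 0 w₂)
    (h : ∀ N, c.AtTau N w₁ w₂) : ∃ p₁ p₂, m.GoodPair p₁ p₂ := by
  have hL := m.halfLength_pos
  have hfin : Nonempty (Fin r) := ⟨(c.fold 1).u.1⟩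
  have h1 := m.halfLength_le_of_atTau h
  have h2 := m.halfLength_le_of_atTau fun N => (h N).symm
  have key : ∀ (p : ℕ) (w : EdgeWord r), c.tau (p * n) <+: c.powWord p w →
      m.halfLength ≤ m.length w → ∃ s, c.tau (p * n) ++ s <+: c.powWord p w ∧
      m.EndsInLast s m.halfLength := by
    rintro p w ⟨t, ht⟩ hw
    have e := congrArg m.length ht
    rw [length_append, length_tau, length_powWord] at e
    have := m.one_le_pow_stretch p
    obtain ⟨s, hs, hs'⟩ := m.exists_prefix_endsInLast (w := t) hL (by nlinarith)
    exact ⟨s, by rw [← ht, List.prefix_append_right_inj]; exact hs, hs'⟩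
  have key2 : ∀ p : ℕ, ∃ s : EdgeWord r × EdgeWord r,
      (c.tau (p * n) ++ s.1 <+: c.powWord p w₁ ∧ m.EndsInLast s.1 m.halfLength) ∧
      (c.tau (p * n) ++ s.2 <+: c.powWord p w₂ ∧ m.EndsInLast s.2 m.halfLength) := by
    intro p
    obtain ⟨x, v₁, y, v₂, e1, e2, -⟩ := h (p * n)
    obtain ⟨s₁, hs₁⟩ := key p w₁ (by unfold powWord; rw [e1]; exact List.prefix_append _ _) h1
    obtain ⟨s₂, hs₂⟩ := key p w₂ (by unfold powWord; rw [e2]; exact List.prefix_append _ _) h2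
    exact ⟨(s₁, s₂), hs₁, hs₂⟩
  -- `F p` records the beginnings, up to distance L, of what remains of the two sides after g^p.
  -- Only finitely many values are possible, so two times agree.
  choose F hF₁ hF₂ using key2
  have hS := m.finite_length_dropLast_lt m.halfLength
  obtain ⟨p, -, q, -, hpq, hFe⟩ := Set.infinite_univ.exists_lt_map_eq_of_mapsTo
    (f := F) (t := {w : EdgeWord r | m.length w.dropLast < m.halfLength} ×ˢ
      {w : EdgeWord r | m.length w.dropLast < m.halfLength})
    (fun p _ => ⟨(hF₁ p).2.1, (hF₂ p).2.1⟩) (hS.prod hS)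
  obtain ⟨K, rfl⟩ := Nat.exists_eq_add_of_lt hpq
  rw [add_assoc] at hFe
  have hper : ∀ w s : EdgeWord r, c.tau (p * n) ++ s <+: c.powWord p w →
      c.tau ((p + (K + 1)) * n) ++ s <+: c.powWord (p + (K + 1)) w →
      m.halfLength ≤ m.length s →
      c.tau ((K + 1) * n) ++ s <+: c.powWord (K + 1) s := by
    intro w s e1 e2 e3
    have e4 := c.genWord_prefix (N := (K + 1) * n) e1
    rw [powWord_add, add_mul, tau_add, List.append_assoc] at e2
    rw [genWord_append] at e4
    -- Both words, preceded by the image of the path removed at time p, are initial subpaths of the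
    -- same image of w. So only lengths have to be compared: (λ^k - 1) L + |s| ≤ λ^k |s| with k = K
    -- + 1, which is |s| ≥ L.
    rw [← List.prefix_append_right_inj (c.genWord ((K + 1) * n) (c.tau (p * n)))]
    refine m.prefix_of_length_le e2 e4 ?_
    rw [length_append, length_append, length_append, length_tau, length_powWord]
    have := m.one_le_pow_stretch (K + 1)
    nlinarith
  have hp₁ := hper w₁ (F p).1 (hF₁ p).1 (by rw [hFe]; exact (hF₁ _).1) (hF₁ p).2.2
  have hp₂ := hper w₂ (F p).2 (hF₂ p).1 (by rw [hFe]; exact (hF₂ _).1) (hF₂ p).2.2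
  have hleg : ∀ w s : EdgeWord r, c.Legal 0 w → c.tau (p * n) ++ s <+: c.powWord p w →
      c.Legal 0 s := by
    rintro w s hw ⟨t, ht⟩
    exact (hw.powWord p).infix ⟨_, _, ht⟩
  have hl₁ := hleg _ _ hw₁ (hF₁ p).1
  have hl₂ := hleg _ _ hw₂ (hF₂ p).1
  have hhead : ∀ w s v : EdgeWord r, ∀ x : Dir r, c.tau (p * n) ++ s <+: c.powWord p w → s ≠ [] →
      c.genWord (p * n) w = c.tau (p * n) ++ x :: v → s.head? = some x := by
    intro w s v x e1 e2 e3
    rw [powWord, e3, List.prefix_append_right_inj] at e1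
    cases s with
    | nil => exact absurd rfl e2
    | cons z s => rw [List.cons_prefix_cons] at e1; rw [List.head?_cons, e1.1]
  obtain ⟨x, v₁, y, v₂, e1, e2, hxy⟩ := h (p * n)
  have hx := hhead _ _ _ _ (hF₁ p).1 (EndsInLast.ne_nil m hL (hF₁ p).2) e1
  have hy := hhead _ _ _ _ (hF₂ p).1 (EndsInLast.ne_nil m hL (hF₂ p).2) e2
  rw [turn_mul, turn_zero, Sym2.eq_iff] at hxy
  -- The two sides may have exchanged roles at T_0; then the periodic pair is taken in the other
  -- order.
  rcases hxy with ⟨rfl, rfl⟩ | ⟨rfl, rfl⟩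
  · exact ⟨_, _, hx, hy, hl₁, hl₂, (hF₁ p).2, (hF₂ p).2, K + 1, by omega, hp₁, hp₂⟩
  · exact ⟨_, _, hy, hx, hl₂, hl₁, (hF₂ p).2, (hF₁ p).2, K + 1, by omega, hp₂, hp₁⟩

end

end Metric

end AdmissibleComposition

/-! ### The procedure: prospective pairs, extension and elimination -/

namespace AdmissibleComposition

variable {c : AdmissibleComposition r n}

theorem LegalNext.legal {w : EdgeWord r} {e : Dir r} (h : c.LegalNext w e) (hw : c.Legal 0 w) :
    c.Legal 0 (w ++ [e]) := by
  refine List.IsChain.append hw (List.isChain_singleton e) ?_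
  intro x hx y hy
  simp only [List.head?_cons, Option.mem_def, Option.some.injEq] at hy
  subst hy
  simpa using h x hx

theorem Legal.legalNext {w s : EdgeWord r} {e : Dir r} (h : c.Legal 0 (w ++ e :: s)) :
    c.LegalNext w e := by
  intro x hx
  have := (List.isChain_append.1 h).2.2 x hx e rfl
  simpa using this

theorem Swallowed.absorbed {N : ℕ} {w₁ w₂ : EdgeWord r} (h : c.Swallowed N w₁ w₂)
    (hrun : ∀ k < N, c.AtTau k w₁ w₂) : c.Absorbed N w₁ w₂ (c.fd N).u := by
  obtain ⟨h1, v, h2⟩ := h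
  exact ⟨fun k hk => (hrun k hk).atTurn, v, by rw [h2, h1]⟩

/-- A pair that starts with `T_0` continues forever, or (IIb) or (IIc) occurs for it. -/
theorem AtTau.cases {w₁ w₂ : EdgeWord r} (h : c.AtTau 0 w₁ w₂) :
    (∀ N, c.AtTau N w₁ w₂) ∨ (∃ N, c.Diverges N w₁ w₂) ∨ (∃ N t, c.Absorbed N w₁ w₂ t) ∨
      ∃ N t, c.Absorbed N w₂ w₁ t := by
  by_cases hall : ∀ N, c.AtTau N w₁ w₂
  · exact Or.inl hall
  push Not at hall
  obtain ⟨N, hN⟩ := hall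
  right
  rcases h.run N with h1 | ⟨M, -, hrun, h1 | h1 | h1⟩
  · exact absurd (h1 N le_rfl) hN
  · exact Or.inr (Or.inl ⟨M, _, h1.absorbed hrun⟩)
  · exact Or.inr (Or.inr ⟨M, _, h1.absorbed fun k hk => (hrun k hk).symm⟩)
  · obtain ⟨τ, x, v₁, y, v₂, h2⟩ := h1
    exact Or.inl ⟨M, fun k hk => (hrun k hk).atTurn, τ, x, v₁, y, v₂, h2⟩

/-- If the sides `w₁`, `w₂` of a pair that continues forever are cut off and one of them is
absorbed, then the next edge of that side is among those that (III) suggests. -/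
theorem Absorbed.exists_nextEdge {N : ℕ} {w₁ w₂ p₁ p₂ : EdgeWord r} {t : Dir r}
    (h : c.Absorbed N w₁ w₂ t) (h₀ : c.AtTau 0 w₁ w₂) (hp : c.AtTau N p₁ p₂)
    (hp₂ : c.Legal 0 p₂) (h₁ : w₁ <+: p₁) (h₂ : w₂ <+: p₂) :
    ∃ e, w₂ ++ [e] <+: p₂ ∧ c.NextEdge N t w₂ e := by
  obtain ⟨⟨e2, v, e1⟩, rfl⟩ := h.swallowed h₀
  obtain ⟨x, v₁, y, v₂, f1, f2, hxy⟩ := hp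
  obtain ⟨s₁, rfl⟩ := h₁
  obtain ⟨s₂, rfl⟩ := h₂
  rw [genWord_append, e1, List.append_assoc, List.append_cancel_left_eq, List.cons_append,
    List.cons.injEq] at f1
  rw [genWord_append, e2, List.append_cancel_left_eq] at f2
  cases s₂ with
  | nil => simp at f2
  | cons e s =>
    have hy := c.head?_genWord N (e :: s)
    rw [f2, List.head?_cons, List.head?_cons, Option.map_some, Option.some.injEq] at hy
    refine ⟨e, ⟨s, by simp⟩, fun _ => ?_, fun hred => ?_, hp₂.legalNext⟩
    · rw [← hxy, f1.1, ← hy, Sym2.eq_swap]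
    · exact absurd ((c.mem_red_iff _ _).2 rfl) hred

/-- A pair that is ruled out is not the beginning of a pair that continues forever. -/
theorem RuledOut.not_prefix {w₁ w₂ : EdgeWord r} (h : c.RuledOut w₁ w₂) {p₁ p₂ : EdgeWord r}
    (hp : ∀ N, c.AtTau N p₁ p₂) (hl₁ : c.Legal 0 p₁) (hl₂ : c.Legal 0 p₂)
    (h₀ : c.AtTau 0 w₁ w₂) (h₁ : w₁ <+: p₁) (h₂ : w₂ <+: p₂) : False := by
  induction h with
  | diverges w₁ w₂ N hd => exact (Separated.mono_prefix hd.2 h₁ h₂).not_atTurn (hp N).atTurn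
  | right w₁ w₂ N t ha _ ih =>
    obtain ⟨e, he, hn⟩ := ha.exists_nextEdge h₀ (hp N) hl₂ h₁ h₂
    exact ih e hn (h₀.mono List.prefix_rfl (List.prefix_append _ _)) h₁ he
  | left w₁ w₂ N t ha _ ih =>
    obtain ⟨e, he, hn⟩ := ha.exists_nextEdge h₀.symm (hp N).symm hl₁ h₂ h₁
    exact ih e hn (h₀.mono (List.prefix_append _ _) List.prefix_rfl) he h₂

/-- The remainders start with the first edges of the sides, which form T_0 = T_{pn}, so the pair is
at its turn and the removed path is the standard one. -/
theorem Returns.atTau {p : ℕ} {w₁ w₂ τ γ₁ γ₂ : EdgeWord r} (h : c.Returns p w₁ w₂ τ γ₁ γ₂)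
    (h₀ : c.AtTau 0 w₁ w₂) : (∀ k ≤ p * n, c.AtTau k w₁ w₂) ∧ τ = c.tau (p * n) := by
  obtain ⟨-, -, e1, e2, hγ₁, hγ₂, hd₁, hd₂⟩ := h
  obtain ⟨x, v₁, y, v₂, f1, f2, hxy⟩ := h₀
  rw [genWord_zero] at f1 f2
  rw [f1] at hd₁
  rw [f2] at hd₂
  obtain ⟨s₁, rfl⟩ := List.head?_eq_some_iff.1 hd₁
  obtain ⟨s₂, rfl⟩ := List.head?_eq_some_iff.1 hd₂
  have hat : c.AtTurn (p * n) w₁ w₂ :=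
    ⟨τ, x, s₁, y, s₂, e1, e2, by rw [hxy, turn_mul, Nat.cast_zero]⟩
  have h0 : c.AtTau 0 w₁ w₂ := ⟨x, v₁, y, v₂, f1, f2, hxy⟩
  exact ⟨hat.atTau h0, (hat.atTau h0 _ le_rfl).eq_tau e1 e2 (ne_of_eq_turn hxy)⟩

theorem Arises.mono {b b' : ℕ} (hb : b ≤ b') {w₁ w₂ : EdgeWord r} (h : c.Arises b w₁ w₂) :
    c.Arises b' w₁ w₂ := by
  induction h with
  | start => exact .start
  | addRight w₁ w₂ N t e _ hN h1 h2 ih =>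
    exact .addRight w₁ w₂ N t e ih (hN.trans (Nat.mul_le_mul_right n hb)) h1 h2
  | addLeft w₁ w₂ N t e _ hN h1 h2 ih =>
    exact .addLeft w₁ w₂ N t e ih (hN.trans (Nat.mul_le_mul_right n hb)) h1 h2
  | shortRight w₁ w₂ p τ γ₁ γ₂ t e _ hp h1 h2 h3 h4 h5 ih =>
    exact .shortRight w₁ w₂ p τ γ₁ γ₂ t e ih (hp.trans hb) h1 h2 h3 h4 h5
  | shortLeft w₁ w₂ p τ γ₁ γ₂ t e _ hp h1 h2 h3 h4 h5 ih =>
    exact .shortLeft w₁ w₂ p τ γ₁ γ₂ t e ih (hp.trans hb) h1 h2 h3 h4 h5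

namespace Metric

variable (m : c.Metric)

theorem Finds.mono {b b' : ℕ} (hb : b ≤ b') {σ : MPath r} (h : c.Finds m b σ) :
    c.Finds m b' σ := by
  cases h with
  | exact w₁ w₂ p τ h1 h2 h3 => exact .exact w₁ w₂ p τ (h1.mono hb) (h2.trans hb) h3
  | trimmed w₁ w₂ p τ γ₁ γ₂ L₁ L₂ h1 h2 h3 h4 h5 h6 h7 h8 h9 h10 =>
    exact .trimmed w₁ w₂ p τ γ₁ γ₂ L₁ L₂ (h1.mono hb) (h2.trans hb) h3 h4 h5 h6 h7 h8 h9 h10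

/-- What the procedure maintains about the sides of a prospective pair. -/
structure Prospective (w₁ w₂ : EdgeWord r) : Prop where
  head₁ : w₁.head? = some (c.fold 1).u
  head₂ : w₂.head? = some (c.fold 1).a
  legal₁ : c.Legal 0 w₁
  legal₂ : c.Legal 0 w₂
  short₁ : m.length w₁.dropLast < m.halfLength
  short₂ : m.length w₂.dropLast < m.halfLength

variable {m}

theorem Prospective.atTau {w₁ w₂ : EdgeWord r} (h : m.Prospective w₁ w₂) : c.AtTau 0 w₁ w₂ :=
  atTau_zero h.head₁ h.head₂ c.turn_zero.symm

theorem head?_concat {w : EdgeWord r} {x : Dir r} (h : w.head? = some x) (e : Dir r) :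
    (w ++ [e]).head? = some x := by
  rw [List.head?_append, h]; rfl

theorem Prospective.addRight {w₁ w₂ : EdgeWord r} (h : m.Prospective w₁ w₂) {e : Dir r}
    (he : c.LegalNext w₂ e) (hs : m.length w₂ < m.halfLength) :
    m.Prospective w₁ (w₂ ++ [e]) :=
  ⟨h.head₁, head?_concat h.head₂ e, h.legal₁, he.legal h.legal₂, h.short₁, by simpa using hs⟩

theorem Prospective.addLeft {w₁ w₂ : EdgeWord r} (h : m.Prospective w₁ w₂) {e : Dir r}
    (he : c.LegalNext w₁ e) (hs : m.length w₁ < m.halfLength) :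
    m.Prospective (w₁ ++ [e]) w₂ :=
  ⟨head?_concat h.head₁ e, h.head₂, he.legal h.legal₁, h.legal₂, by simpa using hs, h.short₂⟩

theorem GoodPair.start_prefix {p₁ p₂ : EdgeWord r} (h : m.GoodPair p₁ p₂) :
    [(c.fold 1).u] <+: p₁ ∧ [(c.fold 1).a] <+: p₂ := by
  obtain ⟨v₁, hv₁⟩ := List.head?_eq_some_iff.1 h.head₁
  obtain ⟨v₂, hv₂⟩ := List.head?_eq_some_iff.1 h.head₂
  exact ⟨⟨v₁, hv₁.symm⟩, ⟨v₂, hv₂.symm⟩⟩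

/-- The period K serves all truncations at once: since g^K(p_i) = τ p_i σ_i, the remainder of a
truncated side is an initial subpath of p_i σ_i, hence comparable with the truncation. This is the
source of the bound in the third claim. -/
theorem GoodPair.exists_returns {p₁ p₂ : EdgeWord r} (h : m.GoodPair p₁ p₂) :
    ∃ K, 1 ≤ K ∧ ∀ w₁ w₂, w₁ <+: p₁ → w₂ <+: p₂ → (∀ N ≤ K * n, c.AtTurn N w₁ w₂) →
      ∃ γ₁ γ₂ σ₁ σ₂, c.Returns K w₁ w₂ (c.tau (K * n)) γ₁ γ₂ ∧ γ₁ <+: p₁ ++ σ₁ ∧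
        γ₂ <+: p₂ ++ σ₂ := by
  obtain ⟨K, hK, ⟨σ₁, e1⟩, ⟨σ₂, e2⟩⟩ := h.periodic
  refine ⟨K, hK, fun w₁ w₂ h1 h2 hat => ?_⟩
  have h0 : c.AtTau 0 w₁ w₂ := by
    obtain ⟨τ, x, v₁, y, v₂, f1, f2, hxy⟩ := hat 0 (Nat.zero_le _)
    rw [genWord_zero] at f1 f2
    subst f1 f2
    obtain ⟨q₁, hq₁⟩ := h1
    obtain ⟨q₂, hq₂⟩ := h2
    cases τ with
    | nil => exact ⟨x, v₁, y, v₂, rfl, rfl, hxy⟩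
    -- A nonempty common beginning would give both sides the same first edge, but these edges are
    -- u_1 and a_1.
    | cons t τ =>
      exfalso
      have a1 := h.head₁
      have a2 := h.head₂
      rw [← hq₁] at a1
      rw [← hq₂] at a2
      simp only [List.cons_append, List.head?_cons, Option.some.injEq] at a1 a2
      exact (c.fold 1).ne (a2.symm.trans a1)
  obtain ⟨x, v₁, y, v₂, f1, f2, hxy⟩ := (hat _ le_rfl).atTau h0 _ le_rfl
  have key : ∀ w p v σ : EdgeWord r, ∀ x : Dir r, w <+: p → w ≠ [] →
      c.tau (K * n) ++ p ++ σ = c.powWord K p →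
      c.genWord (K * n) w = c.tau (K * n) ++ x :: v →
      x :: v <+: p ++ σ ∧ (x :: v).head? = w.head? := by
    intro w p v σ x hwp hw hp hv
    have hpre := c.genWord_prefix (N := K * n) hwp
    rw [← powWord, ← powWord, ← hp, powWord, hv, List.append_assoc,
      List.prefix_append_right_inj] at hpre
    refine ⟨hpre, ?_⟩
    obtain ⟨s, rfl⟩ := hwp
    cases w with
    | nil => exact absurd rfl hw
    | cons z w =>
      rw [List.cons_append, List.cons_append, List.cons_prefix_cons] at hpre
      rw [List.head?_cons, List.head?_cons, hpre.1]
  have hne₁ : w₁ ≠ [] := by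
    rintro rfl; simp at f1
  have hne₂ : w₂ ≠ [] := by
    rintro rfl; simp at f2
  obtain ⟨a1, a2⟩ := key w₁ p₁ v₁ σ₁ x h1 hne₁ e1 f1
  obtain ⟨b1, b2⟩ := key w₂ p₂ v₂ σ₂ y h2 hne₂ e2 f2
  exact ⟨x :: v₁, y :: v₂, σ₁, σ₂, ⟨hK, fun k hk => hat k hk.le, f1, f2, by simp, by simp, a2, b2⟩,
    a1, b1⟩

theorem comparable_of_prefix {γ w p σ : EdgeWord r} (h : γ <+: p ++ σ) (hw : w <+: p) :
    Comparable γ w :=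
  List.prefix_or_prefix_of_prefix h (hw.trans (List.prefix_append _ _))

variable [NeZero n]

variable (m) in
theorem prospective_start : m.Prospective [(c.fold 1).u] [(c.fold 1).a] :=
  ⟨rfl, rfl, List.isChain_singleton _, List.isChain_singleton _, m.halfLength_pos,
    m.halfLength_pos⟩

variable (m) in
theorem length_lt_of_absorbed {N : ℕ} {w₁ w₂ : EdgeWord r} {t : Dir r}
    (h : c.Absorbed N w₁ w₂ t) (h₀ : c.AtTau 0 w₁ w₂) : m.length w₂ < m.halfLength :=
  m.lt_halfLength_of_prefix_tau (by rw [(h.swallowed h₀).1.1])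

variable (m) in
-- λ^p |w| = (λ^p - 1) L + |γ| and |γ| < |w|, so |w| < L.
theorem length_lt_of_short {p : ℕ} {w τ γ : EdgeWord r} {t : Dir r} (hp : 1 ≤ p)
    (h : c.powWord p w = τ ++ γ) (hτ : τ = c.tau (p * n)) (hγ : γ ++ [t] <+: w) :
    m.length w < m.halfLength := by
  have e := congrArg m.length h
  rw [length_append, hτ, length_tau, length_powWord] at e
  have h1 := m.length_le_of_prefix hγ
  rw [length_append, length_cons, length_nil] at h1
  have h2 := m.len_pos t.1
  have h3 := m.one_lt_pow_stretch hp
  nlinarith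

variable (m) in
-- An edge is only ever added to a side shorter than L: either the side has been absorbed, or its
-- remainder under g^p is too short.
theorem prospective_of_arises {b : ℕ} {w₁ w₂ : EdgeWord r} (h : c.Arises b w₁ w₂) :
    m.Prospective w₁ w₂ := by
  induction h with
  | start => exact m.prospective_start
  | addRight w₁ w₂ N t e _ _ h1 h2 ih =>
    exact ih.addRight h2.2.2 (m.length_lt_of_absorbed h1 ih.atTau)
  | addLeft w₁ w₂ N t e _ _ h1 h2 ih =>
    exact ih.addLeft h2.2.2 (m.length_lt_of_absorbed h1 ih.atTau.symm)
  | shortRight w₁ w₂ p τ γ₁ γ₂ t e _ _ h1 _ h2 _ h3 ih =>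
    exact ih.addRight h3 (m.length_lt_of_short h1.1 h1.2.2.2.1 (h1.atTau ih.atTau).2 h2)
  | shortLeft w₁ w₂ p τ γ₁ γ₂ t e _ _ h1 h2 _ _ h3 ih =>
    exact ih.addLeft h3 (m.length_lt_of_short h1.1 h1.2.2.1 (h1.atTau ih.atTau).2 h2)

theorem finite_arises (m : c.Metric) :
    {q : EdgeWord r × EdgeWord r | ∃ b, c.Arises b q.1 q.2}.Finite := by
  have hfin : Nonempty (Fin r) := ⟨(c.fold 1).u.1⟩
  have hS := m.finite_length_dropLast_lt m.halfLength
  refine (hS.prod hS).subset ?_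
  rintro ⟨w₁, w₂⟩ ⟨b, hb⟩
  have := m.prospective_of_arises hb
  exact ⟨this.short₁, this.short₂⟩

theorem GoodPair.not_ruledOut {p₁ p₂ w₁ w₂ : EdgeWord r} (h : m.GoodPair p₁ p₂)
    (hw : m.Prospective w₁ w₂) (h₁ : w₁ <+: p₁) (h₂ : w₂ <+: p₂) : ¬ c.RuledOut w₁ w₂ :=
  fun hr => hr.not_prefix h.atTau h.legal₁ h.legal₂ hw.atTau h₁ h₂

/-- Starting from the initial pair, follow the edges of the periodic pair. A truncation of it cannot
separate; if a side is absorbed, its true next edge is among those tried in (III); if the truncation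
runs forever, its sides reach L and it is the whole pair. The bound is enlarged to cover each time
of absorption. -/
theorem GoodPair.arises {p₁ p₂ : EdgeWord r} (h : m.GoodPair p₁ p₂) : ∃ b, c.Arises b p₁ p₂ := by
  have hNn : ∀ N, N ≤ N * n := fun N => Nat.le_mul_of_pos_right N (NeZero.pos n)
  -- `k` bounds the number of edges still missing.
  have key : ∀ k b w₁ w₂, c.Arises b w₁ w₂ → w₁ <+: p₁ → w₂ <+: p₂ →
      p₁.length + p₂.length ≤ w₁.length + w₂.length + k → ∃ b, c.Arises b p₁ p₂ := by
    intro k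
    induction k with
    | zero =>
      intro b w₁ w₂ hA h1 h2 hk
      have e1 := h1.length_le
      have e2 := h2.length_le
      rw [← h1.eq_of_length (by omega), ← h2.eq_of_length (by omega)]
      exact ⟨b, hA⟩
    | succ k ih =>
      intro b w₁ w₂ hA h1 h2 hk
      have hP := m.prospective_of_arises hA
      rcases hP.atTau.cases with h3 | ⟨N, h3⟩ | ⟨N, t, h3⟩ | ⟨N, t, h3⟩
      · rw [← m.eq_of_endsInLast h1 ⟨hP.short₁, m.halfLength_le_of_atTau h3⟩ h.ends₁,
          ← m.eq_of_endsInLast h2 ⟨hP.short₂, m.halfLength_le_of_atTau fun N => (h3 N).symm⟩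
            h.ends₂]
        exact ⟨b, hA⟩
      · exact absurd (h.atTau N).atTurn (Separated.mono_prefix h3.2 h1 h2).not_atTurn
      · obtain ⟨e, he, hn⟩ := h3.exists_nextEdge hP.atTau (h.atTau N) h.legal₂ h1 h2
        refine ih (max b N) w₁ (w₂ ++ [e]) (.addRight w₁ w₂ N t e (hA.mono (le_max_left _ _)) ?_ h3
          hn) h1 he ?_
        · exact (hNn N).trans (Nat.mul_le_mul_right n (le_max_right _ _))
        · rw [List.length_append, List.length_singleton]; omega
      · obtain ⟨e, he, hn⟩ := h3.exists_nextEdge hP.atTau.symm (h.atTau N).symm h.legal₁ h2 h1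
        refine ih (max b N) (w₁ ++ [e]) w₂ (.addLeft w₁ w₂ N t e (hA.mono (le_max_left _ _)) ?_ h3
          hn) he h2 ?_
        · exact (hNn N).trans (Nat.mul_le_mul_right n (le_max_right _ _))
        · rw [List.length_append, List.length_singleton]; omega
  exact key _ 0 _ _ .start h.start_prefix.1 h.start_prefix.2 le_add_self

/-- A pair that is not ruled out and does not run forever has an extension by (III) that is not
ruled out. Sides have boundedly many edges, so this cannot go on, and a pair that runs forever is
reached. -/
theorem exists_goodPair_of_not_ruledOut {w₁ w₂ : EdgeWord r} (hw : m.Prospective w₁ w₂)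
    (h : ¬ c.RuledOut w₁ w₂) : ∃ p₁ p₂, m.GoodPair p₁ p₂ := by
  have hfin : Nonempty (Fin r) := ⟨(c.fold 1).u.1⟩
  -- `B` bounds the number of edges of a side, so the search tree has depth at most `2 * B`.
  obtain ⟨B, hB⟩ := ((m.finite_length_dropLast_lt m.halfLength).image List.length).bddAbove
  have hB' : ∀ w : EdgeWord r, m.length w.dropLast < m.halfLength → w.length ≤ B :=
    fun w hw => hB ⟨w, hw, rfl⟩
  have key : ∀ k w₁ w₂, m.Prospective w₁ w₂ → ¬ c.RuledOut w₁ w₂ →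
      2 * B < w₁.length + w₂.length + k → ∃ p₁ p₂, m.GoodPair p₁ p₂ := by
    intro k
    induction k with
    | zero =>
      intro w₁ w₂ hP _ hk
      have := hB' _ hP.short₁
      have := hB' _ hP.short₂
      omega
    | succ k ih =>
      intro w₁ w₂ hP hr hk
      rcases hP.atTau.cases with h3 | ⟨N, h3⟩ | ⟨N, t, h3⟩ | ⟨N, t, h3⟩
      · exact exists_goodPair_of_atTau hP.legal₁ hP.legal₂ h3
      · exact absurd (RuledOut.diverges _ _ N h3) hr
      · have : ¬ ∀ e, c.NextEdge N t w₂ e → c.RuledOut w₁ (w₂ ++ [e]) :=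
          fun h4 => hr (.right _ _ N t h3 h4)
        push Not at this
        obtain ⟨e, he, hr'⟩ := this
        refine ih _ _ (hP.addRight he.2.2 (m.length_lt_of_absorbed h3 hP.atTau)) hr' ?_
        rw [List.length_append, List.length_singleton]; omega
      · have : ¬ ∀ e, c.NextEdge N t w₁ e → c.RuledOut (w₁ ++ [e]) w₂ :=
          fun h4 => hr (.left _ _ N t h3 h4)
        push Not at this
        obtain ⟨e, he, hr'⟩ := this
        refine ih _ _ (hP.addLeft he.2.2 (m.length_lt_of_absorbed h3 hP.atTau.symm)) hr' ?_
        rw [List.length_append, List.length_singleton]; omega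
  exact key (2 * B + 1) w₁ w₂ hw h (by omega)

/-- The point at distance L is fixed by the period on either side. If g^K(p_i) = τ p_i for both i,
that point is the end of the word and (IVa) applies; otherwise (IVc) does. -/
theorem GoodPair.finds {p₁ p₂ : EdgeWord r} (h : m.GoodPair p₁ p₂) :
    ∃ b, c.Finds m b (m.vee p₁ p₂ m.halfLength m.halfLength) := by
  obtain ⟨b, hb⟩ := h.arises
  obtain ⟨K, hK, ⟨σ₁, e1⟩, ⟨σ₂, e2⟩⟩ := h.periodic
  rw [List.append_assoc] at e1 e2
  have hne₁ := EndsInLast.ne_nil m m.halfLength_pos h.ends₁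
  have hne₂ := EndsInLast.ne_nil m m.halfLength_pos h.ends₂
  have hR : c.Returns K p₁ p₂ (c.tau (K * n)) (p₁ ++ σ₁) (p₂ ++ σ₂) :=
    ⟨hK, fun k _ => (h.atTau k).atTurn, e1.symm, e2.symm, by simp [hne₁], by simp [hne₂],
      List.head?_append_of_ne_nil _ hne₁, List.head?_append_of_ne_nil _ hne₂⟩
  have hA : c.Arises (max b K) p₁ p₂ := hb.mono (le_max_left _ _)
  have hL : m.stretch ^ K * m.halfLength = m.length (c.tau (K * n)) + m.halfLength := by
    rw [length_tau]; ring
  by_cases hσ : p₁ ++ σ₁ = p₁ ∧ p₂ ++ σ₂ = p₂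
  · have hlen : ∀ p σ : EdgeWord r, c.tau (K * n) ++ (p ++ σ) = c.powWord K p → p ++ σ = p →
        m.length p = m.halfLength := by
      intro p σ e1 e2
      rw [e2] at e1
      have e := congrArg m.length e1
      rw [length_append, length_tau, length_powWord] at e
      have := m.one_lt_pow_stretch hK
      have h3 : (m.stretch ^ K - 1) * (m.halfLength - m.length p) = 0 := by linarith
      rcases mul_eq_zero.1 h3 with h4 | h4 <;> linarith
    have := Finds.exact (m := m) p₁ p₂ K (c.tau (K * n)) hA (le_max_right _ _) (by
      rw [hσ.1, hσ.2] at hR; exact hR)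
    rw [hlen p₁ σ₁ e1 hσ.1, hlen p₂ σ₂ e2 hσ.2] at this
    exact ⟨_, this⟩
  · exact ⟨_, .trimmed p₁ p₂ K _ _ _ _ _ hA (le_max_right _ _) hR (List.prefix_append _ _)
      (List.prefix_append _ _) hσ h.ends₁ h.ends₂ hL hL⟩

/-- The fixed point equation λ^p x = |τ| + x has L as its only solution, so both cases of the output
end at distance L. -/
theorem Finds.exists_goodPair {b : ℕ} {σ : MPath r} (h : c.Finds m b σ) :
    ∃ p₁ p₂, m.GoodPair p₁ p₂ ∧ σ = m.vee p₁ p₂ m.halfLength m.halfLength := by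
  have key : ∀ {p : ℕ} {L : ℝ}, 1 ≤ p → m.stretch ^ p * L = m.length (c.tau (p * n)) + L →
      L = m.halfLength := by
    intro p L hp hL
    rw [length_tau] at hL
    have := m.one_lt_pow_stretch hp
    have h3 : (m.stretch ^ p - 1) * (m.halfLength - L) = 0 := by linarith
    rcases mul_eq_zero.1 h3 with h4 | h4 <;> linarith
  cases h with
  | exact w₁ w₂ p τ h1 h2 h3 =>
    have hP := m.prospective_of_arises h1
    have hτ := (h3.atTau hP.atTau).2
    obtain ⟨hp, -, e1, e2, -⟩ := h3
    subst hτ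
    have l1 : m.length w₁ = m.halfLength := key hp (by
      rw [← length_powWord, e1, length_append])
    have l2 : m.length w₂ = m.halfLength := key hp (by
      rw [← length_powWord, e2, length_append])
    exact ⟨w₁, w₂, ⟨hP.head₁, hP.head₂, hP.legal₁, hP.legal₂, ⟨hP.short₁, l1.ge⟩,
      ⟨hP.short₂, l2.ge⟩, p, hp, by rw [e1], by rw [e2]⟩, by rw [l1, l2]⟩
  | trimmed w₁ w₂ p τ γ₁ γ₂ L₁ L₂ h1 h2 h3 h4 h5 h6 h7 h8 h9 h10 =>
    have hP := m.prospective_of_arises h1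
    have hτ := (h3.atTau hP.atTau).2
    obtain ⟨hp, -, e1, e2, -⟩ := h3
    subst hτ
    obtain rfl := key hp h9
    obtain rfl := key hp h10
    refine ⟨w₁, w₂, ⟨hP.head₁, hP.head₂, hP.legal₁, hP.legal₂, h7, h8, p, hp, ?_, ?_⟩, rfl⟩
    · rw [e1, List.prefix_append_right_inj]; exact h4
    · rw [e2, List.prefix_append_right_inj]; exact h5

end Metric

end AdmissibleComposition

/-! ### Points of the universal cover and the lift of g^k -/

/-- Left translation of points of the universal cover of the metric rose. A point is recorded as
in `AdmissibleComposition.Metric.locate`. -/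
def translate (h : FreeGroup (Fin r)) (A : FreeGroup (Fin r) × Option (Fin r × ℝ)) :
    FreeGroup (Fin r) × Option (Fin r × ℝ) := (h * A.1, A.2)

@[simp] theorem translate_one (A : FreeGroup (Fin r) × Option (Fin r × ℝ)) :
    translate 1 A = A := by simp [translate]

@[simp] theorem translate_translate (g h : FreeGroup (Fin r))
    (A : FreeGroup (Fin r) × Option (Fin r × ℝ)) :
    translate g (translate h A) = translate (g * h) A := by simp [translate, mul_assoc]

theorem translate_right_cancel {g h : FreeGroup (Fin r)}
    {A : FreeGroup (Fin r) × Option (Fin r × ℝ)} (e : translate g A = translate h A) :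
    g = h := by
  have := congrArg Prod.fst e
  simpa [translate] using this

namespace AdmissibleComposition

variable {c : AdmissibleComposition r n}

namespace Metric

variable (m : c.Metric)

theorem locate_of_nonpos (w : EdgeWord r) {s : ℝ} (h : s ≤ 0) : m.locate w s = (1, none) := by
  cases w <;> simp [locate, h]

theorem locate_cons_of_lt (x : Dir r) (w : EdgeWord r) {s : ℝ} (h : s < m.len x.1) :
    m.locate (x :: w) s = m.locate [x] s := by
  simp [locate, h]

theorem locate_cons_of_le (x : Dir r) (w : EdgeWord r) {s : ℝ} (h : m.len x.1 ≤ s) :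
    m.locate (x :: w) s = translate (FreeGroup.mk [x]) (m.locate w (s - m.len x.1)) := by
  have := m.len_pos x.1
  rw [locate, if_neg (by linarith), if_neg (by linarith)]
  rfl

theorem locate_singleton_true (x : Dir r) (hx : x.2 = true) {s : ℝ} (h0 : 0 < s)
    (h : s < m.len x.1) : m.locate [x] s = (1, some (x.1, s)) := by
  rw [locate, if_neg (by linarith), if_pos h, if_pos hx]

theorem locate_singleton_false (x : Dir r) (hx : x.2 = false) {s : ℝ} (h0 : 0 < s)
    (h : s < m.len x.1) :
    m.locate [x] s = (FreeGroup.mk [x], some (x.1, m.len x.1 - s)) := by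
  rw [locate, if_neg (by linarith), if_pos h, if_neg (by simp [hx])]

theorem locate_append_right (v w : EdgeWord r) {s : ℝ} (h : 0 ≤ s) :
    m.locate (v ++ w) (m.length v + s) = translate (FreeGroup.mk v) (m.locate w s) := by
  induction v with
  | nil => rw [List.nil_append, length_nil, zero_add]; exact (translate_one _).symm
  | cons x v ih =>
    have := m.length_nonneg v
    rw [List.cons_append, locate_cons_of_le _ _ _ (by rw [length_cons]; linarith), length_cons,
      show m.len x.1 + m.length v + s - m.len x.1 = m.length v + s by ring, ih,
      translate_translate, ← mk_append]
    rfl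

theorem locate_append_left (v w : EdgeWord r) {s : ℝ} (h : s ≤ m.length v) :
    m.locate (v ++ w) s = m.locate v s := by
  induction v generalizing s with
  | nil =>
    rw [length_nil] at h
    rw [locate_of_nonpos _ _ h, locate_of_nonpos _ _ h]
  | cons x v ih =>
    rw [List.cons_append]
    by_cases hs : s < m.len x.1
    · rw [m.locate_cons_of_lt x (v ++ w) hs, m.locate_cons_of_lt x v hs]
    · push Not at hs
      rw [locate_cons_of_le _ _ _ hs, locate_cons_of_le _ _ _ hs, ih]
      rw [length_cons] at h
      linarith

theorem locate_length (w : EdgeWord r) : m.locate w (m.length w) = (FreeGroup.mk w, none) := by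
  have := m.locate_append_right w [] le_rfl
  rw [List.append_nil, add_zero, locate_of_nonpos _ _ le_rfl] at this
  rw [this]
  simp [translate]

theorem locate_bar (x : Dir r) {s : ℝ} (h0 : 0 < s) (h : s < m.len x.1) :
    m.locate [bar x] (m.len x.1 - s) = translate (FreeGroup.mk [x])⁻¹ (m.locate [x] s) := by
  have e : (FreeGroup.mk [x])⁻¹ = FreeGroup.mk [bar x] := FreeGroup.inv_mk
  have h0' : 0 < m.len x.1 - s := by linarith
  have h' : m.len x.1 - s < m.len (bar x).1 := by rw [bar_fst]; linarith
  cases hx : x.2 with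
  | true =>
    rw [m.locate_singleton_true x hx h0 h, m.locate_singleton_false (bar x) (by simp [bar, hx])
      h0' h', e]
    simp [translate]
  | false =>
    rw [m.locate_singleton_false x hx h0 h, m.locate_singleton_true (bar x) (by simp [bar, hx])
      h0' h']
    simp only [translate, inv_mul_cancel, bar_fst]

theorem locate_invRev (w : EdgeWord r) {s : ℝ} (h0 : 0 ≤ s) (h : s ≤ m.length w) :
    m.locate (FreeGroup.invRev w) (m.length w - s) =
      translate (FreeGroup.mk w)⁻¹ (m.locate w s) := by
  induction w generalizing s with
  | nil =>
    rw [length_nil] at h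
    rw [length_nil, locate_of_nonpos _ _ (by linarith), locate_of_nonpos _ _ h,
      ← FreeGroup.one_eq_mk, inv_one, translate_one]
  | cons x w ih =>
    have e : FreeGroup.mk (x :: w) = FreeGroup.mk [x] * FreeGroup.mk w := mk_append [x] w
    rw [length_cons] at h
    rcases h0.eq_or_lt with rfl | h0
    · rw [sub_zero, ← length_invRev, locate_length, locate_of_nonpos _ _ le_rfl, mk_invRev_mul]
      simp [translate]
    · rw [invRev_cons', length_cons]
      by_cases hs : s < m.len x.1
      · rw [show m.len x.1 + m.length w - s = m.length (FreeGroup.invRev w) + (m.len x.1 - s) by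
          rw [length_invRev]; ring, locate_append_right _ _ _ (by linarith), locate_bar _ _ h0 hs,
          m.locate_cons_of_lt x w hs, translate_translate, mk_invRev_mul, e, mul_inv_rev]
      · push Not at hs
        rw [locate_append_left _ _ _ (by rw [length_invRev]; linarith),
          show m.len x.1 + m.length w - s = m.length w - (s - m.len x.1) by ring,
          ih (by linarith) (by linarith), locate_cons_of_le _ _ _ hs, translate_translate, e]
        congr 1
        group

theorem locate_vee_left {v w : EdgeWord r} {L : ℝ} (h0 : 0 ≤ L) (h : L ≤ m.length v) :
    m.locate (FreeGroup.invRev v ++ w) (m.length v - L) =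
      translate (FreeGroup.mk v)⁻¹ (m.locate v L) := by
  rw [locate_append_left _ _ _ (by rw [length_invRev]; linarith), locate_invRev _ _ h0 h]

theorem locate_vee_right {v w : EdgeWord r} {L : ℝ} (h0 : 0 ≤ L) :
    m.locate (FreeGroup.invRev v ++ w) (m.length v + L) =
      translate (FreeGroup.mk v)⁻¹ (m.locate w L) := by
  rw [← length_invRev, locate_append_right _ _ _ h0, mk_invRev_mul]

/-- Two paths are homotopic rel endpoints when the endpoint pairs of their lifts differ by one deck
translation; this makes the relation equivariant under lifts of maps. -/
theorem homotopic_iff {ρ σ : MPath r} : m.Homotopic ρ σ ↔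
    ∃ h, m.locate σ.word σ.a = translate h (m.locate ρ.word ρ.a) ∧
      m.locate σ.word σ.b = translate h (m.locate ρ.word ρ.b) := by
  unfold Homotopic translate
  constructor
  · rintro ⟨h1, h2, h3⟩
    refine ⟨(m.locate σ.word σ.a).1 * (m.locate ρ.word ρ.a).1⁻¹, Prod.ext ?_ h1.symm,
      Prod.ext ?_ h2.symm⟩
    · simp
    · rw [mul_assoc, h3]; simp
  · rintro ⟨h, h1, h2⟩
    rw [h1, h2]
    refine ⟨rfl, rfl, ?_⟩
    simp only
    group

variable {m} in
theorem Homotopic.symm {ρ σ : MPath r} (h : m.Homotopic ρ σ) : m.Homotopic σ ρ :=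
  ⟨h.1.symm, h.2.1.symm, h.2.2.symm⟩

variable {m} in
theorem Homotopic.trans {ρ σ υ : MPath r} (h : m.Homotopic ρ σ) (h' : m.Homotopic σ υ) :
    m.Homotopic ρ υ :=
  ⟨h.1.trans h'.1, h.2.1.trans h'.2.1, h.2.2.trans h'.2.2⟩

/-- If a path is a translate of `vee w v`, then its reverse is a translate of `vee v w`. -/
theorem homotopic_reverse_vee {ρ : MPath r} {v w : EdgeWord r} {L : ℝ} (hρ : m.IsTight ρ)
    (h0 : 0 ≤ L) (hv : L ≤ m.length v) (hw : L ≤ m.length w)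
    (h : m.Homotopic ρ (m.vee w v L L)) : m.Homotopic (m.reverse ρ) (m.vee v w L L) := by
  obtain ⟨g, h1, h2⟩ := m.homotopic_iff.1 h
  obtain ⟨-, a0, ab, b1⟩ := hρ
  simp only [vee] at h1 h2
  rw [m.locate_vee_left h0 hw] at h1
  rw [m.locate_vee_right h0] at h2
  have h1' := congrArg (translate (FreeGroup.mk w)) h1
  have h2' := congrArg (translate (FreeGroup.mk w)) h2
  rw [translate_translate, translate_translate, mul_inv_cancel, translate_one] at h1' h2'
  refine m.homotopic_iff.2 ⟨(FreeGroup.mk v)⁻¹ * FreeGroup.mk w * g * FreeGroup.mk ρ.word, ?_, ?_⟩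
  · simp only [vee, reverse]
    rw [m.locate_vee_left h0 hv, locate_invRev _ _ (by linarith) b1, h2', translate_translate, translate_translate]
    congr 1
    group
  · simp only [vee, reverse]
    rw [m.locate_vee_right h0, locate_invRev _ _ a0 (by linarith), h1', translate_translate,
      translate_translate]
    congr 1
    group

variable (c) in
/-- The endomorphism of the fundamental group induced by `g ^ k`. -/
def powHom (k : ℕ) : FreeGroup (Fin r) →* FreeGroup (Fin r) :=
  FreeGroup.lift fun i => FreeGroup.mk (c.powWord k [(i, true)])

theorem powHom_mk (k : ℕ) (w : EdgeWord r) :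
    powHom c k (FreeGroup.mk w) = FreeGroup.mk (c.powWord k w) := by
  have hx : ∀ x : Dir r, powHom c k (FreeGroup.mk [x]) = FreeGroup.mk (c.powWord k [x]) := by
    have ht : ∀ i, powHom c k (FreeGroup.mk [(i, true)]) =
        FreeGroup.mk (c.powWord k [(i, true)]) := fun i => FreeGroup.lift_apply_of
    rintro ⟨i, s⟩
    cases s with
    | true => exact ht i
    | false =>
      have e : ([(i, false)] : EdgeWord r) = FreeGroup.invRev [(i, true)] := rfl
      rw [e, mk_invRev_mul, map_inv, ht]
      unfold powWord
      rw [genWord_invRev, mk_invRev_mul]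
  induction w with
  | nil => rw [← FreeGroup.one_eq_mk, map_one, powWord, genWord_nil, FreeGroup.one_eq_mk]
  | cons x w ih =>
    have e1 : FreeGroup.mk (x :: w) = FreeGroup.mk [x] * FreeGroup.mk w := mk_append [x] w
    have e2 : c.powWord k (x :: w) = c.powWord k [x] ++ c.powWord k w := c.genWord_cons _ x w
    rw [e1, map_mul, hx, ih, e2, mk_append]

/-- The lift of `g ^ k` to the universal cover of the metric rose. -/
noncomputable def powPoint (k : ℕ) :
    FreeGroup (Fin r) × Option (Fin r × ℝ) → FreeGroup (Fin r) × Option (Fin r × ℝ)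
  | (g, none) => (powHom c k g, none)
  | (g, some (i, t)) =>
    translate (powHom c k g) (m.locate (c.powWord k [(i, true)]) (m.stretch ^ k * t))

theorem powPoint_translate (k : ℕ) (h : FreeGroup (Fin r))
    (A : FreeGroup (Fin r) × Option (Fin r × ℝ)) :
    m.powPoint k (translate h A) = translate (powHom c k h) (m.powPoint k A) := by
  obtain ⟨g, _ | ⟨i, t⟩⟩ := A
  · simp [powPoint, translate]
  · simp [powPoint, translate, mul_assoc]

section

variable [NeZero n]

theorem locate_powWord_singleton (k : ℕ) (x : Dir r) {s : ℝ} (h : s < m.len x.1) :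
    m.locate (c.powWord k [x]) (m.stretch ^ k * s) = m.powPoint k (m.locate [x] s) := by
  have hk : 0 < m.stretch ^ k := by linarith [m.one_le_pow_stretch k]
  rcases le_or_gt s 0 with h0 | h0
  · rw [locate_of_nonpos _ _ h0, locate_of_nonpos _ _ (mul_nonpos_of_nonneg_of_nonpos hk.le h0)]
    simp [powPoint]
  cases hx : x.2 with
  | true =>
    rw [m.locate_singleton_true x hx h0 h]
    have : x = (x.1, true) := by rw [← hx]
    simp only [powPoint, map_one, translate_one]
    rw [← this]
  | false =>
    rw [m.locate_singleton_false x hx h0 h]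
    have e : x = bar (x.1, true) := by rw [bar, Bool.not_true, ← hx]
    have e2 : c.powWord k [x] = FreeGroup.invRev (c.powWord k [(x.1, true)]) := by
      unfold powWord
      rw [← genWord_invRev, invRev_singleton, ← e]
    have hl : m.length (c.powWord k [(x.1, true)]) = m.stretch ^ k * m.len x.1 := by
      rw [length_powWord]; simp
    have hle : m.stretch ^ k * (m.len x.1 - s) ≤ m.length (c.powWord k [(x.1, true)]) := by
      rw [hl]; exact mul_le_mul_of_nonneg_left (by linarith) hk.le
    have := m.locate_invRev (c.powWord k [(x.1, true)])
      (s := m.stretch ^ k * (m.len x.1 - s)) (mul_nonneg hk.le (by linarith)) hle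
    rw [hl, ← mul_sub, sub_sub_cancel, ← e2, ← mk_invRev_mul, ← e2] at this
    rw [this]
    simp only [powPoint]
    rw [powHom_mk]

/-- Since g^k stretches every edge linearly by λ^k, its lift carries the point at arc length s along
a word to the point at arc length λ^k s along the image word. -/
theorem locate_powWord (k : ℕ) (w : EdgeWord r) (s : ℝ) :
    m.locate (c.powWord k w) (m.stretch ^ k * s) = m.powPoint k (m.locate w s) := by
  have hk : 0 < m.stretch ^ k := by linarith [m.one_le_pow_stretch k]
  induction w generalizing s with
  | nil => simp [powWord, locate, powPoint]
  | cons x w ih =>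
    have e2 : c.powWord k (x :: w) = c.powWord k [x] ++ c.powWord k w := c.genWord_cons _ x w
    have hl : m.length (c.powWord k [x]) = m.stretch ^ k * m.len x.1 := by
      rw [length_powWord]; simp
    rw [e2]
    by_cases hs : s < m.len x.1
    · rw [locate_append_left _ _ _ (by rw [hl]; exact mul_le_mul_of_nonneg_left hs.le hk.le),
        locate_powWord_singleton _ _ _ hs, m.locate_cons_of_lt x w hs]
    · push Not at hs
      rw [locate_cons_of_le _ _ _ hs, powPoint_translate, ← ih, powHom_mk, mul_sub, ← hl,
        ← locate_append_right _ _ _ (by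
          rw [hl, ← mul_sub]; exact mul_nonneg hk.le (by linarith)), add_sub_cancel]

theorem Homotopic.image {ρ σ : MPath r} (h : m.Homotopic ρ σ) (k : ℕ) :
    m.Homotopic (m.image k ρ) (m.image k σ) := by
  obtain ⟨g, h1, h2⟩ := m.homotopic_iff.1 h
  refine m.homotopic_iff.2 ⟨powHom c k g, ?_, ?_⟩
  · simp only [Metric.image]
    rw [locate_powWord, locate_powWord, h1, powPoint_translate]
  · simp only [Metric.image]
    rw [locate_powWord, locate_powWord, h2, powPoint_translate]

variable {m} in
theorem IsPNP.of_homotopic {ρ σ : MPath r} (hρ : m.IsPNP ρ) (h : m.Homotopic ρ σ)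
    (hσ : m.IsTight σ) : m.IsPNP σ := by
  obtain ⟨-, k, hk, h1⟩ := hρ
  exact ⟨hσ, k, hk, ((Homotopic.image m h k).symm.trans h1).trans h⟩

end

end Metric

end AdmissibleComposition

/-! ### Counting the turns T_N, and legal segments -/

namespace AdmissibleComposition

variable (c : AdmissibleComposition r n)

/-- The turn at which `v` and `w` are joined is `T_N`. -/
def Junction (N : ℕ) (v w : EdgeWord r) : Prop :=
  ∃ x ∈ v.getLast?, ∃ y ∈ w.head?, s(bar x, y) = c.turn N

open Classical in
/-- The number of times that an edge word takes the turn `T_N`. -/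
noncomputable def illCount (N : ℕ) : EdgeWord r → ℕ
  | [] => 0
  | x :: w => (if c.Junction N [x] w then 1 else 0) + illCount N w

variable {c}

open Classical in
theorem illCount_cons (N : ℕ) (x : Dir r) (w : EdgeWord r) :
    c.illCount N (x :: w) = (if c.Junction N [x] w then 1 else 0) + c.illCount N w := rfl

open Classical in
theorem illCount_append (N : ℕ) (v w : EdgeWord r) :
    c.illCount N (v ++ w) =
      c.illCount N v + c.illCount N w + if c.Junction N v w then 1 else 0 := by
  induction v with
  | nil =>
    rw [if_neg (by simp [Junction])]
    simp [illCount]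
  | cons x v ih =>
    rw [List.cons_append, illCount_cons, illCount_cons, ih]
    cases v with
    | nil =>
      rw [if_neg (c := c.Junction N [] w) (by simp [Junction]),
        if_neg (c := c.Junction N [x] []) (by simp [Junction]), List.nil_append]
      simp [illCount]
      ring
    | cons y v =>
      have e1 : c.Junction N [x] (y :: v ++ w) ↔ c.Junction N [x] (y :: v) := by simp [Junction]
      have e2 : c.Junction N (x :: y :: v) w ↔ c.Junction N (y :: v) w := by simp [Junction]
      simp only [e1, e2]
      ring

theorem illCount_append_of_junction {N : ℕ} {v w : EdgeWord r} (h : c.Junction N v w) :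
    c.illCount N (v ++ w) = c.illCount N v + c.illCount N w + 1 := by
  rw [illCount_append, if_pos h]

theorem illCount_append_le (N : ℕ) (v w : EdgeWord r) :
    c.illCount N v + c.illCount N w ≤ c.illCount N (v ++ w) := by
  rw [illCount_append]
  exact Nat.le_add_right _ _

theorem illCount_append_le_add_one (N : ℕ) (v w : EdgeWord r) :
    c.illCount N (v ++ w) ≤ c.illCount N v + c.illCount N w + 1 := by
  rw [illCount_append]
  split_ifs <;> omega

theorem Legal.illCount_eq_zero {N : ℕ} {w : EdgeWord r} (h : c.Legal N w) :
    c.illCount N w = 0 := by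
  induction w with
  | nil => rfl
  | cons x w ih =>
    rw [illCount_cons, ih (Legal.right (v := [x]) h), if_neg]
    rintro ⟨x', hx, y, hy, hxy⟩
    simp only [List.getLast?_singleton, Option.mem_def, Option.some.injEq] at hx
    subst hx
    exact (List.IsChain.rel_head? h hy).2 hxy

theorem Junction.left_ne_nil {N : ℕ} {v w : EdgeWord r} (h : c.Junction N v w) : v ≠ [] := by
  rintro rfl
  simp [Junction] at h

theorem Junction.right_ne_nil {N : ℕ} {v w : EdgeWord r} (h : c.Junction N v w) : w ≠ [] := by
  rintro rfl
  simp [Junction] at h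

theorem Junction.append_left {N : ℕ} {v w : EdgeWord r} (h : c.Junction N v w)
    (u : EdgeWord r) : c.Junction N (u ++ v) w := by
  obtain ⟨x, hx, h⟩ := h
  exact ⟨x, List.mem_getLast?_append_of_mem_getLast? hx, h⟩

theorem Junction.append_right {N : ℕ} {v w : EdgeWord r} (h : c.Junction N v w)
    (u : EdgeWord r) : c.Junction N v (w ++ u) := by
  obtain ⟨x, hx, y, hy, h⟩ := h
  exact ⟨x, hx, y, List.mem_head?_append_of_mem_head? hy, h⟩

theorem Junction.of_append_left {N : ℕ} {u v w : EdgeWord r} (h : c.Junction N (u ++ v) w)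
    (hv : v ≠ []) : c.Junction N v w := by
  obtain ⟨x, hx, h⟩ := h
  rw [List.getLast?_append_of_ne_nil _ hv] at hx
  exact ⟨x, hx, h⟩

theorem Junction.of_append_right {N : ℕ} {u v w : EdgeWord r} (h : c.Junction N v (w ++ u))
    (hw : w ≠ []) : c.Junction N v w := by
  obtain ⟨x, hx, y, hy, h⟩ := h
  rw [List.head?_append_of_ne_nil _ hw] at hy
  exact ⟨x, hx, y, hy, h⟩

theorem Junction.invRev {N : ℕ} {v w : EdgeWord r} (h : c.Junction N v w) :
    c.Junction N (FreeGroup.invRev w) (FreeGroup.invRev v) := by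
  obtain ⟨x, hx, y, hy, h⟩ := h
  rw [Option.mem_def] at hx hy
  exact ⟨bar y, by rw [getLast?_invRev, hy]; rfl, bar x, by rw [head?_invRev, hx]; rfl,
    by rw [bar_bar, Sym2.eq_swap, h]⟩

/-- If the two cuts differed, the turn T_N at the cut of `A' ++ B'` would lie inside `A` or inside
`B` and make its count exceed the bound. -/
theorem eq_of_append_eq_append {N : ℕ} {A B A' B' : EdgeWord r} (h : A ++ B = A' ++ B')
    (hj : c.Junction N A' B') (hA : c.illCount N A ≤ c.illCount N A')
    (hB : c.illCount N B ≤ c.illCount N B') : A = A' ∧ B = B' := by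
  rcases List.append_eq_append_iff.1 h with ⟨X, rfl, rfl⟩ | ⟨X, rfl, rfl⟩
  · by_cases hX : X = []
    · subst hX; simp
    · rw [illCount_append_of_junction (hj.of_append_left hX)] at hB
      omega
  · by_cases hX : X = []
    · subst hX; simp
    · rw [illCount_append_of_junction (hj.of_append_right hX)] at hA
      omega

variable (c) in
/-- The subdivision of an edge word at all the turns `T_N` that it takes. -/
structure Segmented (N : ℕ) (l : List (EdgeWord r)) : Prop where
  legal : ∀ W ∈ l, c.Legal N W
  chain : l.IsChain (c.Junction N)

theorem exists_segmented {N : ℕ} {w : EdgeWord r} (hw : FreeGroup.IsReduced w) (hne : w ≠ []) :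
    ∃ W l, c.Segmented N (W :: l) ∧ (W :: l).flatten = w ∧ l.length ≤ c.illCount N w ∧
      W ≠ [] := by
  rw [isReduced_iff_isChain] at hw
  induction w with
  | nil => exact absurd rfl hne
  | cons x w ih =>
    by_cases hw0 : w = []
    · subst hw0
      exact ⟨[x], [], ⟨fun V hV => by
        rw [List.mem_singleton.1 hV]; exact List.isChain_singleton _, List.isChain_singleton _⟩,
        by simp, by simp, by simp⟩
    obtain ⟨W, l, hl, rfl, hlen, hW⟩ := ih (List.IsChain.right_of_append (l₁ := [x]) hw) hw0
    obtain ⟨y, W, rfl⟩ := List.exists_cons_of_ne_nil hW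
    have hWl := hl.legal _ (List.mem_cons_self)
    rw [illCount_cons]
    by_cases hj : c.Junction N [x] (y :: W)
    · refine ⟨[x], (y :: W) :: l, ⟨?_, List.isChain_cons_cons.2 ⟨hj, hl.chain⟩⟩, by simp, ?_,
        by simp⟩
      · intro V hV
        rcases List.mem_cons.1 hV with rfl | hV
        · exact List.isChain_singleton _
        · exact hl.legal V hV
      · have hj' := hj.append_right l.flatten
        rw [← List.flatten_cons] at hj'
        rw [if_pos hj', List.length_cons]
        omega
    · refine ⟨x :: y :: W, l, ⟨?_, ?_⟩, by simp, by omega, by simp⟩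
      · intro V hV
        rcases List.mem_cons.1 hV with rfl | hV
        · refine List.isChain_cons_cons.2 ⟨⟨(List.isChain_cons_cons.1 hw).1, fun h => hj ?_⟩, hWl⟩
          exact ⟨x, by simp, y, by simp, h⟩
        · exact hl.legal V (List.mem_cons_of_mem _ hV)
      · have hch := hl.chain
        cases l with
        | nil => exact List.isChain_singleton _
        | cons V l =>
          rw [List.isChain_cons_cons] at hch ⊢
          exact ⟨hch.1.append_left [x], hch.2⟩

theorem illCount_flatten_lt {N : ℕ} {l : List (EdgeWord r)} (hl : ∀ W ∈ l, c.Legal N W)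
    (hne : l ≠ []) : c.illCount N l.flatten < l.length := by
  induction l with
  | nil => exact absurd rfl hne
  | cons V l ih =>
    rw [List.flatten_cons, List.length_cons]
    have hV := (hl V List.mem_cons_self).illCount_eq_zero
    by_cases hl0 : l = []
    · subst hl0; simp [hV]
    have := ih (fun W hW => hl W (List.mem_cons_of_mem _ hW)) hl0
    have := c.illCount_append_le_add_one N V l.flatten
    omega

/-- Legal pieces take no turn T_N in their interior, so each of the joints has to contribute one. -/
theorem segmented_of_le_illCount {N : ℕ} {l : List (EdgeWord r)} (hl : ∀ W ∈ l, c.Legal N W)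
    (h : l.length ≤ c.illCount N l.flatten + 1) : c.Segmented N l := by
  refine ⟨hl, ?_⟩
  induction l with
  | nil => exact List.isChain_nil
  | cons V l ih =>
    rw [List.flatten_cons, List.length_cons] at h
    have hV := (hl V List.mem_cons_self).illCount_eq_zero
    have hl' : ∀ W ∈ l, c.Legal N W := fun W hW => hl W (List.mem_cons_of_mem _ hW)
    by_cases hl0 : l = []
    · subst hl0; exact List.isChain_singleton _
    have h1 := illCount_flatten_lt hl' hl0
    rw [illCount_append] at h
    split_ifs at h with hj
    · have hch := ih hl' (by omega)
      cases l with
      | nil => exact absurd rfl hl0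
      | cons W l =>
        refine List.isChain_cons_cons.2 ⟨?_, hch⟩
        rw [List.flatten_cons] at hj
        refine hj.of_append_right ?_
        cases l with
        | nil =>
          rintro rfl
          exact hj.right_ne_nil (by simp)
        | cons W' l => exact (List.isChain_cons_cons.1 hch).1.left_ne_nil
    · omega

/-- `l'` is obtained from the images of the members of `l` by removing `pre` at the beginning of
the first one, `τ` at the beginning of the others and the inverse of `τ` at the end of all but the
last one. -/
inductive Trimmed (g : EdgeWord r → EdgeWord r) (τ : EdgeWord r) :
    EdgeWord r → List (EdgeWord r) → List (EdgeWord r) → Prop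
  | single (pre W W' : EdgeWord r) : g W = pre ++ W' → Trimmed g τ pre [W] [W']
  | cons (pre V V' W : EdgeWord r) (l l' : List (EdgeWord r)) :
      g V = pre ++ V' ++ FreeGroup.invRev τ → Trimmed g τ τ (W :: l) l' →
      Trimmed g τ pre (V :: W :: l) (V' :: l')

namespace Trimmed

variable {g : EdgeWord r → EdgeWord r} {τ pre : EdgeWord r} {l l' : List (EdgeWord r)}

theorem length_eq (h : Trimmed g τ pre l l') : l'.length = l.length := by
  induction h with
  | single => rfl
  | cons pre V V' W l l' _ _ ih => rw [List.length_cons, ih]; rfl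

/-- Trimming after g and then after f removes f(τ)σ altogether, which is the recursion that defines
`tau`. -/
theorem comp {f : EdgeWord r → EdgeWord r} {σ pre' : EdgeWord r} {l'' : List (EdgeWord r)}
    (hf : ∀ v w, f (v ++ w) = f v ++ f w)
    (hf' : ∀ w, f (FreeGroup.invRev w) = FreeGroup.invRev (f w))
    (h : Trimmed g τ pre l l') (h' : Trimmed f σ pre' l' l'') :
    Trimmed (fun w => f (g w)) (f τ ++ σ) (f pre ++ pre') l l'' := by
  induction h generalizing pre' l'' with
  | single pre W W' e =>
    cases h' with
    | single _ _ W'' e' => exact .single _ _ _ (by simp only [e, hf, e', List.append_assoc])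
  | cons pre V V' W l l' e hWl ih =>
    cases h' with
    | single => cases hWl
    | cons _ _ V'' W' l₁ l'' e' h'' =>
      refine .cons _ _ _ _ _ _ ?_ (ih h'')
      simp only [e, hf, hf', e', FreeGroup.invRev_append, List.append_assoc]

/-- At every joint the removed τ⁻¹τ cancels, so only the first removed path survives in the
fundamental group. -/
theorem mk_flatten (hg : ∀ v w, g (v ++ w) = g v ++ g w) (h : Trimmed g τ pre l l') :
    FreeGroup.mk (g l.flatten) = FreeGroup.mk (pre ++ l'.flatten) := by
  induction h with
  | single pre W W' e => simp only [List.flatten_cons, List.flatten_nil, List.append_nil, e]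
  | cons pre V V' W l l' e _ ih =>
    rw [List.flatten_cons, hg, mk_append, ih, e]
    simp only [List.flatten_cons, mk_append, mk_invRev_mul, mul_assoc, inv_mul_cancel_left]

theorem split {l₁ l₂ : List (EdgeWord r)} (h : Trimmed g τ pre (l₁ ++ l₂) l') (h₁ : l₁ ≠ [])
    (h₂ : l₂ ≠ []) : ∃ l₁' l₂', l' = l₁' ++ l₂' ∧ l₁'.length = l₁.length ∧
      Trimmed g τ τ l₂ l₂' := by
  induction l₁ generalizing pre l' with
  | nil => exact absurd rfl h₁
  | cons V l₁ ih =>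
    by_cases hl₁ : l₁ = []
    · subst hl₁
      obtain ⟨W, l₂, rfl⟩ := List.exists_cons_of_ne_nil h₂
      cases h with
      | cons _ _ V' _ _ l' e h' => exact ⟨[V'], l', rfl, rfl, h'⟩
    · obtain ⟨W, l₁, rfl⟩ := List.exists_cons_of_ne_nil hl₁
      cases h with
      | cons _ _ V' _ _ l' e h' =>
        obtain ⟨l₁', l₂', rfl, hlen, h3⟩ := ih h' hl₁
        exact ⟨V' :: l₁', l₂', rfl, by rw [List.length_cons, hlen]; rfl, h3⟩

end Trimmed

end AdmissibleComposition

/-! ### The evolution of segments under folds -/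

namespace AdmissibleComposition

variable {c : AdmissibleComposition r n}

/-- A side that starts at the turn `T_N`, after the fold and removal of the folded edge. -/
theorem exists_mapWord_eq_cons {f : Fold r} {x : Dir r} (hx : x = f.u ∨ x = f.a)
    (w : EdgeWord r) : ∃ v, f.mapWord (x :: w) = f.a :: v ∧ (x = f.u → v.head? = some f.u) ∧
      (x = f.a → ∀ y ∈ v.head?, y ≠ f.u) := by
  rcases hx with rfl | rfl
  · refine ⟨f.u :: f.mapWord w, by simp [f.image_u], by simp, fun h => absurd h.symm f.ne⟩
  · refine ⟨f.mapWord w, by simp [f.image_a], fun h => absurd h f.ne, ?_⟩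
    intro _ y hy
    rw [f.head?_mapWord, Option.mem_def, Option.map_eq_some_iff] at hy
    obtain ⟨z, -, rfl⟩ := hy
    exact f.dir_ne_u z

theorem turn_cases {N : ℕ} {x y : Dir r} (h : s(x, y) = c.turn N) :
    (x = (c.fd (N + 1)).u ∧ y = (c.fd (N + 1)).a) ∨
      (x = (c.fd (N + 1)).a ∧ y = (c.fd (N + 1)).u) := by
  rwa [turn_nat, Sym2.eq_iff] at h

/-- At the turn T_N the images of both sides begin with a. Once this a is removed, the side that
began with u starts with u, and the other does not, so no further cancellation takes place. `F`
stands for what follows the joint on the right after the removal. -/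
theorem Junction.exists_mapWord_eq {N : ℕ} {V W : EdgeWord r} (h : c.Junction N V W) :
    ∃ P y, (c.fd (N + 1)).mapWord V = P ++ [bar (c.fd (N + 1)).a] ∧ W.head? = some y ∧
      (y = (c.fd (N + 1)).u ∨ y = (c.fd (N + 1)).a) ∧ ∀ F : EdgeWord r,
      (y = (c.fd (N + 1)).u → F.head? = some (c.fd (N + 1)).u) →
      (y = (c.fd (N + 1)).a → ∀ q ∈ F.head?, q ≠ (c.fd (N + 1)).u) →
      ∀ p ∈ P.getLast?, ∀ q ∈ F.head?, q ≠ bar p := by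
  set f := c.fd (N + 1) with hf
  obtain ⟨z, hz, y, hy, hzy⟩ := h
  have hcases := turn_cases hzy
  rw [← hf] at hcases
  have hV : (FreeGroup.invRev V).head? = some (bar z) := by
    rw [head?_invRev, hz]; rfl
  obtain ⟨V₀, hV₀⟩ := List.head?_eq_some_iff.1 hV
  obtain ⟨v, hv, h1, h2⟩ := exists_mapWord_eq_cons (f := f) (x := bar z)
    (by rcases hcases with h | h <;> simp [h.1]) V₀
  rw [← hV₀, Fold.mapWord_invRev] at hv
  have hfV := congrArg FreeGroup.invRev hv
  rw [FreeGroup.invRev_invRev, invRev_cons'] at hfV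
  refine ⟨FreeGroup.invRev v, y, hfV, hy, by rcases hcases with h | h <;> simp [h.2], ?_⟩
  intro F hu ha p hp q hq hqp
  rw [getLast?_invRev, Option.mem_def, Option.map_eq_some_iff] at hp
  obtain ⟨p, hp, rfl⟩ := hp
  rw [bar_bar] at hqp
  subst hqp
  rcases hcases with ⟨e1, e2⟩ | ⟨e1, e2⟩
  · rw [h1 e1, Option.some.injEq] at hp
    exact ha e2 _ hq hp.symm
  · rw [hu e2, Option.mem_def, Option.some.injEq] at hq
    exact h2 e1 _ hp hq.symm

/-- The fold `g_{N+1}` on the segments of a tight word that starts after the turn `T_N`. -/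
theorem Segmented.fold_tail {N : ℕ} {l : List (EdgeWord r)} {W : EdgeWord r} {x : Dir r}
    (h : c.Segmented N (W :: l)) (hW : W.head? = some x)
    (hx : x = (c.fd (N + 1)).u ∨ x = (c.fd (N + 1)).a) :
    ∃ l', Trimmed (c.fd (N + 1)).mapWord [(c.fd (N + 1)).a] [(c.fd (N + 1)).a] (W :: l) l' ∧
      (∀ V ∈ l', c.Legal (N + 1) V) ∧ FreeGroup.IsReduced l'.flatten ∧
      (x = (c.fd (N + 1)).u → l'.flatten.head? = some (c.fd (N + 1)).u) ∧
      (x = (c.fd (N + 1)).a → ∀ y ∈ l'.flatten.head?, y ≠ (c.fd (N + 1)).u) := by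
  set f := c.fd (N + 1) with hf
  induction l generalizing W x with
  | nil =>
    obtain ⟨W, rfl⟩ := List.head?_eq_some_iff.1 hW
    obtain ⟨v, hv, h1, h2⟩ := exists_mapWord_eq_cons hx W
    have hl := (h.legal _ List.mem_cons_self).mapWord
    rw [← hf, hv] at hl
    have hl' : c.Legal (N + 1) v := Legal.right (v := [f.a]) hl
    exact ⟨[v], .single _ _ _ hv, by simpa using hl', by simpa using hl'.isReduced,
      by simpa using h1, by simpa using h2⟩
  | cons V l ih =>
    obtain ⟨P, y, hP, hy, hy', hjoin⟩ := (List.isChain_cons_cons.1 h.chain).1.exists_mapWord_eq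
    rw [← hf] at hP hy' hjoin
    obtain ⟨l', hl', hleg, hred, hu, ha⟩ :=
      ih ⟨fun U hU => h.legal U (List.mem_cons_of_mem _ hU), (List.isChain_cons_cons.1 h.chain).2⟩
        hy hy'
    obtain ⟨W, rfl⟩ := List.head?_eq_some_iff.1 hW
    obtain ⟨X, hX, h1, h2⟩ := exists_mapWord_eq_cons hx W
    have hWl := (h.legal _ List.mem_cons_self).mapWord
    rw [← hf] at hWl
    -- The a removed at the front and its inverse removed at the back are different letters, and
    -- they are not adjacent because the image is tight. So something is left between them.
    cases P with
    | nil =>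
      rw [hX, List.nil_append, List.cons.injEq] at hP
      exact absurd hP.1.symm (bar_ne _)
    | cons p P =>
      rw [hX, List.cons_append, List.cons.injEq] at hP
      obtain ⟨rfl, rfl⟩ := hP
      have hP0 : P ≠ [] := by
        rintro rfl
        rw [hX] at hWl
        exact (List.isChain_cons_cons.1 hWl).1.1 rfl
      have hPl : c.Legal (N + 1) P := by
        rw [hX] at hWl
        exact hWl.infix ⟨[f.a], [bar f.a], rfl⟩
      have hhead : (P ++ l'.flatten).head? = (P ++ [bar f.a]).head? := by
        rw [List.head?_append_of_ne_nil _ hP0, List.head?_append_of_ne_nil _ hP0]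
      refine ⟨P :: l', .cons _ _ _ _ _ _ (by rw [hX]; rfl) hl', ?_, ?_, ?_, ?_⟩
      · intro V' hV'
        rcases List.mem_cons.1 hV' with rfl | hV'
        · exact hPl
        · exact hleg V' hV'
      · rw [List.flatten_cons, isReduced_iff_isChain]
        refine List.IsChain.append (isReduced_iff_isChain.1 hPl.isReduced)
          (isReduced_iff_isChain.1 hred) ?_
        intro p' hp' q hq
        refine hjoin _ hu ha p' ?_ q hq
        rwa [← List.singleton_append, List.getLast?_append_of_ne_nil _ hP0]
      · intro hxu
        rw [List.flatten_cons, hhead, h1 hxu]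
      · intro hxa
        rw [List.flatten_cons, hhead]
        exact h2 hxa

/-- The fold `g_{N+1}` on the segments of a tight word. -/
theorem Segmented.fold {N : ℕ} {l : List (EdgeWord r)} (h : c.Segmented N l) (hne : l ≠ []) :
    ∃ l', Trimmed (c.fd (N + 1)).mapWord [(c.fd (N + 1)).a] [] l l' ∧
      (∀ V ∈ l', c.Legal (N + 1) V) ∧ FreeGroup.IsReduced l'.flatten := by
  obtain ⟨W, l, rfl⟩ := List.exists_cons_of_ne_nil hne
  have hWl := (h.legal _ List.mem_cons_self).mapWord
  cases l with
  | nil =>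
    exact ⟨[(c.fd (N + 1)).mapWord W], .single _ _ _ (by simp), by simpa using hWl,
      by simpa using hWl.isReduced⟩
  | cons V l =>
    obtain ⟨P, y, hP, hy, hy', hjoin⟩ := (List.isChain_cons_cons.1 h.chain).1.exists_mapWord_eq
    obtain ⟨l', hl', hleg, hred, hu, ha⟩ := Segmented.fold_tail
      ⟨fun U hU => h.legal U (List.mem_cons_of_mem _ hU), (List.isChain_cons_cons.1 h.chain).2⟩
        hy hy'
    rw [hP] at hWl
    refine ⟨P :: l', .cons _ _ _ _ _ _ (by rw [hP]; rfl) hl', ?_, ?_⟩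
    · intro V' hV'
      rcases List.mem_cons.1 hV' with rfl | hV'
      · exact hWl.left
      · exact hleg V' hV'
    · rw [List.flatten_cons, isReduced_iff_isChain]
      exact List.IsChain.append (isReduced_iff_isChain.1 hWl.left.isReduced)
        (isReduced_iff_isChain.1 hred) (hjoin _ hu ha)

theorem mk_mapWord_congr {f : Fold r} {v w : EdgeWord r}
    (h : FreeGroup.mk v = FreeGroup.mk w) :
    FreeGroup.mk (f.mapWord v) = FreeGroup.mk (f.mapWord w) := by
  have hx : ∀ w : EdgeWord r, FreeGroup.mk (f.mapWord w) =
      FreeGroup.lift (fun i => FreeGroup.mk (f.image (i, true))) (FreeGroup.mk w) := by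
    intro w
    induction w with
    | nil => rfl
    | cons x w ih =>
      rw [Fold.mapWord_cons, mk_append, ih, ← List.singleton_append (x := x), mk_append, map_mul]
      congr 1
      obtain ⟨i, s⟩ := x
      cases s with
      | true => simp [FreeGroup.lift_mk]
      | false =>
        have : ((i, false) : Dir r) = bar (i, true) := rfl
        rw [this, f.image_bar, mk_invRev_mul, ← invRev_singleton, mk_invRev_mul, map_inv]
        simp [FreeGroup.lift_mk]
  rw [hx, hx, h]

theorem Trimmed.refl {g : EdgeWord r → EdgeWord r} (hg : ∀ w, g w = w) {l : List (EdgeWord r)}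
    (hne : l ≠ []) : Trimmed g [] [] l l := by
  induction l with
  | nil => exact absurd rfl hne
  | cons V l ih =>
    cases l with
    | nil => exact .single _ _ _ (hg V)
    | cons W l => exact .cons _ _ _ _ _ _ (by simp [hg]) (ih (by simp))

/-- The images of a tight word with the turn `T_0` between any two consecutive members of `l`: the
number of turns `T_N` does not increase, and as long as it does not decrease, the segments
persist. -/
theorem Segmented.evolve {l : List (EdgeWord r)} (h : c.Segmented 0 l) (hne : l ≠ [])
    (hred : FreeGroup.IsReduced l.flatten) (N : ℕ) :
    ∃ z, FreeGroup.IsReduced z ∧ FreeGroup.mk z = FreeGroup.mk (c.genWord N l.flatten) ∧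
      (c.illCount N z + 1 < l.length ∨ ∃ l', c.Segmented N l' ∧ l'.flatten = z ∧
        Trimmed (c.genWord N) (c.tau N) [] l l') := by
  induction N with
  | zero => exact ⟨_, hred, rfl, Or.inr ⟨l, h, rfl, .refl (fun _ => rfl) hne⟩⟩
  | succ N ih =>
    obtain ⟨z, hz, hzmk, hcase⟩ := ih
    have hzmk' := mk_mapWord_congr (f := c.fd (N + 1)) hzmk
    rw [← genWord_succ] at hzmk'
    -- Once the number of turns has dropped, the tight word is subdivided afresh; its segments fold
    -- to as many legal pieces, so the number stays below the original one.
    rcases hcase with hlt | ⟨l', hl', rfl, htrim⟩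
    · by_cases hz0 : z = []
      · subst hz0
        exact ⟨[], FreeGroup.IsReduced.nil, hzmk', Or.inl hlt⟩
      obtain ⟨W, l₁, hl₁, rfl, hlen, -⟩ := exists_segmented (N := N) hz hz0
      obtain ⟨l', htrim, hleg, hred'⟩ := hl₁.fold (by simp)
      have hmk := htrim.mk_flatten (c.fd (N + 1)).mapWord_append
      have hlen' := htrim.length_eq
      rw [List.length_cons] at hlen'
      have := illCount_flatten_lt hleg (by rw [← List.length_pos_iff]; omega)
      exact ⟨l'.flatten, hred', hmk.symm.trans hzmk', Or.inl (by omega)⟩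
    · have hlen := htrim.length_eq
      obtain ⟨l'', htrim', hleg, hred'⟩ := hl'.fold (by
        rintro rfl
        exact hne (List.length_eq_zero_iff.1 hlen.symm))
      have hmk := htrim'.mk_flatten (c.fd (N + 1)).mapWord_append
      have hlen' := htrim'.length_eq
      refine ⟨l''.flatten, hred', hmk.symm.trans hzmk', ?_⟩
      by_cases hle : l''.length ≤ c.illCount (N + 1) l''.flatten + 1
      · exact Or.inr ⟨l'', segmented_of_le_illCount hleg hle, rfl,
          htrim.comp (c.fd (N + 1)).mapWord_append (c.fd (N + 1)).mapWord_invRev htrim'⟩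
      · exact Or.inl (by omega)

theorem junction_mul {p : ℕ} {v w : EdgeWord r} : c.Junction (p * n) v w ↔ c.Junction 0 v w := by
  simp [Junction]

theorem illCount_mul (p : ℕ) (w : EdgeWord r) : c.illCount (p * n) w = c.illCount 0 w := by
  induction w with
  | nil => rfl
  | cons x w ih =>
    classical
    have e : c.Junction (p * n) [x] w ↔ c.Junction 0 [x] w := junction_mul
    rw [illCount_cons, illCount_cons, ih, if_congr e rfl rfl]

theorem Segmented.append {N : ℕ} {l₁ l₂ : List (EdgeWord r)} {V W : EdgeWord r}
    (h₁ : c.Segmented N (V :: l₁)) (h₂ : c.Segmented N (W :: l₂))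
    (hne : ∀ U ∈ (V :: l₁).getLast?, U ≠ []) (hne' : W ≠ [])
    (hj : c.Junction N (V :: l₁).flatten (W :: l₂).flatten) :
    c.Segmented N ((V :: l₁) ++ (W :: l₂)) := by
  refine ⟨fun U hU => ?_, List.IsChain.append h₁.chain h₂.chain ?_⟩
  · rcases List.mem_append.1 hU with hU | hU
    · exact h₁.legal U hU
    · exact h₂.legal U hU
  · intro U hU U' hU'
    rw [List.head?_cons, Option.mem_def, Option.some.injEq] at hU'
    subst hU'
    have hU0 := hne U hU
    obtain ⟨l, hl⟩ := List.getLast?_eq_some_iff.1 hU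
    rw [hl, List.flatten_append, List.flatten_cons, List.flatten_nil, List.append_nil] at hj
    exact (hj.of_append_left hU0).of_append_right hne'

theorem Segmented.getLast_ne_nil {N : ℕ} {l : List (EdgeWord r)} {V : EdgeWord r}
    (h : c.Segmented N (V :: l)) (hV : V ≠ []) : ∀ U ∈ (V :: l).getLast?, U ≠ [] := by
  have hch := h.chain
  clear h
  induction l generalizing V with
  | nil => simpa using hV
  | cons W l ih =>
    rw [List.getLast?_cons_cons]
    rw [List.isChain_cons_cons] at hch
    exact ih hch.1.right_ne_nil hch.2

/-- A tight word `w` whose image under `g ^ K` tightens to `σ w σ'`: behind every turn `T_0` there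
is a legal segment `W` with `g ^ K (W) = τ W σ'` if it is the last segment, and
`g ^ K (W) = τ W τ⁻¹` otherwise. -/
theorem exists_segment_of_junction {K : ℕ} {P S σ σ' : EdgeWord r}
    (hw : FreeGroup.IsReduced (P ++ S)) (hj : c.Junction 0 P S)
    (hmk : FreeGroup.mk (c.powWord K (P ++ S)) = FreeGroup.mk (σ ++ (P ++ S) ++ σ'))
    (hred : FreeGroup.IsReduced (σ ++ (P ++ S) ++ σ')) :
    FreeGroup.mk (c.powWord K S) = FreeGroup.mk (c.tau (K * n) ++ S ++ σ') ∧
    ∃ W, W ≠ [] ∧ c.Legal 0 W ∧ ((W = S ∧ c.powWord K W = c.tau (K * n) ++ W ++ σ') ∨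
      (c.powWord K W = c.tau (K * n) ++ W ++ FreeGroup.invRev (c.tau (K * n)) ∧
        ∃ S', S = W ++ S' ∧ c.Junction 0 W S')) := by
  have hP : FreeGroup.IsReduced P := hw.infix ⟨[], S, by simp⟩
  have hS : FreeGroup.IsReduced S := hw.infix ⟨P, [], by simp⟩
  obtain ⟨V, lP, hlP, rfl, hlenP, hV⟩ := exists_segmented (c := c) (N := 0) hP hj.left_ne_nil
  obtain ⟨W, lS, hlS, rfl, hlenS, hW⟩ := exists_segmented (c := c) (N := 0) hS hj.right_ne_nil
  have hl := hlP.append hlS (hlP.getLast_ne_nil hV) hW hj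
  obtain ⟨z, hz, hzmk, hcase⟩ := hl.evolve (by simp) (by rw [List.flatten_append]; exact hw) (K * n)
  rw [List.flatten_append, ← powWord, hmk] at hzmk
  obtain rfl := eq_of_mk_eq hz hred hzmk
  rw [illCount_mul] at hcase
  set P := (V :: lP).flatten with hPdef
  set S := (W :: lS).flatten with hSdef
  have hc1 : c.illCount 0 σ + c.illCount 0 P ≤ c.illCount 0 (σ ++ P) := illCount_append_le _ _ _
  have hc2 : c.illCount 0 S + c.illCount 0 σ' ≤ c.illCount 0 (S ++ σ') := illCount_append_le _ _ _
  have hassoc : σ ++ (P ++ S) ++ σ' = (σ ++ P) ++ (S ++ σ') := by simp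
  have hj' : c.Junction 0 (σ ++ P) (S ++ σ') := (hj.append_left _).append_right _
  -- The number of turns cannot have dropped, because the tightened image contains `P ++ S` with all
  -- its turns T_0.
  rcases hcase with hlt | ⟨l', hl', hflat, htrim⟩
  · rw [hassoc, illCount_append_of_junction hj', List.length_append, List.length_cons,
      List.length_cons] at hlt
    omega
  have hleg : ∀ U ∈ l', c.Legal 0 U := fun U hU => legal_mul.1 (hl'.legal U hU)
  obtain ⟨l₁', l₂', rfl, hlen₁, htrim₂⟩ := htrim.split (by simp) (by simp)
  have hlen₂ := htrim₂.length_eq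
  rw [List.length_cons] at hlen₁ hlen₂
  have hleg₁ : ∀ U ∈ l₁', c.Legal 0 U := fun U hU => hleg U (List.mem_append_left _ hU)
  have hleg₂ : ∀ U ∈ l₂', c.Legal 0 U := fun U hU => hleg U (List.mem_append_right _ hU)
  have hi₁ := illCount_flatten_lt hleg₁ (by rw [← List.length_pos_iff]; omega)
  have hi₂ := illCount_flatten_lt hleg₂ (by rw [← List.length_pos_iff]; omega)
  rw [List.flatten_append, hassoc] at hflat
  -- The numbers of segments in front of and behind the chosen turn are preserved, which locates
  -- this turn in the image.
  obtain ⟨hf₁, hf₂⟩ := eq_of_append_eq_append hflat hj' (by omega) (by omega)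
  have hWl := hlS.legal W List.mem_cons_self
  have hmkS := htrim₂.mk_flatten (c.genWord_append (K * n))
  rw [hf₂, ← List.append_assoc] at hmkS
  refine ⟨hmkS, W, hW, hWl, ?_⟩
  cases htrim₂ with
  | single _ _ W' e =>
    simp only [List.flatten_cons, List.flatten_nil, List.append_nil] at hf₂ hSdef
    refine Or.inl ⟨hSdef.symm, ?_⟩
    rw [powWord, e, hf₂, hSdef, List.append_assoc]
  | cons _ _ W' W₂ lS l₂' e htrim₃ =>
    right
    have hj₂ := (List.isChain_cons_cons.1 hlS.chain).1
    set S' := (W₂ :: lS).flatten with hS'def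
    have hSW : S = W ++ S' := by rw [hSdef, List.flatten_cons]
    have hj₃ : c.Junction 0 W S' := by rw [hS'def, List.flatten_cons]; exact hj₂.append_right _
    refine ⟨?_, S', hSW, hj₃⟩
    have hi₃ := illCount_flatten_lt (l := l₂')
      (fun U hU => hleg₂ U (List.mem_cons_of_mem _ hU))
      (by rw [← List.length_pos_iff, htrim₃.length_eq]; simp)
    have hlen₃ := htrim₃.length_eq
    rw [List.length_cons] at hlen₃ hlenS
    have hc3 : c.illCount 0 S' + c.illCount 0 σ' ≤ c.illCount 0 (S' ++ σ') :=
      illCount_append_le _ _ _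
    have hW' := (hleg₂ W' List.mem_cons_self).illCount_eq_zero
    have hW0 := hWl.illCount_eq_zero
    have hc4 : c.illCount 0 S = c.illCount 0 W + c.illCount 0 S' + 1 := by
      rw [hSW, illCount_append_of_junction hj₃]
    rw [List.flatten_cons, hSW, List.append_assoc] at hf₂
    obtain ⟨rfl, -⟩ := eq_of_append_eq_append hf₂ (hj₃.append_right σ') (by omega) (by omega)
    rw [powWord, e]

end AdmissibleComposition

/-! ### Fixed endpoints and the tightened image of a periodic Nielsen path -/

namespace AdmissibleComposition

variable {c : AdmissibleComposition r n}

namespace Metric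

variable (m : c.Metric)

theorem exists_of_locate_eq_some {V : EdgeWord r} {t d : ℝ} {i : Fin r}
    (h : (m.locate V t).2 = some (i, d)) :
    ∃ σ y κ, V = σ ++ y :: κ ∧ y.1 = i ∧ 0 < t - m.length σ ∧ t - m.length σ < m.len y.1 ∧
      m.locate V t = translate (FreeGroup.mk σ) (m.locate [y] (t - m.length σ)) := by
  induction V generalizing t with
  | nil => simp [locate] at h
  | cons x V ih =>
    rcases le_or_gt t 0 with h0 | h0
    · rw [locate_of_nonpos _ _ h0] at h; simp at h
    by_cases hs : t < m.len x.1
    · rw [m.locate_cons_of_lt x V hs] at h ⊢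
      refine ⟨[], x, V, rfl, ?_, by simpa using h0, by simpa using hs, ?_⟩
      · cases hx : x.2 with
        | true =>
          rw [m.locate_singleton_true x hx h0 hs] at h
          simpa using congrArg (·.1) (Option.some.inj h)
        | false =>
          rw [m.locate_singleton_false x hx h0 hs] at h
          simpa using congrArg (·.1) (Option.some.inj h)
      · rw [length_nil, sub_zero, ← FreeGroup.one_eq_mk, translate_one]
    · push Not at hs
      rw [locate_cons_of_le _ _ _ hs] at h ⊢
      obtain ⟨σ, y, κ, rfl, h1, h2, h3, h4⟩ := ih h
      rw [sub_sub] at h2 h3 h4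
      refine ⟨x :: σ, y, κ, rfl, h1, h2, h3, ?_⟩
      rw [h4, translate_translate, ← mk_append]
      rfl

theorem locate_singleton_snd {x : Dir r} {s : ℝ} (h0 : 0 < s) (h : s < m.len x.1) :
    (m.locate [x] s).2 = some (x.1, if x.2 then s else m.len x.1 - s) := by
  cases hx : x.2 with
  | true => rw [m.locate_singleton_true x hx h0 h]; simp
  | false => rw [m.locate_singleton_false x hx h0 h]; simp

theorem legal_singleton (x : Dir r) : c.Legal 0 [x] := List.isChain_singleton x

/-- An endpoint inside the edge `x` that is fixed up to a translation: `g ^ (2 * k) (x)` crosses `x`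
in the positive direction at the fixed point. -/
theorem exists_prefix_of_fixed {k : ℕ} {x : Dir r} {s : ℝ} {h : FreeGroup (Fin r)} (h0 : 0 ≤ s)
    (hs : s < m.len x.1)
    (hfix : m.locate (c.powWord k [x]) (m.stretch ^ k * s) = translate h (m.locate [x] s)) :
    ∃ σ, powHom c k h * h = FreeGroup.mk σ ∧ FreeGroup.IsReduced (σ ++ [x]) ∧
      m.length σ = (m.stretch ^ (k + k) - 1) * s := by
  rcases h0.eq_or_lt with rfl | h0
  · rw [mul_zero, locate_of_nonpos _ _ le_rfl, locate_of_nonpos _ _ le_rfl] at hfix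
    have : h = 1 := by simpa [translate] using (congrArg Prod.fst hfix).symm
    subst this
    exact ⟨[], by simp [← FreeGroup.one_eq_mk], by simp, by simp⟩
  have hsnd : (m.locate (c.powWord k [x]) (m.stretch ^ k * s)).2 =
      some (x.1, if x.2 then s else m.len x.1 - s) := by
    rw [hfix]; exact m.locate_singleton_snd h0 hs
  obtain ⟨σ, y, κ, hV, hy, t0, t1, hloc⟩ := m.exists_of_locate_eq_some hsnd
  rw [hloc] at hsnd hfix
  have hsnd' := m.locate_singleton_snd t0 t1
  have hred := ((legal_singleton (c := c) x).powWord (k + k)).isReduced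
  have hpow : c.powWord (k + k) [x] = c.powWord k σ ++ c.powWord k [y] ++ c.powWord k κ := by
    rw [powWord_add, hV]
    unfold powWord
    rw [genWord_append, genWord_cons, List.append_assoc]
  have hlen := m.length_powWord k [x]
  rw [hV] at hlen
  simp only [length_append, length_cons, length_nil, add_zero] at hlen
  -- At the fixed point g^k(x) crosses either x or its inverse. The doubled power makes the
  -- direction positive in both cases.
  rcases eq_or_eq_bar hy with rfl | rfl
  · have ht : m.stretch ^ k * s - m.length σ = s := by
      have := Option.some.inj (hsnd'.symm.trans hsnd)
      cases hx : y.2 <;> simp [hx] at this <;> linarith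
    rw [ht] at hfix
    obtain rfl := translate_right_cancel hfix
    rw [hV] at hpow
    refine ⟨c.powWord k σ ++ σ, by rw [powHom_mk, mk_append], ?_, ?_⟩
    · rw [hpow] at hred
      exact hred.infix ⟨[], κ ++ c.powWord k κ, by simp⟩
    · rw [length_append, length_powWord, pow_add, show m.length σ = m.stretch ^ k * s - s by
        linarith]
      ring
  · have ht : m.stretch ^ k * s - m.length σ = m.len x.1 - s := by
      have := Option.some.inj (hsnd'.symm.trans hsnd)
      cases hx : x.2 <;> simp [hx, bar] at this <;> linarith
    rw [ht, m.locate_bar x h0 hs, translate_translate] at hfix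
    obtain rfl := translate_right_cancel hfix
    have hbar : c.powWord k [bar x] = FreeGroup.invRev κ ++ [x] ++ FreeGroup.invRev σ := by
      rw [← invRev_singleton, powWord, genWord_invRev, ← powWord, hV, FreeGroup.invRev_append,
        invRev_cons', bar_bar]
    rw [hbar] at hpow
    -- From g^k(x) = σ x⁻¹ κ one gets g^k(x⁻¹) = κ⁻¹ x σ⁻¹, so the x at the fixed point of g^{2k}(x)
    -- is preceded by g^k(σ) κ⁻¹.
    refine ⟨c.powWord k σ ++ FreeGroup.invRev κ, ?_, ?_, ?_⟩
    · rw [map_mul, map_inv, powHom_mk, powHom_mk, mk_append, mk_invRev_mul, hV, mk_append,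
        ← List.singleton_append (x := bar x), mk_append, ← invRev_singleton, mk_invRev_mul]
      group
    · rw [hpow] at hred
      exact hred.infix ⟨[], FreeGroup.invRev σ ++ c.powWord k κ, by simp⟩
    · rw [bar_fst] at hlen
      rw [length_append, length_powWord, length_invRev, pow_add,
        show m.length κ = m.stretch ^ k * m.len x.1 - m.len x.1 - m.length σ by linarith,
        show m.length σ = m.stretch ^ k * s - (m.len x.1 - s) by linarith]
      ring

variable {m} in
theorem isReduced_extend {σ w σ' : EdgeWord r} {x y : Dir r} (hw : FreeGroup.IsReduced w)
    (hx : w.head? = some x) (hy : w.getLast? = some y) (h1 : FreeGroup.IsReduced (σ ++ [x]))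
    (h2 : FreeGroup.IsReduced ([y] ++ σ')) : FreeGroup.IsReduced (σ ++ w ++ σ') := by
  have hne : w ≠ [] := by rintro rfl; simp at hx
  unfold FreeGroup.IsReduced at *
  refine List.IsChain.append (List.IsChain.append h1.left_of_append hw ?_) h2.right_of_append ?_
  · intro a ha b hb
    rw [hx] at hb
    exact (List.isChain_append.1 h1).2.2 a ha b (by simpa using hb)
  · intro a ha b hb
    rw [List.getLast?_append_of_ne_nil _ hne, hy] at ha
    exact (List.isChain_append.1 h2).2.2 a (by simpa using ha) b hb

section

variable [NeZero n]

/-- A periodic Nielsen path whose word has no superfluous edges, together with the tightened image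
`σ w σ'` of its word. -/
structure Core (w : EdgeWord r) (a b : ℝ) (K : ℕ) (σ σ' : EdgeWord r) : Prop where
  reduced : FreeGroup.IsReduced w
  nonneg : 0 ≤ a
  lt : a < b
  le : b ≤ m.length w
  start : m.length w.tail < m.length w - a
  finish : m.length w.dropLast < b
  one_le : 1 ≤ K
  mk_pow : FreeGroup.mk (c.powWord K w) = FreeGroup.mk (σ ++ w ++ σ')
  reduced_pow : FreeGroup.IsReduced (σ ++ w ++ σ')
  length_left : m.length σ = (m.stretch ^ K - 1) * a
  length_right : m.length σ' = (m.stretch ^ K - 1) * (m.length w - b)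
  fix_left : m.powPoint K (m.locate w a) = translate (FreeGroup.mk σ) (m.locate w a)
  fix_right : m.powPoint K (m.locate w b) = translate (FreeGroup.mk σ) (m.locate w b)

theorem powPoint_add (k l : ℕ) (w : EdgeWord r) (s : ℝ) :
    m.powPoint l (m.powPoint k (m.locate w s)) = m.powPoint (k + l) (m.locate w s) := by
  rw [← locate_powWord, ← locate_powWord, ← locate_powWord, powWord_add, pow_add, ← mul_assoc,
    mul_comm (m.stretch ^ l)]

/-- The fixed endpoints lie in the first and the last edge. In the squared image these edges are
crossed positively at the fixed points, which gives a beginning σ and, read backwards, an end σ',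
while one and the same translation relates both endpoints to their images. Since σ and the first
edge, and the last edge and σ', fit together tightly, σ w σ' is the tightened image. -/
theorem exists_core {w : EdgeWord r} {a b : ℝ} {k : ℕ} (hk : 0 < k)
    (hw : FreeGroup.IsReduced w) (ha : 0 ≤ a) (hab : a < b) (hb : b ≤ m.length w)
    (hstart : m.length w.tail < m.length w - a) (hfinish : m.length w.dropLast < b)
    (h : m.Homotopic (m.image k ⟨w, a, b⟩) ⟨w, a, b⟩) :
    ∃ σ σ', m.Core w a b (k + k) σ σ' := by
  have hne : w ≠ [] := by
    rintro rfl
    rw [length_nil] at hb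
    linarith
  obtain ⟨h', e1, e2⟩ := m.homotopic_iff.1 h.symm
  simp only [image] at e1 e2
  rw [locate_powWord] at e1 e2
  obtain ⟨x, w₁, hx⟩ := List.exists_cons_of_ne_nil hne
  have hy : w = w.dropLast ++ [w.getLast hne] := (List.dropLast_append_getLast hne).symm
  set y := w.getLast hne with hydef
  set w₂ := w.dropLast with hw₂
  have hxa : a < m.len x.1 := by
    rw [hx, List.tail_cons, length_cons] at hstart
    linarith
  have hlw : m.length w = m.length w₂ + m.len y.1 := by
    conv_lhs => rw [hy]
    simp
  have hyb : m.length w - b < m.len (bar y).1 := by rw [bar_fst]; linarith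
  have hlocA : m.locate w a = m.locate [x] a := by rw [hx, m.locate_cons_of_lt x w₁ hxa]
  -- The terminal endpoint is read from the end of the word, along the last edge reversed, so that
  -- the same lemma serves both ends.
  have hlocB : m.locate w b =
      translate (FreeGroup.mk w) (m.locate [bar y] (m.length w - b)) := by
    have e := m.locate_invRev w (ha.trans hab.le) hb
    have e' : FreeGroup.invRev w = bar y :: FreeGroup.invRev w₂ := by
      conv_lhs => rw [hy]
      rw [FreeGroup.invRev_append]; rfl
    rw [e', m.locate_cons_of_lt _ _ hyb] at e
    rw [e, translate_translate, mul_inv_cancel, translate_one]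
  rw [hlocA, ← locate_powWord] at e1
  rw [hlocB, powPoint_translate, ← locate_powWord, translate_translate] at e2
  have e2' := congrArg (translate (powHom c k (FreeGroup.mk w))⁻¹) e2
  rw [translate_translate, translate_translate, inv_mul_cancel, translate_one] at e2'
  obtain ⟨σ, f1, f2, f3⟩ := m.exists_prefix_of_fixed ha hxa e1
  obtain ⟨ς, g1, g2, g3⟩ := m.exists_prefix_of_fixed (by linarith) hyb e2'
  have hΦ : powHom c (k + k) (FreeGroup.mk w) = powHom c k (powHom c k (FreeGroup.mk w)) := by
    rw [powHom_mk, powHom_mk, powHom_mk, powWord_add]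
  have hmk : FreeGroup.mk (c.powWord (k + k) w) =
      FreeGroup.mk (σ ++ w ++ FreeGroup.invRev ς) := by
    rw [← powHom_mk, hΦ, mk_append, mk_append, mk_invRev_mul, ← f1, ← g1]
    simp only [map_mul, map_inv]
    group
  have hfix : ∀ s, m.powPoint k (m.locate w s) = translate h' (m.locate w s) →
      m.powPoint (k + k) (m.locate w s) = translate (FreeGroup.mk σ) (m.locate w s) := by
    intro s hs
    rw [← powPoint_add, hs, powPoint_translate, hs, translate_translate, f1]
  refine ⟨σ, FreeGroup.invRev ς, hw, ha, hab, hb, hstart, hfinish, by omega, hmk, ?_, f3, ?_,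
    hfix a ?_, hfix b ?_⟩
  · refine isReduced_extend (x := x) (y := y) hw (by rw [hx]; rfl) (by rw [hy]; simp) f2 ?_
    have g2' := FreeGroup.isReduced_iff_reduce_eq.1 g2
    rw [FreeGroup.isReduced_iff_reduce_eq]
    have := FreeGroup.reduce_invRev (w := ς ++ [bar y])
    rw [g2', FreeGroup.invRev_append, invRev_singleton, bar_bar] at this
    exact this
  · rw [length_invRev, g3]
  · rw [hlocA, ← locate_powWord]; exact e1
  · rw [hlocB, powPoint_translate, ← locate_powWord, translate_translate]; exact e2

end

end Metric

end AdmissibleComposition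

theorem tail_invRev (w : EdgeWord r) :
    (FreeGroup.invRev w).tail = FreeGroup.invRev w.dropLast := by
  simp [FreeGroup.invRev, List.map_dropLast, List.tail_reverse]

theorem dropLast_invRev (w : EdgeWord r) :
    (FreeGroup.invRev w).dropLast = FreeGroup.invRev w.tail := by
  have := tail_invRev (FreeGroup.invRev w)
  rw [FreeGroup.invRev_invRev] at this
  rw [this, FreeGroup.invRev_invRev]

/-! ### The periodic pair at a turn T_0 of a periodic Nielsen path -/

namespace AdmissibleComposition

variable {c : AdmissibleComposition r n}

namespace Metric

variable {m : c.Metric}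

theorem fix_invRev {w σ σ' : EdgeWord r} {K : ℕ} {s : ℝ}
    (hmk : FreeGroup.mk (c.powWord K w) = FreeGroup.mk (σ ++ w ++ σ')) (h0 : 0 ≤ s)
    (h : s ≤ m.length w)
    (hs : m.powPoint K (m.locate w s) = translate (FreeGroup.mk σ) (m.locate w s)) :
    m.powPoint K (m.locate (FreeGroup.invRev w) (m.length w - s)) =
      translate (FreeGroup.mk (FreeGroup.invRev σ'))
        (m.locate (FreeGroup.invRev w) (m.length w - s)) := by
  rw [m.locate_invRev w h0 h, powPoint_translate, hs, map_inv, powHom_mk, hmk, translate_translate,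
    translate_translate, mk_append, mk_append, mk_invRev_mul]
  congr 1
  group

theorem Core.symm {w σ σ' : EdgeWord r} {a b : ℝ} {K : ℕ} (h : m.Core w a b K σ σ') :
    m.Core (FreeGroup.invRev w) (m.length w - b) (m.length w - a) K (FreeGroup.invRev σ')
      (FreeGroup.invRev σ) := by
  have hpow : c.powWord K (FreeGroup.invRev w) = FreeGroup.invRev (c.powWord K w) :=
    c.genWord_invRev _ _
  have hinv : FreeGroup.invRev σ' ++ FreeGroup.invRev w ++ FreeGroup.invRev σ =
      FreeGroup.invRev (σ ++ w ++ σ') := by simp [FreeGroup.invRev_append]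
  have hrev : ∀ {v : EdgeWord r}, FreeGroup.IsReduced v →
      FreeGroup.IsReduced (FreeGroup.invRev v) := by
    intro v hv
    rw [FreeGroup.isReduced_iff_reduce_eq] at *
    rw [FreeGroup.reduce_invRev, hv]
  have ha := h.nonneg
  have hab := h.lt
  have hb := h.le
  refine ⟨hrev h.reduced, by linarith, by linarith, by rw [length_invRev]; linarith, ?_, ?_,
    h.one_le, ?_, ?_, ?_, ?_, fix_invRev h.mk_pow (by linarith) hb h.fix_right,
    fix_invRev h.mk_pow ha (by linarith) h.fix_left⟩
  · rw [tail_invRev, length_invRev, length_invRev]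
    linarith [h.finish]
  · rw [dropLast_invRev, length_invRev]
    exact h.start
  · rw [hpow, hinv, mk_invRev_mul, mk_invRev_mul, h.mk_pow]
  · rw [hinv]; exact hrev h.reduced_pow
  · rw [length_invRev, h.length_right]
  · rw [length_invRev, length_invRev, h.length_left]
    ring

variable [NeZero n]

/-- If w were legal, its image would be the word σ w σ' without tightening, and the lengths would
give λ^K |w| = |w| + (λ^K - 1)(|w| - (b - a)), that is a = b. -/
theorem Core.exists_junction {w σ σ' : EdgeWord r} {a b : ℝ} {K : ℕ} (h : m.Core w a b K σ σ') :
    ∃ P S, w = P ++ S ∧ c.Junction 0 P S := by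
  have hne : w ≠ [] := by
    rintro rfl
    have := h.le
    rw [length_nil] at this
    linarith [h.lt, h.nonneg]
  obtain ⟨W, l, hl, hfl, -, hW⟩ := exists_segmented (c := c) (N := 0) h.reduced hne
  cases l with
  | nil =>
    exfalso
    rw [List.flatten_cons, List.flatten_nil, List.append_nil] at hfl
    subst hfl
    have hleg := hl.legal W List.mem_cons_self
    have e := congrArg m.length
      (eq_of_mk_eq (hleg.powWord K).isReduced h.reduced_pow h.mk_pow)
    rw [length_powWord, length_append, length_append, h.length_left, h.length_right] at e
    have := m.one_lt_pow_stretch h.one_le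
    nlinarith [h.lt]
  | cons V l =>
    refine ⟨W, (V :: l).flatten, by rw [← hfl, List.flatten_cons], ?_⟩
    rw [List.flatten_cons]
    exact (List.isChain_cons_cons.1 hl.chain).1.append_right _

/-- The side behind a turn `T_0` of a periodic Nielsen path. -/
theorem Core.side {P S σ σ' : EdgeWord r} {a b : ℝ} {K : ℕ} (h : m.Core (P ++ S) a b K σ σ')
    (hj : c.Junction 0 P S) : ∃ p, p <+: S ∧ m.EndsInLast p m.halfLength ∧ c.Legal 0 p ∧
      c.tau (K * n) ++ p <+: c.powWord K p ∧ m.length P + m.halfLength ≤ b ∧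
      (m.length P + m.halfLength = b ∨ (m.length P + m.halfLength < b ∧
        m.powPoint K (m.locate (P ++ S) (m.length P + m.halfLength)) =
          translate (FreeGroup.mk σ) (m.locate (P ++ S) (m.length P + m.halfLength)))) := by
  have hL := m.halfLength_pos
  have hK := m.one_lt_pow_stretch h.one_le
  obtain ⟨hmkS, W, hW, hleg, hcase⟩ :=
    exists_segment_of_junction h.reduced hj h.mk_pow h.reduced_pow
  have hpre : W <+: S := by
    rcases hcase with ⟨rfl, -⟩ | ⟨-, S', rfl, -⟩
    · exact List.prefix_rfl
    · exact List.prefix_append _ _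
  have hgW : c.tau (K * n) ++ W <+: c.powWord K W := by
    rcases hcase with ⟨-, e⟩ | ⟨e, -⟩ <;> rw [e] <;> exact List.prefix_append _ _
  have hle := h.le
  rw [length_append] at hle
  have key : m.halfLength ≤ m.length W ∧ m.length P + m.halfLength ≤ b ∧
      (m.length P + m.halfLength = b ∨ (m.length P + m.halfLength < b ∧
        m.powPoint K (m.locate (P ++ S) (m.length P + m.halfLength)) =
          translate (FreeGroup.mk σ) (m.locate (P ++ S) (m.length P + m.halfLength)))) := by
    rcases hcase with ⟨rfl, e⟩ | ⟨e, S', rfl, hj'⟩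
    -- Last segment: comparing lengths in g^K(W) = τ W σ' yields |P| + L = b, so the path ends
    -- exactly at distance L behind the turn.
    · have e' := congrArg m.length e
      rw [length_powWord, length_append, length_append, length_tau, h.length_right,
        length_append] at e'
      have e3 : (m.stretch ^ K - 1) * (m.length P + m.halfLength - b) = 0 := by linarith
      rcases mul_eq_zero.1 e3 with e4 | e4
      · linarith
      · exact ⟨by linarith, by linarith, Or.inl (by linarith)⟩
    -- Inner segment: g^K(W) = τ W τ⁻¹ yields |W| = 2L, so its midpoint is fixed and lies before the
    -- end of the path.
    · have e' := congrArg m.length e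
      rw [length_powWord, length_append, length_append, length_invRev, length_tau] at e'
      have e3 : (m.stretch ^ K - 1) * (m.length W - 2 * m.halfLength) = 0 := by linarith
      have e4 : m.length W = 2 * m.halfLength := by
        rcases mul_eq_zero.1 e3 with e4 | e4 <;> linarith
      have hS' := m.length_nonneg S'.dropLast
      have hfin := h.finish
      rw [← List.append_assoc, List.dropLast_append_of_ne_nil hj'.right_ne_nil, length_append,
        length_append] at hfin
      refine ⟨by linarith, by linarith, Or.inr ⟨by linarith, ?_⟩⟩
      have hloc : m.locate (P ++ (W ++ S')) (m.length P + m.halfLength) =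
          translate (FreeGroup.mk P) (m.locate W m.halfLength) := by
        rw [locate_append_right _ _ _ hL.le, locate_append_left _ _ _ (by linarith)]
      have hlW : m.powPoint K (m.locate W m.halfLength) =
          translate (FreeGroup.mk (c.tau (K * n))) (m.locate W m.halfLength) := by
        rw [← locate_powWord, e, List.append_assoc,
          show m.stretch ^ K * m.halfLength = m.length (c.tau (K * n)) + m.halfLength by
            rw [length_tau]; ring,
          locate_append_right _ _ _ hL.le, locate_append_left _ _ _ (by linarith)]
      -- Cancel the image of S, which is τ S σ', from that of P S, which is σ P S σ'.
      have hP : FreeGroup.mk (c.powWord K P) * FreeGroup.mk (c.tau (K * n)) =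
          FreeGroup.mk σ * FreeGroup.mk P := by
        have e5 := h.mk_pow
        rw [powWord, genWord_append, ← powWord, ← powWord, mk_append, hmkS] at e5
        simp only [mk_append] at e5
        simp only [mul_assoc] at e5
        simp only [← mul_assoc] at e5
        exact mul_right_cancel (mul_right_cancel (mul_right_cancel e5))
      rw [hloc, powPoint_translate, hlW, translate_translate, translate_translate, powHom_mk, hP]
  obtain ⟨hlW, hb, hfix⟩ := key
  obtain ⟨p, hp, hpe⟩ := m.exists_prefix_endsInLast hL hlW
  refine ⟨p, hp.trans hpre, hpe, hleg.infix hp.isInfix, ?_, hb, hfix⟩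
  refine m.prefix_of_length_le (w := c.powWord K W) ?_ (c.genWord_prefix hp) ?_
  · exact List.IsPrefix.trans ((List.prefix_append_right_inj _).2 hp) hgW
  · rw [length_append, length_tau, length_powWord]
    nlinarith [hpe.2]

/-- The two sides of a periodic Nielsen path at a turn `T_0`. -/
theorem Core.goodPair {P S σ σ' : EdgeWord r} {a b : ℝ} {K : ℕ} (h : m.Core (P ++ S) a b K σ σ')
    (hj : c.Junction 0 P S) : ∃ p q, p <+: FreeGroup.invRev P ∧ q <+: S ∧
      (m.GoodPair p q ∨ m.GoodPair q p) ∧ a ≤ m.length P - m.halfLength ∧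
      m.length P + m.halfLength ≤ b ∧
      ((m.length P - m.halfLength = a ∧ m.length P + m.halfLength = b) ∨ ∃ t, a < t ∧ t < b ∧
        m.powPoint K (m.locate (P ++ S) t) =
          translate (FreeGroup.mk σ) (m.locate (P ++ S) t)) := by
  have hL := m.halfLength_pos
  obtain ⟨q, hqS, hqe, hql, hqp, hb, hqf⟩ := h.side hj
  have hsym := h.symm
  have hab := h.lt
  have ha := h.nonneg
  have hble := h.le
  rw [FreeGroup.invRev_append] at hsym
  obtain ⟨p, hpP, hpe, hpl, hpp, ha', hpf⟩ := hsym.side hj.invRev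
  simp only [length_append, length_invRev] at ha' hpf hble
  refine ⟨p, q, hpP, hqS, ?_, by linarith, hb, ?_⟩
  · obtain ⟨x, hx, y, hy, hxy⟩ := hj
    have hp0 := EndsInLast.ne_nil m hL hpe
    have hq0 := EndsInLast.ne_nil m hL hqe
    have hq : q.head? = some y := by
      obtain ⟨s, rfl⟩ := hqS
      rwa [List.head?_append_of_ne_nil _ hq0] at hy
    have hp : p.head? = some (bar x) := by
      obtain ⟨s, hs⟩ := hpP
      have : (FreeGroup.invRev P).head? = some (bar x) := by rw [head?_invRev, hx]; rfl
      rwa [← hs, List.head?_append_of_ne_nil _ hp0] at this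
    rw [Nat.cast_zero, turn_zero, Sym2.eq_iff] at hxy
    rcases hxy with ⟨e1, e2⟩ | ⟨e1, e2⟩
    · left
      rw [e1] at hp
      rw [e2] at hq
      exact ⟨hp, hq, hpl, hql, hpe, hqe, K, h.one_le, hpp, hqp⟩
    · right
      rw [e1] at hp
      rw [e2] at hq
      exact ⟨hq, hp, hql, hpl, hqe, hpe, K, h.one_le, hqp, hpp⟩
  · have hPpos := m.length_pos hj.left_ne_nil
    rcases hqf with hqf | ⟨hqf, hfix⟩
    · rcases hpf with hpf | ⟨hpf, hfix⟩
      · exact Or.inl ⟨by linarith, hqf⟩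
      · right
        -- The fixed point found on the reversed path, measured from the other end.
        refine ⟨m.length P - m.halfLength, by linarith, by linarith, ?_⟩
        have e := h.symm.mk_pow
        rw [FreeGroup.invRev_append] at e
        have hS0 := m.length_nonneg S
        have := fix_invRev e (by linarith) (by simp only [length_append, length_invRev]; linarith)
          hfix
        simp only [length_append, length_invRev, ← FreeGroup.invRev_append,
          FreeGroup.invRev_invRev] at this
        rwa [show m.length P + m.length S - (m.length S + m.halfLength) =
          m.length P - m.halfLength by ring] at this
    · exact Or.inr ⟨_, by linarith, hqf, hfix⟩

end Metric

/-! ### Indivisible paths and the periodic pair -/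

namespace Metric

variable {m : c.Metric}

variable (m) in
/-- Removal of the edges of a word that a path does not meet. -/
theorem exists_trim {w₀ : EdgeWord r} {a b : ℝ} (ha : 0 ≤ a) (hab : a < b)
    (hb : b ≤ m.length w₀) : ∃ p w s, w₀ = p ++ w ++ s ∧ m.length p ≤ a ∧
      b ≤ m.length p + m.length w ∧ m.length w.tail < m.length w - (a - m.length p) ∧
      m.length w.dropLast < b - m.length p := by
  obtain ⟨v, ⟨s, rfl⟩, hv⟩ := m.exists_prefix_endsInLast (ha.trans_lt hab) hb
  obtain ⟨u, ⟨t, ht⟩, hu⟩ := m.exists_prefix_endsInLast (w := FreeGroup.invRev v)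
    (L := m.length v - a) (by linarith [hv.2]) (by rw [length_invRev]; linarith)
  have hu0 := EndsInLast.ne_nil m (by linarith [hv.2]) hu
  have e : v = FreeGroup.invRev t ++ FreeGroup.invRev u := by
    rw [← FreeGroup.invRev_append, ht, FreeGroup.invRev_invRev]
  have hl := congrArg m.length e
  rw [length_append, length_invRev, length_invRev] at hl
  have h1 := hu.1
  have h2 := hu.2
  have h3 := hv.1
  rw [e, List.dropLast_append_of_ne_nil (by simpa [invRev_eq_nil] using hu0), length_append,
    length_invRev] at h3
  refine ⟨FreeGroup.invRev t, FreeGroup.invRev u, s, by rw [e], ?_, ?_, ?_, ?_⟩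
  · rw [length_invRev]; linarith
  · rw [length_invRev, length_invRev]; linarith [hv.2]
  · rw [tail_invRev, length_invRev, length_invRev, length_invRev]; linarith
  · rw [length_invRev]; linarith

theorem locate_infix {p w s : EdgeWord r} {t : ℝ} (h : m.length p ≤ t)
    (h' : t ≤ m.length p + m.length w) :
    m.locate (p ++ w ++ s) t = translate (FreeGroup.mk p) (m.locate w (t - m.length p)) := by
  rw [locate_append_left _ _ _ (by rwa [length_append]), ← locate_append_right _ _ _
    (by linarith), add_sub_cancel]

variable [NeZero n]

theorem IsPNP.exists_core {ρ : MPath r} (h : m.IsPNP ρ) : ∃ p w s K σ σ',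
    ρ.word = p ++ w ++ s ∧ m.length p ≤ ρ.a ∧ ρ.b ≤ m.length p + m.length w ∧
      m.Core w (ρ.a - m.length p) (ρ.b - m.length p) K σ σ' := by
  obtain ⟨⟨hred, ha, hab, hb⟩, k, hk, hhom⟩ := h
  obtain ⟨p, w, s, e, h1, h2, h3, h4⟩ := m.exists_trim ha hab hb
  have key : m.Homotopic ρ ⟨w, ρ.a - m.length p, ρ.b - m.length p⟩ := by
    refine Homotopic.symm (m.homotopic_iff.2 ⟨FreeGroup.mk p, ?_, ?_⟩)
    · rw [e, locate_infix h1 (by linarith)]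
    · rw [e, locate_infix (by linarith) h2]
  have hw : FreeGroup.IsReduced w := by
    rw [e] at hred
    exact hred.infix ⟨p, s, rfl⟩
  obtain ⟨σ, σ', hc⟩ := m.exists_core hk hw (by linarith) (by linarith) (by linarith) h3 h4
    (((Homotopic.image m key k).symm.trans hhom).trans key)
  exact ⟨p, w, s, _, σ, σ', e, h1, h2, hc⟩

theorem IsPNP.exists_junction {ρ : MPath r} (h : m.IsPNP ρ) : ∃ P S, ρ.word = P ++ S ∧
    c.Junction 0 P S ∧ ρ.a < m.length P ∧ m.length P < ρ.b := by
  obtain ⟨p, w, s, K, σ, σ', e, -, -, hc⟩ := h.exists_core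
  obtain ⟨P, S, rfl, hj⟩ := hc.exists_junction
  obtain ⟨-, -, -, -, -, h1, h2, -⟩ := hc.goodPair hj
  have hL := m.halfLength_pos
  refine ⟨p ++ P, S ++ s, by rw [e]; simp, (hj.append_left p).append_right s, ?_, ?_⟩ <;>
  · rw [length_append]; linarith

/-- At each of its turns `T_0`, a periodic Nielsen path contains an indivisible one. -/
theorem IsPNP.goodPair {ρ : MPath r} (h : m.IsPNP ρ) {P S : EdgeWord r} (e : ρ.word = P ++ S)
    (hj : c.Junction 0 P S) (h1 : ρ.a < m.length P) (h2 : m.length P < ρ.b) :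
    ∃ p q, p <+: FreeGroup.invRev P ∧ q <+: S ∧ (m.GoodPair p q ∨ m.GoodPair q p) ∧
      ρ.a ≤ m.length P - m.halfLength ∧ m.length P + m.halfLength ≤ ρ.b ∧
      ((m.length P - m.halfLength = ρ.a ∧ m.length P + m.halfLength = ρ.b) ∨
        ∃ t, ρ.a < t ∧ t < ρ.b ∧ m.IsPNP ⟨ρ.word, ρ.a, t⟩ ∧ m.IsPNP ⟨ρ.word, t, ρ.b⟩) := by
  obtain ⟨p₀, w, s, K, σ, σ', e', ha, hb, hc⟩ := h.exists_core
  -- The turn lies strictly inside the path, so it survives the removal of the superfluous edges and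
  -- can be cut out of the trimmed word.
  obtain ⟨P', rfl⟩ := m.prefix_of_length_le (u := p₀) (v := P) (w := ρ.word)
    (by rw [e', List.append_assoc]; exact List.prefix_append _ _)
    (by rw [e]; exact List.prefix_append _ _) (by linarith)
  rw [length_append] at h1 h2
  have e'' : w ++ s = P' ++ S := by
    rw [e', List.append_assoc, List.append_assoc] at e
    exact List.append_cancel_left e
  obtain ⟨S', rfl⟩ := m.prefix_of_length_le (u := P') (v := w) (w := w ++ s)
    (by rw [e'']; exact List.prefix_append _ _) (List.prefix_append _ _) (by linarith)
  rw [List.append_assoc] at e''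
  obtain rfl := List.append_cancel_left e''
  have hP' : P' ≠ [] := by
    rintro rfl
    rw [length_nil] at h1
    linarith
  have hS' : S' ≠ [] := by
    rintro rfl
    rw [List.append_nil] at hb
    linarith
  obtain ⟨p, q, hp, hq, hg, b1, b2, b3⟩ :=
    hc.goodPair ((hj.of_append_left hP').of_append_right hS')
  refine ⟨p, q, ?_, hq.trans (List.prefix_append _ _), hg, by rw [length_append]; linarith,
    by rw [length_append]; linarith, ?_⟩
  · rw [FreeGroup.invRev_append]
    exact hp.trans (List.prefix_append _ _)
  rcases b3 with ⟨c1, c2⟩ | ⟨t, t1, t2, t3⟩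
  · left
    rw [length_append]
    exact ⟨by linarith, by linarith⟩
  right
  obtain ⟨⟨hred, ha0, hab, hb0⟩, -⟩ := h
  -- Fixed points of the trimmed word become fixed points of the whole one for a single translation,
  -- conjugated by the removed beginning; so any two of them bound a path homotopic to its image.
  have hfix : ∀ x, m.length p₀ ≤ x → x ≤ m.length p₀ + m.length (P' ++ S') →
      m.powPoint K (m.locate (P' ++ S') (x - m.length p₀)) =
        translate (FreeGroup.mk σ) (m.locate (P' ++ S') (x - m.length p₀)) →
      m.locate (c.powWord K ρ.word) (m.stretch ^ K * x) =
        translate (powHom c K (FreeGroup.mk p₀) * FreeGroup.mk σ * (FreeGroup.mk p₀)⁻¹)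
          (m.locate ρ.word x) := by
    intro x x1 x2 hx
    rw [locate_powWord, e', locate_infix x1 x2, powPoint_translate, hx, translate_translate,
      translate_translate]
    congr 1
    group
  have hA := hfix ρ.a ha (by linarith) hc.fix_left
  have hB := hfix ρ.b (by linarith) hb hc.fix_right
  have hT := hfix (m.length p₀ + t) (by linarith) (by linarith) (by rwa [add_sub_cancel_left])
  refine ⟨m.length p₀ + t, by linarith, by linarith,
    ⟨⟨hred, ha0, by dsimp only; linarith, by dsimp only; linarith⟩, K, hc.one_le, ?_⟩,
    ⟨⟨hred, by dsimp only; linarith, by dsimp only; linarith, hb0⟩, K, hc.one_le, ?_⟩⟩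
  · exact Homotopic.symm (m.homotopic_iff.2 ⟨_, hA, hT⟩)
  · exact Homotopic.symm (m.homotopic_iff.2 ⟨_, hT, hB⟩)

/-- The point at distance L is fixed on both sides, so the path is periodic. It is indivisible since
every pNp extends at least L to both sides of one of its turns T_0, so it has length at least 2L,
which leaves no room for a proper initial part. -/
theorem GoodPair.isIPNP {p q : EdgeWord r} (h : m.GoodPair p q) :
    m.IsIPNP (m.vee p q m.halfLength m.halfLength) := by
  have hL := m.halfLength_pos
  have hred : FreeGroup.IsReduced (FreeGroup.invRev p ++ q) := by
    rw [isReduced_iff_isChain]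
    refine List.IsChain.append (isReduced_iff_isChain.1 h.legal₁.invRev.isReduced)
      (isReduced_iff_isChain.1 h.legal₂.isReduced) ?_
    intro x hx y hy
    rw [getLast?_invRev, h.head₁] at hx
    rw [h.head₂] at hy
    simp only [Option.map_some, Option.mem_def, Option.some.injEq] at hx hy
    subst hx hy
    rw [bar_bar]
    exact (c.fold 1).ne
  have hp := h.ends₁.2
  have hq := h.ends₂.2
  refine ⟨⟨⟨hred, by simp only [vee]; linarith, by simp only [vee]; linarith,
    by simp only [vee, length_append, length_invRev]; linarith⟩, ?_⟩, ?_⟩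
  · obtain ⟨K, hK, ⟨σ₁, e1⟩, ⟨σ₂, e2⟩⟩ := h.periodic
    have key : ∀ v σ : EdgeWord r, m.halfLength ≤ m.length v →
        c.tau (K * n) ++ v ++ σ = c.powWord K v → m.powPoint K (m.locate v m.halfLength) =
          translate (FreeGroup.mk (c.tau (K * n))) (m.locate v m.halfLength) := by
      intro v σ hv e
      rw [← locate_powWord, ← e, show m.stretch ^ K * m.halfLength =
        m.length (c.tau (K * n)) + m.halfLength by rw [length_tau]; ring,
        locate_infix (by linarith) (by linarith), add_sub_cancel_left]
    refine ⟨K, hK, Homotopic.symm (m.homotopic_iff.2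
      ⟨(powHom c K (FreeGroup.mk p))⁻¹ * FreeGroup.mk (c.tau (K * n)) * FreeGroup.mk p, ?_, ?_⟩)⟩
    · simp only [image, vee]
      rw [locate_powWord, locate_vee_left _ hL.le hp, powPoint_translate, key p σ₁ hp e1,
        translate_translate, translate_translate, map_inv]
      congr 1
      group
    · simp only [image, vee]
      rw [locate_powWord, locate_vee_right _ hL.le, powPoint_translate, key q σ₂ hq e2,
        translate_translate, translate_translate, map_inv]
      congr 1
      group
  · rintro ⟨t, -, t2, ht, -⟩
    obtain ⟨P, S, e, hj, h1, h2⟩ := ht.exists_junction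
    obtain ⟨-, -, -, -, -, h3, h4, -⟩ := ht.goodPair e hj h1 h2
    simp only [vee] at h3 h4 t2
    linarith

/-- An indivisible periodic Nielsen path is given by a periodic pair. -/
theorem IsIPNP.exists_goodPair {ρ : MPath r} (h : m.IsIPNP ρ) : ∃ p q, m.GoodPair p q ∧
    (m.Homotopic ρ (m.vee p q m.halfLength m.halfLength) ∨
      m.Homotopic (m.reverse ρ) (m.vee p q m.halfLength m.halfLength)) := by
  have hL := m.halfLength_pos
  obtain ⟨P, S, e, hj, h1, h2⟩ := h.1.exists_junction
  obtain ⟨p, q, hp, hq, hg, -, -, h3⟩ := h.1.goodPair e hj h1 h2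
  rcases h3 with ⟨h3, h4⟩ | h3
  swap
  · exact absurd h3 h.2
  have hends : m.halfLength ≤ m.length p ∧ m.halfLength ≤ m.length q := by
    rcases hg with hg | hg
    · exact ⟨hg.ends₁.2, hg.ends₂.2⟩
    · exact ⟨hg.ends₂.2, hg.ends₁.2⟩
  have key : m.Homotopic ρ (m.vee p q m.halfLength m.halfLength) := by
    obtain ⟨p', hp'⟩ := hp
    obtain ⟨q', rfl⟩ := hq
    have eP : P = FreeGroup.invRev (p ++ p') := by rw [hp', FreeGroup.invRev_invRev]
    have hlP : m.length P = m.length (p ++ p') := by rw [eP, length_invRev]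
    have hle := m.length_nonneg p'
    refine m.homotopic_iff.2 ⟨(FreeGroup.mk p)⁻¹ * FreeGroup.mk (p ++ p'), ?_, ?_⟩
    · rw [← h3, e, hlP, eP, locate_vee_left _ hL.le (by rw [length_append]; linarith),
        locate_append_left _ _ _ hends.1]
      simp only [vee]
      rw [locate_vee_left _ hL.le hends.1, translate_translate]
      congr 1
      group
    · rw [← h4, e, hlP, eP, locate_vee_right _ hL.le, locate_append_left _ _ _ hends.2]
      simp only [vee]
      rw [locate_vee_right _ hL.le, translate_translate]
      congr 1
      group
  rcases hg with hg | hg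
  · exact ⟨p, q, hg, Or.inl key⟩
  · exact ⟨q, p, hg, Or.inr (m.homotopic_reverse_vee h.1.1 hL.le hends.2 hends.1 key)⟩

/-- The vertex between the two sides is a turn T_0, so the periodic pair sits there. Without its
last edge a prospective side is shorter than L, so it is an initial subpath of the periodic side. -/
theorem Contains.exists_goodPair {ρ : MPath r} (hρ : m.IsPNP ρ) {w₁ w₂ : EdgeWord r}
    (hw : m.Prospective w₁ w₂) (h : m.Contains ρ w₁ w₂) :
    ∃ p₁ p₂, m.GoodPair p₁ p₂ ∧ w₁ <+: p₁ ∧ w₂ <+: p₂ := by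
  obtain ⟨v₁, v₂, L₁, L₂, h₁, h₂, hred, he₁, he₂, hh⟩ := h
  have hpos₁ := (m.length_nonneg _).trans_lt he₁.1
  have hpos₂ := (m.length_nonneg _).trans_lt he₂.1
  have hd₁ : v₁.head? = some (c.fold 1).u := by
    obtain ⟨s, rfl⟩ := h₁
    rw [List.head?_append, hw.head₁]; rfl
  have hd₂ : v₂.head? = some (c.fold 1).a := by
    obtain ⟨s, rfl⟩ := h₂
    rw [List.head?_append, hw.head₂]; rfl
  have hp := hρ.of_homotopic hh ⟨hred, by simp only [vee]; linarith [he₁.2],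
    by simp only [vee]; linarith, by simp only [vee, length_append, length_invRev];
                                     linarith [he₂.2]⟩
  have hj : c.Junction 0 (FreeGroup.invRev v₁) v₂ := by
    refine ⟨bar (c.fold 1).u, by rw [getLast?_invRev, hd₁]; rfl, (c.fold 1).a, hd₂, ?_⟩
    rw [bar_bar, Nat.cast_zero, turn_zero]
  obtain ⟨p, q, hpv, hqv, hg, -⟩ := hp.goodPair (P := FreeGroup.invRev v₁) (S := v₂) rfl hj
    (by simp only [vee, length_invRev]; linarith) (by simp only [vee, length_invRev]; linarith)
  rw [FreeGroup.invRev_invRev] at hpv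
  rcases hg with hg | hg
  · exact ⟨p, q, hg, m.prefix_of_lt_of_le hw.short₁ hg.ends₁.2 h₁ hpv,
      m.prefix_of_lt_of_le hw.short₂ hg.ends₂.2 h₂ hqv⟩
  · exfalso
    obtain ⟨s, rfl⟩ := hqv
    rw [List.head?_append, hg.head₁] at hd₂
    exact (c.fold 1).ne (Option.some.inj hd₂).symm

end Metric

end AdmissibleComposition

/-! ### Existence of the metric: Perron–Frobenius -/

open Matrix in
/-- The Perron–Frobenius theorem: an irreducible matrix has a positive eigenvector. -/
theorem exists_pos_eigenvector {ι : Type*} [Fintype ι] [DecidableEq ι] [Nonempty ι]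
    {A : Matrix ι ι ℝ} (hA : A.IsIrreducible) :
    ∃ (v : ι → ℝ) (μ : ℝ), (∀ i, 0 < v i) ∧ A *ᵥ v = μ • v := by
  have h0 := hA.nonneg
  -- A sum of powers of A, one for each entry that has to become positive.
  obtain ⟨B, hB, hAB⟩ : ∃ B : Matrix ι ι ℝ, (∀ i j, 0 < B i j) ∧ A * B = B * A := by
    choose k _ hk using (isIrreducible_iff_exists_pow_pos h0).1 hA
    refine ⟨∑ q : ι × ι, A ^ k q.1 q.2, fun i j => ?_, ?_⟩
    · rw [Matrix.sum_apply]
      exact Finset.sum_pos' (fun q _ => pow_apply_nonneg h0 _ _ _)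
        ⟨(i, j), Finset.mem_univ _, hk i j⟩
    · rw [Finset.mul_sum, Finset.sum_mul]
      exact Finset.sum_congr rfl fun q _ => (pow_mul_comm' A _).symm
  have hBpos : ∀ x : ι → ℝ, (∀ i, 0 ≤ x i) → x ≠ 0 → ∀ i, 0 < (B *ᵥ x) i := by
    intro x hx hne i
    obtain ⟨j, hj⟩ := Function.ne_iff.1 hne
    exact Finset.sum_pos' (fun j _ => mul_nonneg (hB i j).le (hx j))
      ⟨j, Finset.mem_univ _, mul_pos (hB i j) ((hx j).lt_of_ne' hj)⟩
  set C := ∑ i, ∑ j, A i j with hC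
  have hC0 : 0 ≤ C := Finset.sum_nonneg fun i _ => Finset.sum_nonneg fun j _ => h0 i j
  have hbound : ∀ t : ℝ, ∀ x ∈ stdSimplex ℝ ι, (∀ i, t * x i ≤ (A *ᵥ x) i) → t ≤ C := by
    intro t x hx ht
    calc t = ∑ i, t * x i := by rw [← Finset.mul_sum, hx.2, mul_one]
      _ ≤ ∑ i, (A *ᵥ x) i := Finset.sum_le_sum fun i _ => ht i
      _ ≤ C := by
        refine Finset.sum_le_sum fun i _ => Finset.sum_le_sum fun j _ => ?_
        have hj : x j ≤ 1 := by
          rw [← hx.2]; exact Finset.single_le_sum (fun i _ => hx.1 i) (Finset.mem_univ j)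
        exact mul_le_of_le_one_right (h0 i j) hj
  have hcont : ∀ i, Continuous fun x : ι → ℝ => (A *ᵥ x) i := fun i =>
    (continuous_apply i).comp (Continuous.matrix_mulVec continuous_const continuous_id)
  -- The Collatz–Wielandt argument: among nonnegative vectors of sum 1, take the largest μ with μ x
  -- ≤ A x. It is attained by compactness.
  have hcomp : IsCompact ((Set.Icc 0 C ×ˢ stdSimplex ℝ ι) ∩
      {q : ℝ × (ι → ℝ) | ∀ i, q.1 * q.2 i ≤ (A *ᵥ q.2) i}) := by
    refine (isCompact_Icc.prod (isCompact_stdSimplex ℝ ι)).inter_right ?_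
    rw [Set.ofPred_forall]
    refine isClosed_iInter fun i => isClosed_le ?_ ((hcont i).comp continuous_snd)
    exact continuous_fst.mul ((continuous_apply i).comp continuous_snd)
  obtain ⟨i₀⟩ := ‹Nonempty ι›
  have hne : ((Set.Icc 0 C ×ˢ stdSimplex ℝ ι) ∩
      {q : ℝ × (ι → ℝ) | ∀ i, q.1 * q.2 i ≤ (A *ᵥ q.2) i}).Nonempty := by
    refine ⟨(0, Pi.single i₀ 1), ⟨⟨le_rfl, hC0⟩, single_mem_stdSimplex ℝ i₀⟩, fun i => ?_⟩
    simp [h0]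
  obtain ⟨⟨μ, x⟩, ⟨⟨⟨hμ, -⟩, hx⟩, hle⟩, hmax⟩ := hcomp.exists_isMaxOn hne continuous_fst.continuousOn
  dsimp only at hμ hx hle
  have hx0 : x ≠ 0 := by
    rintro rfl
    simpa using hx.2
  have hv := hBpos x hx.1 hx0
  have hcommB : A *ᵥ (B *ᵥ x) = B *ᵥ (A *ᵥ x) := by rw [mulVec_mulVec, mulVec_mulVec, hAB]
  suffices h : A *ᵥ x = μ • x from
    ⟨B *ᵥ x, μ, hv, by rw [hcommB, h, mulVec_smul]⟩
  by_contra hne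
  -- If A x ≠ μ x, applying B makes the inequality strict in every coordinate, so B x, after
  -- normalization, admits a factor larger than μ.
  have hy := hBpos (A *ᵥ x - μ • x) (fun i => by simpa using hle i) (sub_ne_zero.2 hne)
  rw [mulVec_sub, mulVec_smul, ← hcommB] at hy
  set v := B *ᵥ x with hvdef
  obtain ⟨i₁, hi₁⟩ := Finite.exists_min fun i => ((A *ᵥ v - μ • v) i) / v i
  set ε := ((A *ᵥ v - μ • v) i₁) / v i₁ with hε
  have hεpos : 0 < ε := div_pos (hy i₁) (hv i₁)
  have hle' : ∀ i, (μ + ε) * v i ≤ (A *ᵥ v) i := by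
    intro i
    have := (le_div_iff₀ (hv i)).1 (hi₁ i)
    simp only [Pi.sub_apply, Pi.smul_apply, smul_eq_mul] at this
    linarith
  set s := ∑ i, v i with hs
  have hspos : 0 < s := Finset.sum_pos (fun i _ => hv i) ⟨i₀, Finset.mem_univ _⟩
  have hmem : s⁻¹ • v ∈ stdSimplex ℝ ι := by
    refine ⟨fun i => mul_nonneg (inv_pos.2 hspos).le (hv i).le, ?_⟩
    simp only [Pi.smul_apply, smul_eq_mul]
    rw [← Finset.mul_sum, inv_mul_cancel₀ hspos.ne']
  have hle'' : ∀ i, (μ + ε) * (s⁻¹ • v) i ≤ (A *ᵥ (s⁻¹ • v)) i := by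
    intro i
    rw [mulVec_smul, Pi.smul_apply, Pi.smul_apply, smul_eq_mul, smul_eq_mul, mul_left_comm]
    exact mul_le_mul_of_nonneg_left (hle' i) (inv_pos.2 hspos).le
  have := hmax (a := (μ + ε, s⁻¹ • v))
    ⟨⟨⟨by dsimp only; linarith, hbound _ _ hmem hle''⟩, hmem⟩, hle''⟩
  dsimp only [Set.mem_ofPred_eq] at this
  linarith

theorem sum_map_eq_sum_countP (len : Fin r → ℝ) (w : EdgeWord r) :
    (w.map fun x => len x.1).sum =
      ∑ i, ((w.countP (fun x => x.1 = i) : ℕ) : ℝ) * len i := by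
  induction w with
  | nil => simp
  | cons x w ih =>
    simp only [List.map_cons, List.sum_cons, ih, List.countP_cons, Nat.cast_add, add_mul,
      Finset.sum_add_distrib]
    rw [add_comm]
    simp

namespace AdmissibleComposition

/-- Edge lengths form a left eigenvector of the transition matrix, hence the transpose. -/
theorem nonempty_metric (c : AdmissibleComposition r n) (h : c.transition.IsIrreducible) :
    Nonempty c.Metric := by
  have hne : Nonempty (Fin r) := ⟨(c.fold 1).u.1⟩
  obtain ⟨v, μ, hv, he⟩ := exists_pos_eigenvector h.transpose
  refine ⟨⟨v, μ, hv, fun j => ?_⟩⟩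
  rw [sum_map_eq_sum_countP]
  exact congrFun he j

end AdmissibleComposition

end PeriodicNielsen

/-! ### The main theorem -/

open PeriodicNielsen AdmissibleComposition Metric in
theorem mainTheorem3 {r n : ℕ} [NeZero n] (c : PeriodicNielsen.AdmissibleComposition r n)
    (htt : c.IsTrainTrack) (hirr : c.transition.IsIrreducible) :
    Nonempty c.Metric ∧ ∀ m : c.Metric,
      -- only finitely many prospective pairs arise, whatever powers of `g` are examined
      {q : PeriodicNielsen.EdgeWord r × PeriodicNielsen.EdgeWord r |
        ∃ b, c.Arises b q.1 q.2}.Finite ∧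
      -- every path that is found is an ipNp, and it is then the only one up to orientation
      (∀ b σ, c.Finds m b σ → m.IsIPNP σ ∧
        ∀ ρ, m.IsIPNP ρ → m.Homotopic ρ σ ∨ m.Homotopic (m.reverse ρ) σ) ∧
      -- boundedly many powers of `g` suffice
      (∃ b : ℕ,
        -- every ipNp is found
        (∀ ρ, m.IsIPNP ρ →
          ∃ σ, c.Finds m b σ ∧ (m.Homotopic ρ σ ∨ m.Homotopic (m.reverse ρ) σ)) ∧
        -- if no power up to `b` gives a comparison as in (IVa)-(IVd), the pair can be discarded
        (∀ b' w₁ w₂, c.Arises b' w₁ w₂ → (∀ N ≤ b * n, c.AtTurn N w₁ w₂) →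
          (∀ p ≤ b, ∀ τ γ₁ γ₂, c.Returns p w₁ w₂ τ γ₁ γ₂ →
            ¬ (PeriodicNielsen.AdmissibleComposition.Comparable γ₁ w₁ ∧
              PeriodicNielsen.AdmissibleComposition.Comparable γ₂ w₂)) →
          ∀ ρ, m.IsIPNP ρ → ¬ m.Contains ρ w₁ w₂)) ∧
      -- a pair that is ruled out does not belong to any ipNp
      (∀ b w₁ w₂, c.Arises b w₁ w₂ → c.RuledOut w₁ w₂ →
        ∀ ρ, m.IsIPNP ρ → ¬ m.Contains ρ w₁ w₂) ∧
      -- the procedure certifies the absence of pNps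
      List.TFAE [
        ∀ ρ, ¬ m.IsPNP ρ,
        ∀ ρ, ¬ m.IsIPNP ρ,
        ∀ b σ, ¬ c.Finds m b σ,
        c.RuledOut [(c.fold 1).u] [(c.fold 1).a]] := by
  refine ⟨c.nonempty_metric hirr, fun m => ⟨finite_arises m, ?_, ?_, ?_, ?_⟩⟩
  · intro b σ hσ
    obtain ⟨p, q, hg, rfl⟩ := Metric.Finds.exists_goodPair hσ
    refine ⟨hg.isIPNP, fun ρ hρ => ?_⟩
    obtain ⟨p', q', hg', h⟩ := hρ.exists_goodPair
    obtain ⟨rfl, rfl⟩ := hg.unique hg'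
    exact h
  · by_cases hex : ∃ p q, m.GoodPair p q
    · obtain ⟨p, q, hg⟩ := hex
      obtain ⟨b, hb⟩ := hg.finds
      obtain ⟨K, hK, hret⟩ := hg.exists_returns
      -- `b` is enough to output the periodic pair, and `K` is a power at which every truncation of
      -- it is comparable with its remainders.
      refine ⟨max b K, fun ρ hρ => ?_, fun b' w₁ w₂ hA hat hno ρ hρ hcon => ?_⟩
      · obtain ⟨p', q', hg', h⟩ := hρ.exists_goodPair
        obtain ⟨rfl, rfl⟩ := hg.unique hg'
        exact ⟨_, Finds.mono m (le_max_left _ _) hb, h⟩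
      · obtain ⟨p', q', hg', h₁, h₂⟩ := hcon.exists_goodPair hρ.1 (m.prospective_of_arises hA)
        obtain ⟨rfl, rfl⟩ := hg.unique hg'
        obtain ⟨γ₁, γ₂, σ₁, σ₂, hR, g₁, g₂⟩ := hret w₁ w₂ h₁ h₂ fun N hN =>
          hat N (hN.trans (Nat.mul_le_mul_right n (le_max_right _ _)))
        exact hno K (le_max_right _ _) _ _ _ hR
          ⟨comparable_of_prefix g₁ h₁, comparable_of_prefix g₂ h₂⟩
    -- Without a periodic pair there is no ipNp, and any bound will do.
    · refine ⟨0, fun ρ hρ => ?_, fun b' w₁ w₂ _ _ _ ρ hρ _ => ?_⟩ <;>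
      · obtain ⟨p, q, hg, -⟩ := hρ.exists_goodPair
        exact absurd ⟨p, q, hg⟩ hex
  · intro b w₁ w₂ hA hr ρ hρ hcon
    have hP := m.prospective_of_arises hA
    obtain ⟨p, q, hg, h₁, h₂⟩ := hcon.exists_goodPair hρ.1 hP
    exact hg.not_ruledOut hP h₁ h₂ hr
  · tfae_have 1 → 2 := fun h ρ hρ => h ρ hρ.1
    tfae_have 2 → 3 := by
      intro h b σ hσ
      obtain ⟨p, q, hg, rfl⟩ := Metric.Finds.exists_goodPair hσ
      exact h _ hg.isIPNP
    tfae_have 3 → 4 := by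
      intro h
      by_contra hr
      obtain ⟨p, q, hg⟩ := exists_goodPair_of_not_ruledOut m.prospective_start hr
      obtain ⟨b, hb⟩ := hg.finds
      exact h b _ hb
    tfae_have 4 → 1 := by
      intro hr ρ hρ
      obtain ⟨P, S, e, hj, h1, h2⟩ := hρ.exists_junction
      -- Divisible or not, a pNp contains the periodic pair at some turn T_0, and that pair extends
      -- the initial one.
      obtain ⟨p, q, -, -, hg | hg, -⟩ := hρ.goodPair e hj h1 h2 <;>
      exact hg.not_ruledOut m.prospective_start hg.start_prefix.1 hg.start_prefix.2 hr
    tfae_finish
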